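/- **Conventions.** All manifolds are finite-dimensional and smooth, and all vector bundles are smooth, real and of finite rank. A *double vector bundle* $D$ with side bundles $A,B\to M$ is a manifold with vector bundle structures $D\to A$ and $D\to B$ that satisfy the usual compatibility conditions (interchange laws). Its core $C\to M$ consists of the elements that project to zero in both $A$ and $B$. A *triple vector bundle* $E$ consists of * side bundles $E_1,E_2,E_3$ over a manifold $M$; * double vector bundles $E_{i,j}$ with sides $E_i,E_j$ (the lower faces, $\{i,j\}\subset\{1,2,3\}$); * a manifold $E_{1,2,3}$ with vector bundle structures over $E_{1,2}$, $E_{1,3}$, $E_{2,3}$, any two of which form a double vector bundle (an upper face). Let $E_{ij}$ be the core of $E_{i,j}$. Let $E_{123}$ be the ultracore, that is, the set of elements of $E_{1,2,3}$ that project to zero in all three lower faces over a point of $M$. The vector bundles $E_1,E_2,E_3,E_{12},E_{13},E_{23},E_{123}$ over $M$ are the *building bundles* of $E$. The *decomposed* triple vector bundle $\overline E$ is the fibre product over $M$ of the building bundles, with the evident structure. A *statomorphism* is an isomorphism of triple vector bundles that induces the identity on $M$ and on all building bundles. Part of the definition of a triple vector bundle is the *splitting condition*: there is a statomorphism $E\to\overline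 E$. For proper non-empty $I\subset\{0,1,2,3\}$, further bundles $E_I$ are defined for $0\in I$ by $E_I=E_{I^c}^*$, where $I^c$ is the complement. Identifying each bundle with its second dual, we have $E_I\cong E_{I^c}^*$ for all $I$. **Dualization.** The dual $E^X$ is obtained by dualizing the vector bundle $E_{1,2,3}\to E_{2,3}$. Its lower faces are $E_{2,3}$ and the duals, over $E_2$ and over $E_3$, of the core double vector bundles of the two upper faces that contain $E_{2,3}$. The projections and the additional additions are those of the usual duality of double vector bundles: $\langle\kappa(\Psi),c\rangle=\langle\Psi,\tilde 0+c\rangle$ for $c$ in the core, and $\langle\Psi+\Psi',x+x'\rangle=\langle\Psi,x\rangle+\langle\Psi',x'\rangle$. So $E^X$ is a triple vector bundle with building bundles $E_0,E_2,E_3,E_{02},E_{03},E_{23},E_{023}$ in the positions $1,2,3,12,13,23,123$. The duals $E^Y$ over $E_{1,3}$ and $E^Z$ over $E_{1,2}$ are defined in the same way, with $2$, respectively $3$, in the role of $1$. Let $\mathscr C$ be the category of triple vector bundles with statomorphisms as morphisms. Then $X,Y,Z$ are functors $\mathscr C\to\mathscr C^{op}$; since all morphisms are invertible, we regard them as functors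 $\mathscr C\to\mathscr C$ by inverting the images of morphisms. Write $E^{VW}=(E^V)^W$. **Theorem.** Modulo natural isomorphism through statomorphisms, $X$, $Y$ and $Z$ are invertible. Let $\mathscr{DG}_3$ be the group that their classes generate. There is a homomorphism $\pi:\mathscr{DG}_3\to S_4$ into the permutations of $\{0,1,2,3\}$ such that $\pi(X)=(0\,1)$, $\pi(Y)=(0\,2)$, $\pi(Z)=(0\,3)$ and, for all $W\in\mathscr{DG}_3$ and all $E$, the building bundles of $E^W$ are those of $E$ with $E_I$ replaced by $E_{\sigma(I)}$, where $\sigma=\pi(W)$. The homomorphism $\pi$ is surjective, its kernel $K_4$ is a Klein four-group, and $\mathscr{DG}_3$ has order $96$ (not $72$). -/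

import Mathlib

noncomputable section

set_option linter.unusedSectionVars false

namespace TripleVB

/-! ### Triple vector bundles over a point

Double and triple vector bundles over `M` are described through their fibres over the points of `M`
(the algebra, in this part) and smooth structures on the total spaces (below). -/

/-- The operations of a vector bundle `X → B`: projection, fibrewise addition (meaningful when
`proj x = proj y`) and scalar multiplication. The zero over `proj x` is `smul 0 x`. The vector bundle
axioms are `VBStr.Lawful`. -/
structure VBStr (X B : Type) where
  proj : X → B
  add : X → X → X
  smul : ℝ → X → X

/-- `f`, covering `g`, is fibrewise linear. -/
structure VBStr.IsHom {X B X' B' : Type} (s : VBStr X B) (s' : VBStr X' B')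
    (f : X → X') (g : B → B') : Prop where
  proj : ∀ x, s'.proj (f x) = g (s.proj x)
  add : ∀ x y, s.proj x = s.proj y → f (s.add x y) = s'.add (f x) (f y)
  smul : ∀ (t : ℝ) x, f (s.smul t x) = s'.smul t (f x)

/-- A vector space as a vector bundle over a point. -/
def VBStr.ofModule (V : Type) [AddCommGroup V] [Module ℝ V] : VBStr V Unit where
  proj _ := ()
  add x y := x + y
  smul t x := t • x

theorem VBStr.IsHom.refl {X B : Type} (s : VBStr X B) : s.IsHom s id id :=
  ⟨fun _ => rfl, fun _ _ _ => rfl, fun _ _ => rfl⟩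

theorem VBStr.IsHom.comp {X B X' B' X'' B'' : Type} {s : VBStr X B} {s' : VBStr X' B'}
    {s'' : VBStr X'' B''} {f : X → X'} {g : B → B'} {f' : X' → X''} {g' : B' → B''}
    (h' : s'.IsHom s'' f' g') (h : s.IsHom s' f g) : s.IsHom s'' (f' ∘ f) (g' ∘ g) where
  proj x := by simp [h'.proj, h.proj]
  add x y hxy := by
    simp only [Function.comp]
    rw [h.add x y hxy, h'.add _ _ (by rw [h.proj, h.proj, hxy])]
  smul t x := by simp [h'.smul, h.smul]

theorem VBStr.IsHom.symm {X B X' B' : Type} {s : VBStr X B} {s' : VBStr X' B'}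
    {e : X ≃ X'} {g : B ≃ B'} (h : s.IsHom s' e g) : s'.IsHom s e.symm g.symm where
  proj x := by
    apply g.injective; rw [← h.proj]; simp
  add x y hxy := by
    apply e.injective
    rw [h.add _ _ (g.injective (by rw [← h.proj, ← h.proj]; simpa using hxy))]; simp
  smul t x := by apply e.injective; rw [h.smul]; simp

/-- The fibre, over a point of the base manifold, of a double vector bundle `D` with side bundles `A`
and `B` and core `C`: two vector bundle structures `D → A` and `D → B`, and the inclusion of the core. -/
structure DVS (A B C : Type) where
  D : Type
  overA : VBStr D A
  overB : VBStr D B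
  core : C → D

/-- Isomorphisms of double vector bundles inducing the identity on the side bundles and the
core: statomorphisms. -/
structure DVS.Iso {A B C : Type} (E F : DVS A B C) where
  e : E.D ≃ F.D
  homA : E.overA.IsHom F.overA e id
  homB : E.overB.IsHom F.overB e id
  core : ∀ c, e (E.core c) = F.core c

theorem DVS.Iso.ext' {A B C : Type} {E F : DVS A B C} {φ ψ : E.Iso F} (h : ∀ x, φ.e x = ψ.e x) :
    φ = ψ := by
  cases φ; cases ψ; congr; exact Equiv.ext h

def DVS.Iso.refl {A B C : Type} (E : DVS A B C) : E.Iso E :=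
  ⟨Equiv.refl _, .refl _, .refl _, fun _ => rfl⟩

def DVS.Iso.symm {A B C : Type} {E F : DVS A B C} (φ : E.Iso F) : F.Iso E :=
  ⟨φ.e.symm, VBStr.IsHom.symm (g := Equiv.refl _) φ.homA,
    VBStr.IsHom.symm (g := Equiv.refl _) φ.homB, fun c => by rw [← φ.core]; simp⟩

def DVS.Iso.trans {A B C : Type} {E F G : DVS A B C} (φ : E.Iso F) (ψ : F.Iso G) : E.Iso G :=
  ⟨φ.e.trans ψ.e, ψ.homA.comp φ.homA, ψ.homB.comp φ.homB, fun c => by simp [φ.core, ψ.core]⟩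

/-- Exchange of the two sides. -/
def DVS.flip {A B C : Type} (E : DVS A B C) : DVS B A C := ⟨E.D, E.overB, E.overA, E.core⟩

def DVS.Iso.flip {A B C : Type} {E F : DVS A B C} (φ : E.Iso F) : E.flip.Iso F.flip :=
  ⟨φ.e, φ.homB, φ.homA, φ.core⟩

/-- The decomposed double vector bundle `A × B × C`. -/
abbrev DVS.dec (A B C : Type) [AddCommGroup A] [Module ℝ A] [AddCommGroup B] [Module ℝ B]
    [AddCommGroup C] [Module ℝ C] : DVS A B C where
  D := A × B × C
  overA :=
    { proj := fun x => x.1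
      add := fun x y => (x.1, x.2.1 + y.2.1, x.2.2 + y.2.2)
      smul := fun t x => (x.1, t • x.2.1, t • x.2.2) }
  overB :=
    { proj := fun x => x.2.1
      add := fun x y => (x.1 + y.1, x.2.1, x.2.2 + y.2.2)
      smul := fun t x => (t • x.1, x.2.1, t • x.2.2) }
  core := fun c => (0, 0, c)

/-- The fibre, over a point of the base manifold, of a triple vector bundle with total space `T`, lower
faces the double vector bundles `D₁₂`, `D₁₃`, `D₂₃` (with sides `V₁, V₂, V₃` and cores `V₁₂, V₁₃, V₂₃`),
three vector bundle structures of `T` over the lower faces, and ultracore `V₁₂₃`. -/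
structure TVS (V₁ V₂ V₃ V₁₂ V₁₃ V₂₃ V₁₂₃ : Type) where
  D₁₂ : DVS V₁ V₂ V₁₂
  D₁₃ : DVS V₁ V₃ V₁₃
  D₂₃ : DVS V₂ V₃ V₂₃
  T : Type
  over₁₂ : VBStr T D₁₂.D
  over₁₃ : VBStr T D₁₃.D
  over₂₃ : VBStr T D₂₃.D
  core : V₁₂₃ → T

/-- Statomorphisms: isomorphisms of triple vector bundles inducing the identity on all building
bundles, that is on the sides `V₁, V₂, V₃`, the cores `V₁₂, V₁₃, V₂₃` of the lower faces, and the
ultracore `V₁₂₃`. -/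
structure TVS.Iso {V₁ V₂ V₃ V₁₂ V₁₃ V₂₃ V₁₂₃ : Type} (E F : TVS V₁ V₂ V₃ V₁₂ V₁₃ V₂₃ V₁₂₃) where
  i₁₂ : E.D₁₂.Iso F.D₁₂
  i₁₃ : E.D₁₃.Iso F.D₁₃
  i₂₃ : E.D₂₃.Iso F.D₂₃
  e : E.T ≃ F.T
  hom₁₂ : E.over₁₂.IsHom F.over₁₂ e i₁₂.e
  hom₁₃ : E.over₁₃.IsHom F.over₁₃ e i₁₃.e
  hom₂₃ : E.over₂₃.IsHom F.over₂₃ e i₂₃.e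
  core : ∀ u, e (E.core u) = F.core u

section Iso

variable {V₁ V₂ V₃ V₁₂ V₁₃ V₂₃ V₁₂₃ : Type} {E F G : TVS V₁ V₂ V₃ V₁₂ V₁₃ V₂₃ V₁₂₃}

theorem TVS.Iso.ext' {φ ψ : E.Iso F} (h₁₂ : ∀ x, φ.i₁₂.e x = ψ.i₁₂.e x)
    (h₁₃ : ∀ x, φ.i₁₃.e x = ψ.i₁₃.e x) (h₂₃ : ∀ x, φ.i₂₃.e x = ψ.i₂₃.e x)
    (h : ∀ x, φ.e x = ψ.e x) : φ = ψ := by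
  have a := DVS.Iso.ext' h₁₂
  have b := DVS.Iso.ext' h₁₃
  have c := DVS.Iso.ext' h₂₃
  have d := Equiv.ext h
  cases φ; cases ψ; simp only at a b c d; subst a b c d; rfl

def TVS.Iso.refl (E : TVS V₁ V₂ V₃ V₁₂ V₁₃ V₂₃ V₁₂₃) : E.Iso E :=
  ⟨.refl _, .refl _, .refl _, Equiv.refl _, .refl _, .refl _, .refl _, fun _ => rfl⟩

def TVS.Iso.symm (φ : E.Iso F) : F.Iso E :=
  ⟨φ.i₁₂.symm, φ.i₁₃.symm, φ.i₂₃.symm, φ.e.symm, φ.hom₁₂.symm, φ.hom₁₃.symm, φ.hom₂₃.symm,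
    fun u => by rw [← φ.core]; simp⟩

def TVS.Iso.trans (φ : E.Iso F) (ψ : F.Iso G) : E.Iso G :=
  ⟨φ.i₁₂.trans ψ.i₁₂, φ.i₁₃.trans ψ.i₁₃, φ.i₂₃.trans ψ.i₂₃, φ.e.trans ψ.e,
    ψ.hom₁₂.comp φ.hom₁₂, ψ.hom₁₃.comp φ.hom₁₃, ψ.hom₂₃.comp φ.hom₂₃,
    fun u => by simp [φ.core, ψ.core]⟩

end Iso

/-- The decomposed triple vector bundle: the product of the building bundles, with the three evident
vector bundle structures. -/
abbrev TVS.dec (V₁ V₂ V₃ V₁₂ V₁₃ V₂₃ V₁₂₃ : Type)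
    [AddCommGroup V₁] [Module ℝ V₁] [AddCommGroup V₂] [Module ℝ V₂] [AddCommGroup V₃] [Module ℝ V₃]
    [AddCommGroup V₁₂] [Module ℝ V₁₂] [AddCommGroup V₁₃] [Module ℝ V₁₃]
    [AddCommGroup V₂₃] [Module ℝ V₂₃] [AddCommGroup V₁₂₃] [Module ℝ V₁₂₃] :
    TVS V₁ V₂ V₃ V₁₂ V₁₃ V₂₃ V₁₂₃ where
  D₁₂ := DVS.dec V₁ V₂ V₁₂
  D₁₃ := DVS.dec V₁ V₃ V₁₃
  D₂₃ := DVS.dec V₂ V₃ V₂₃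
  T := V₁ × V₂ × V₃ × V₁₂ × V₁₃ × V₂₃ × V₁₂₃
  over₁₂ :=
    { proj := fun (e₁, e₂, _, e₁₂, _, _, _) => (e₁, e₂, e₁₂)
      add := fun (e₁, e₂, e₃, e₁₂, e₁₃, e₂₃, u) (_, _, f₃, _, f₁₃, f₂₃, v) =>
        (e₁, e₂, e₃ + f₃, e₁₂, e₁₃ + f₁₃, e₂₃ + f₂₃, u + v)
      smul := fun t (e₁, e₂, e₃, e₁₂, e₁₃, e₂₃, u) =>
        (e₁, e₂, t • e₃, e₁₂, t • e₁₃, t • e₂₃, t • u) }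
  over₁₃ :=
    { proj := fun (e₁, _, e₃, _, e₁₃, _, _) => (e₁, e₃, e₁₃)
      add := fun (e₁, e₂, e₃, e₁₂, e₁₃, e₂₃, u) (_, f₂, _, f₁₂, _, f₂₃, v) =>
        (e₁, e₂ + f₂, e₃, e₁₂ + f₁₂, e₁₃, e₂₃ + f₂₃, u + v)
      smul := fun t (e₁, e₂, e₃, e₁₂, e₁₃, e₂₃, u) =>
        (e₁, t • e₂, e₃, t • e₁₂, e₁₃, t • e₂₃, t • u) }
  over₂₃ :=
    { proj := fun (_, e₂, e₃, _, _, e₂₃, _) => (e₂, e₃, e₂₃)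
      add := fun (e₁, e₂, e₃, e₁₂, e₁₃, e₂₃, u) (f₁, _, _, f₁₂, f₁₃, _, v) =>
        (e₁ + f₁, e₂, e₃, e₁₂ + f₁₂, e₁₃ + f₁₃, e₂₃, u + v)
      smul := fun t (e₁, e₂, e₃, e₁₂, e₁₃, e₂₃, u) =>
        (t • e₁, e₂, e₃, t • e₁₂, t • e₁₃, e₂₃, t • u) }
  core := fun u => (0, 0, 0, 0, 0, 0, u)


section Flip
variable {V₁ V₂ V₃ V₁₂ V₁₃ V₂₃ V₁₂₃ : Type}

/-- The same triple vector bundle with the axes 1 and 2 exchanged. -/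
def TVS.flip₁₂ (E : TVS V₁ V₂ V₃ V₁₂ V₁₃ V₂₃ V₁₂₃) : TVS V₂ V₁ V₃ V₁₂ V₂₃ V₁₃ V₁₂₃ where
  D₁₂ := E.D₁₂.flip
  D₁₃ := E.D₂₃
  D₂₃ := E.D₁₃
  T := E.T
  over₁₂ := E.over₁₂
  over₁₃ := E.over₂₃
  over₂₃ := E.over₁₃
  core := E.core

/-- The same triple vector bundle with the axes 1 and 3 exchanged. -/
def TVS.flip₁₃ (E : TVS V₁ V₂ V₃ V₁₂ V₁₃ V₂₃ V₁₂₃) : TVS V₃ V₂ V₁ V₂₃ V₁₃ V₁₂ V₁₂₃ where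
  D₁₂ := E.D₂₃.flip
  D₁₃ := E.D₁₃.flip
  D₂₃ := E.D₁₂.flip
  T := E.T
  over₁₂ := E.over₂₃
  over₁₃ := E.over₁₃
  over₂₃ := E.over₁₂
  core := E.core

def TVS.Iso.flip₁₂ {E F : TVS V₁ V₂ V₃ V₁₂ V₁₃ V₂₃ V₁₂₃} (φ : E.Iso F) : E.flip₁₂.Iso F.flip₁₂ :=
  ⟨φ.i₁₂.flip, φ.i₂₃, φ.i₁₃, φ.e, φ.hom₁₂, φ.hom₂₃, φ.hom₁₃, φ.core⟩

def TVS.Iso.flip₁₃ {E F : TVS V₁ V₂ V₃ V₁₂ V₁₃ V₂₃ V₁₂₃} (φ : E.Iso F) : E.flip₁₃.Iso F.flip₁₃ :=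
  ⟨φ.i₂₃.flip, φ.i₁₃.flip, φ.i₁₂.flip, φ.e, φ.hom₂₃, φ.hom₁₃, φ.hom₁₂, φ.core⟩

end Flip


/-! ### Duals

For a vector bundle structure `s : X → B`, a family of subsets `Z k ⊆ X` (`k ∈ K`), each a vector space
for the operations of `s`, is a vector bundle over `K`. `DualTot s Z` is its dual bundle. A linear
functional on `Z k` is recorded as a function on `X` that vanishes outside `Z k`. -/

/-- Linear functionals on the vector space `Z ⊆ X` (operations from `s`), extended by zero. -/
structure Fnl {X B : Type} (s : VBStr X B) (Z : Set X) where
  toFun : X → ℝ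
  off : ∀ x, x ∉ Z → toFun x = 0
  add : ∀ x ∈ Z, ∀ y ∈ Z, s.proj x = s.proj y → toFun (s.add x y) = toFun x + toFun y
  smul : ∀ (t : ℝ), ∀ x ∈ Z, toFun (s.smul t x) = t * toFun x

/-- The total space of the dual bundle of the family `Z k`, `k ∈ K`. -/
structure DualTot {X B K : Type} (s : VBStr X B) (Z : K → Set X) where
  pt : K
  fnl : Fnl s (Z pt)

section DualTot
variable {X B K Y K' P : Type} {s : VBStr X B} {Z : K → Set X}

/-- The value of a functional. -/
def DualTot.val (Ψ : DualTot s Z) : X → ℝ := Ψ.2.toFun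

theorem DualTot.ext {Ψ Φ : DualTot s Z} (h : Ψ.1 = Φ.1)
    (h' : ∀ x ∈ Z Ψ.1, Ψ.val x = Φ.val x) : Ψ = Φ := by
  obtain ⟨k, f, hf, _, _⟩ := Ψ
  obtain ⟨l, g, hg, _, _⟩ := Φ
  simp only [DualTot.val] at h h'
  subst h
  have : f = g := by
    funext x
    by_cases hx : x ∈ Z k
    · exact h' x hx
    · rw [hf x hx, hg x hx]
  subst this
  rfl

def DualTot.zero (k : K) : DualTot s Z := ⟨k, fun _ => 0, by simp, by simp, by simp⟩

open Classical in
/-- The usual vector bundle structure over `K` of a dual bundle, by pointwise operations. -/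
def dualFib (s : VBStr X B) (Z : K → Set X) : VBStr (DualTot s Z) K where
  proj Ψ := Ψ.1
  add Ψ Ψ' :=
    if h : Ψ.1 = Ψ'.1 then
      ⟨Ψ.1, fun x => Ψ.val x + Ψ'.val x,
        fun x hx => by
          rw [DualTot.val, DualTot.val, Ψ.2.off x hx, Ψ'.2.off x (h ▸ hx), add_zero],
        fun x hx y hy e => by
          simp only [DualTot.val, Ψ.2.add x hx y hy e, Ψ'.2.add x (h ▸ hx) y (h ▸ hy) e]; ring,
        fun t x hx => by
          simp only [DualTot.val, Ψ.2.smul t x hx, Ψ'.2.smul t x (h ▸ hx)]; ring⟩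
    else Ψ
  smul t Ψ :=
    ⟨Ψ.1, fun x => t * Ψ.val x,
      fun x hx => by rw [DualTot.val, Ψ.2.off x hx, mul_zero],
      fun x hx y hy e => by simp only [DualTot.val, Ψ.2.add x hx y hy e]; ring,
      fun r x hx => by simp only [DualTot.val, Ψ.2.smul r x hx]; ring⟩

open Classical in
theorem dualFib_add_fst (Ψ Ψ' : DualTot s Z) (h : Ψ.1 = Ψ'.1) :
    ((dualFib s Z).add Ψ Ψ').1 = Ψ.1 := by
  change DualTot.pt (dite _ _ _) = _
  rw [dif_pos h]

open Classical in
theorem dualFib_add_val (Ψ Ψ' : DualTot s Z) (h : Ψ.1 = Ψ'.1) (x : X) :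
    ((dualFib s Z).add Ψ Ψ').val x = Ψ.val x + Ψ'.val x := by
  change DualTot.val (dite _ _ _) x = _
  rw [dif_pos h]; rfl

/-- `Φ` is the sum of `Ψ` and `Ψ'` for the second structure of the dual of a double vector bundle with
structures `s` (dualized) and `s'`: it lies over the sum of the base points and
`⟨Φ, x +' x'⟩ = ⟨Ψ, x⟩ + ⟨Ψ', x'⟩`. -/
def OthAdd (s' : VBStr X Y) (sK : VBStr K K') (Ψ Ψ' Φ : DualTot s Z) : Prop :=
  Φ.1 = sK.add Ψ.1 Ψ'.1 ∧ ∀ x ∈ Z Ψ.1, ∀ x' ∈ Z Ψ'.1, s'.proj x = s'.proj x' →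
    Φ.val (s'.add x x') = Ψ.val x + Ψ'.val x'

/-- `Φ` is `t · Ψ` for the second structure: `⟨Φ, t ·' x⟩ = t ⟨Ψ, x⟩`. -/
def OthSmul (s' : VBStr X Y) (sK : VBStr K K') (pr : DualTot s Z → P) (t : ℝ)
    (Ψ Φ : DualTot s Z) : Prop :=
  Φ.1 = sK.smul t Ψ.1 ∧ pr Φ = pr Ψ ∧ ∀ x ∈ Z Ψ.1, Φ.val (s'.smul t x) = t * Ψ.val x

/-- The second vector bundle structure of the dual of a double vector bundle, over the dual `P` of the
core. Sums and multiples are the unique elements subject to `OthAdd` and `OthSmul` (existence and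
uniqueness: `OthUniq`, proved for the duals of all triple vector bundles in `TVB.good`). -/
def dualOth (s : VBStr X B) (Z : K → Set X) (s' : VBStr X Y) (sK : VBStr K K')
    (pr : DualTot s Z → P) : VBStr (DualTot s Z) P where
  proj := pr
  add Ψ Ψ' := @Classical.epsilon _ ⟨Ψ⟩ (OthAdd s' sK Ψ Ψ')
  smul t Ψ := @Classical.epsilon _ ⟨Ψ⟩ (OthSmul s' sK pr t Ψ)

theorem eps_eq {α : Type} [h : Nonempty α] {p : α → Prop} (hu : ∃! a, p a) {a : α} (ha : p a) :
    Classical.epsilon p = a :=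
  hu.unique (Classical.epsilon_spec ⟨a, ha⟩) ha

end DualTot

section Comap
variable {X B K X' B' K' : Type} {s : VBStr X B} {Z : K → Set X} {s' : VBStr X' B'} {Z' : K' → Set X'}

/-- Pullback of functionals along an isomorphism. -/
def DualTot.comapFun {e : X ≃ X'} {g : B ≃ B'} (h : s.IsHom s' e g) (k : K ≃ K')
    (hZ : ∀ a x, e x ∈ Z' (k a) ↔ x ∈ Z a) (Ψ : DualTot s' Z') : DualTot s Z :=
  ⟨k.symm Ψ.1, fun x => Ψ.val (e x),
    fun x hx => Ψ.2.off _ (fun h' => hx ((hZ _ _).1 (by simpa using h'))),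
    fun x hx y hy hxy => by
      have hx' := (hZ _ _).2 hx
      have hy' := (hZ _ _).2 hy
      rw [Equiv.apply_symm_apply] at hx' hy'
      rw [h.add x y hxy]
      exact Ψ.2.add _ hx' _ hy' (by rw [h.proj, h.proj, hxy]),
    fun t x hx => by
      have hx' := (hZ _ _).2 hx
      rw [Equiv.apply_symm_apply] at hx'
      rw [h.smul]; exact Ψ.2.smul t _ hx'⟩

theorem DualTot.hZ_symm {e : X ≃ X'} {k : K ≃ K'} (hZ : ∀ a x, e x ∈ Z' (k a) ↔ x ∈ Z a) (a x) :
    e.symm x ∈ Z (k.symm a) ↔ x ∈ Z' a := by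
  rw [← hZ]; simp

def DualTot.comap {e : X ≃ X'} {g : B ≃ B'} (h : s.IsHom s' e g) (k : K ≃ K')
    (hZ : ∀ a x, e x ∈ Z' (k a) ↔ x ∈ Z a) : DualTot s' Z' ≃ DualTot s Z where
  toFun := DualTot.comapFun h k hZ
  invFun := DualTot.comapFun h.symm k.symm (DualTot.hZ_symm hZ)
  left_inv Ψ := DualTot.ext (by simp [comapFun]) (fun x _ => by simp [comapFun, DualTot.val])
  right_inv Ψ := DualTot.ext (by simp [comapFun]) (fun x _ => by simp [comapFun, DualTot.val])

@[simp] theorem DualTot.comap_fst {e : X ≃ X'} {g : B ≃ B'} (h : s.IsHom s' e g) (k : K ≃ K')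
    (hZ : ∀ a x, e x ∈ Z' (k a) ↔ x ∈ Z a) (Ψ : DualTot s' Z') :
    (DualTot.comap h k hZ Ψ).1 = k.symm Ψ.1 := rfl

@[simp] theorem DualTot.comap_val {e : X ≃ X'} {g : B ≃ B'} (h : s.IsHom s' e g) (k : K ≃ K')
    (hZ : ∀ a x, e x ∈ Z' (k a) ↔ x ∈ Z a) (Ψ : DualTot s' Z') (x : X) :
    (DualTot.comap h k hZ Ψ).val x = Ψ.val (e x) := rfl

theorem dualFib_hom {e : X ≃ X'} {g : B ≃ B'} (h : s.IsHom s' e g) (k : K ≃ K')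
    (hZ : ∀ a x, e x ∈ Z' (k a) ↔ x ∈ Z a) :
    (dualFib s' Z').IsHom (dualFib s Z) (DualTot.comap h k hZ) k.symm where
  proj _ := rfl
  add Ψ Ψ' hh := by
    change Ψ.1 = Ψ'.1 at hh
    have hh' : (DualTot.comap h k hZ Ψ).1 = (DualTot.comap h k hZ Ψ').1 := by simp [hh]
    refine DualTot.ext ?_ fun x _ => ?_
    · rw [DualTot.comap_fst, dualFib_add_fst _ _ hh, dualFib_add_fst _ _ hh', DualTot.comap_fst]
    · rw [DualTot.comap_val, dualFib_add_val _ _ hh, dualFib_add_val _ _ hh']; rfl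
  smul t Ψ := DualTot.ext rfl fun x _ => rfl

variable {Y Y' L L' P P' : Type} {r : VBStr X Y} {r' : VBStr X' Y'} {sK : VBStr K L}
  {sK' : VBStr K' L'} {pr : DualTot s Z → P} {pr' : DualTot s' Z' → P'}

theorem OthAdd_comap {e : X ≃ X'} {g : B ≃ B'} (h : s.IsHom s' e g) {k : K ≃ K'}
    (hZ : ∀ a x, e x ∈ Z' (k a) ↔ x ∈ Z a) {y : Y ≃ Y'} (hr : r.IsHom r' e y)
    {l : L ≃ L'} (hk : sK.IsHom sK' k l) (Ψ Ψ' Φ : DualTot s' Z')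
    (hc : sK'.proj Ψ.1 = sK'.proj Ψ'.1) :
    OthAdd r sK (DualTot.comap h k hZ Ψ) (DualTot.comap h k hZ Ψ') (DualTot.comap h k hZ Φ) ↔
      OthAdd r' sK' Ψ Ψ' Φ := by
  unfold OthAdd
  refine and_congr ?_ ?_
  · rw [DualTot.comap_fst, DualTot.comap_fst, DualTot.comap_fst, ← hk.symm.add _ _ hc]
    exact k.symm.injective.eq_iff
  · simp only [DualTot.comap_fst, DualTot.comap_val]
    refine e.forall_congr fun {x} => imp_congr ?_ (e.forall_congr fun {x'} => imp_congr ?_ ?_)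
    · simp [← hZ]
    · simp [← hZ]
    · constructor
      · intro H hxx
        have hxx' : r.proj x = r.proj x' := y.injective (by rw [← hr.proj, ← hr.proj, hxx])
        rw [← hr.add _ _ hxx', H hxx']
      · intro H hxx'
        rw [hr.add _ _ hxx', H (by rw [hr.proj, hr.proj, hxx'])]

theorem OthSmul_comap {e : X ≃ X'} {g : B ≃ B'} (h : s.IsHom s' e g) {k : K ≃ K'}
    (hZ : ∀ a x, e x ∈ Z' (k a) ↔ x ∈ Z a) {y : Y ≃ Y'} (hr : r.IsHom r' e y)
    {l : L ≃ L'} (hk : sK.IsHom sK' k l) {p : P' ≃ P}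
    (hp : ∀ Ψ, pr (DualTot.comap h k hZ Ψ) = p (pr' Ψ)) (t : ℝ) (Ψ Φ : DualTot s' Z') :
    OthSmul r sK pr t (DualTot.comap h k hZ Ψ) (DualTot.comap h k hZ Φ) ↔
      OthSmul r' sK' pr' t Ψ Φ := by
  unfold OthSmul
  refine and_congr ?_ (and_congr ?_ ?_)
  · rw [DualTot.comap_fst, DualTot.comap_fst, ← hk.symm.smul]
    exact k.symm.injective.eq_iff
  · rw [hp, hp]; exact p.injective.eq_iff
  · simp only [DualTot.comap_fst, DualTot.comap_val]
    refine e.forall_congr fun {x} => imp_congr ?_ ?_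
    · simp [← hZ]
    · rw [hr.smul]

theorem eps_map {α β : Type} [ha : Nonempty α] [hb : Nonempty β] {p : α → Prop} {q : β → Prop}
    (e : β ≃ α) (h : ∀ b, p (e b) ↔ q b) (hu : ∃! a, p a) :
    e (Classical.epsilon q) = Classical.epsilon p := by
  obtain ⟨a, h1, _⟩ := id hu
  refine hu.unique ((h _).2 (Classical.epsilon_spec ⟨e.symm a, (h _).1 (by simpa)⟩))
    (Classical.epsilon_spec ⟨a, h1⟩)

/-- The second structure of a dual is well-defined. -/
structure OthUniq (s : VBStr X B) (Z : K → Set X) (r : VBStr X Y) (sK : VBStr K L)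
    (pr : DualTot s Z → P) : Prop where
  compat : ∀ Ψ Ψ', pr Ψ = pr Ψ' → sK.proj Ψ.1 = sK.proj Ψ'.1
  add : ∀ Ψ Ψ', pr Ψ = pr Ψ' → ∃! Φ, OthAdd r sK Ψ Ψ' Φ
  smul : ∀ (t : ℝ) (Ψ : DualTot s Z), ∃! Φ, OthSmul r sK pr t Ψ Φ

theorem existsUnique_equiv {α β : Type} {p : α → Prop} {q : β → Prop}
    (e : β ≃ α) (h : ∀ b, p (e b) ↔ q b) : (∃! a, p a) ↔ ∃! b, q b :=
  (e.existsUnique_congr fun {b} => (h b).symm).symm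

theorem OthUniq.comap {e : X ≃ X'} {g : B ≃ B'} (h : s.IsHom s' e g) {k : K ≃ K'}
    (hZ : ∀ a x, e x ∈ Z' (k a) ↔ x ∈ Z a) {y : Y ≃ Y'} (hr : r.IsHom r' e y)
    {l : L ≃ L'} (hk : sK.IsHom sK' k l) {p : P' ≃ P}
    (hp : ∀ Ψ, pr (DualTot.comap h k hZ Ψ) = p (pr' Ψ)) (U : OthUniq s' Z' r' sK' pr') :
    OthUniq s Z r sK pr := by
  have key : ∀ Ψ Ψ', pr Ψ = pr Ψ' → ∃ Φ Φ', Ψ = DualTot.comap h k hZ Φ ∧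
      Ψ' = DualTot.comap h k hZ Φ' ∧ pr' Φ = pr' Φ' := by
    intro Ψ Ψ' hh
    refine ⟨(DualTot.comap h k hZ).symm Ψ, (DualTot.comap h k hZ).symm Ψ', by simp, by simp, ?_⟩
    apply p.injective
    rw [← hp, ← hp]; simpa using hh
  constructor
  · intro Ψ Ψ' hh
    obtain ⟨Φ, Φ', rfl, rfl, hh'⟩ := key Ψ Ψ' hh
    apply l.injective
    rw [← hk.proj, ← hk.proj]
    simpa using U.compat _ _ hh'
  · intro Ψ Ψ' hh
    obtain ⟨Φ, Φ', rfl, rfl, hh'⟩ := key Ψ Ψ' hh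
    exact (existsUnique_equiv _ fun b =>
      OthAdd_comap h hZ hr hk Φ Φ' b (U.compat _ _ hh')).2 (U.add _ _ hh')
  · intro t Ψ
    obtain ⟨Φ, rfl⟩ := (DualTot.comap h k hZ).surjective Ψ
    exact (existsUnique_equiv _ fun b => OthSmul_comap h hZ hr hk hp t Φ b).2 (U.smul t Φ)

theorem dualOth_hom {e : X ≃ X'} {g : B ≃ B'} (h : s.IsHom s' e g) {k : K ≃ K'}
    (hZ : ∀ a x, e x ∈ Z' (k a) ↔ x ∈ Z a) {y : Y ≃ Y'} (hr : r.IsHom r' e y)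
    {l : L ≃ L'} (hk : sK.IsHom sK' k l) {p : P' ≃ P}
    (hp : ∀ Ψ, pr (DualTot.comap h k hZ Ψ) = p (pr' Ψ)) (U : OthUniq s' Z' r' sK' pr') :
    (dualOth s' Z' r' sK' pr').IsHom (dualOth s Z r sK pr) (DualTot.comap h k hZ) p where
  proj := hp
  add Ψ Ψ' hh := by
    have hh' : pr (DualTot.comap h k hZ Ψ) = pr (DualTot.comap h k hZ Ψ') := by
      rw [hp, hp]; exact congrArg p hh
    exact @eps_map _ _ ⟨DualTot.comap h k hZ Ψ⟩
      ⟨Ψ⟩ _ _ (DualTot.comap h k hZ) (fun b =>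
      OthAdd_comap h hZ hr hk Ψ Ψ' b (U.compat _ _ hh)) ((OthUniq.comap h hZ hr hk hp U).add _ _ hh')
  smul t Ψ := by
    exact @eps_map _ _ ⟨DualTot.comap h k hZ Ψ⟩
      ⟨Ψ⟩ _ _ (DualTot.comap h k hZ) (fun b =>
      OthSmul_comap h hZ hr hk hp t Ψ b) ((OthUniq.comap h hZ hr hk hp U).smul _ _)

end Comap

section DualX

variable {V₁ V₂ V₃ V₁₂ V₁₃ V₂₃ V₁₂₃ V₀ V₀₂ V₀₃ V₀₂₃ : Type}

section
variable (E : TVS V₁ V₂ V₃ V₁₂ V₁₃ V₂₃ V₁₂₃)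

/-- The fibre of `E₁,₂,₃ → E₂,₃`. -/
def TVS.fib (d : E.D₂₃.D) : Set E.T := {t | E.over₂₃.proj t = d}

/-- The fibre over `a ∈ V₂` of the core (over `E₂`) of the double vector bundle `E₁₂₃ → E₁₂, E₂₃`
over `E₂`: the elements which project to the zeros over `a` of `E₁₂ → E₂` and of `E₂₃ → E₂`. -/
def TVS.core₂ (a : V₂) : Set E.T :=
  {t | E.D₁₂.overB.smul 0 (E.over₁₂.proj t) = E.over₁₂.proj t ∧
    E.D₂₃.overA.smul 0 (E.over₂₃.proj t) = E.over₂₃.proj t ∧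
    E.D₂₃.overA.proj (E.over₂₃.proj t) = a}

/-- The fibre over `a ∈ V₃` of the core (over `E₃`) of the double vector bundle `E₁₂₃ → E₁₃, E₂₃`
over `E₃`. -/
def TVS.core₃ (a : V₃) : Set E.T :=
  {t | E.D₁₃.overB.smul 0 (E.over₁₃.proj t) = E.over₁₃.proj t ∧
    E.D₂₃.overB.smul 0 (E.over₂₃.proj t) = E.over₂₃.proj t ∧
    E.D₂₃.overB.proj (E.over₂₃.proj t) = a}

/-- The total space of the dual of `E₁₂₃` over `E₂₃`. -/
abbrev TVS.dT : Type := DualTot E.over₂₃ E.fib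
/-- The dual over `E₂` of the core of `E₁₂₃ → E₁₂, E₂₃`. -/
abbrev TVS.d₁₂ : Type := DualTot E.over₂₃ E.core₂
/-- The dual over `E₃` of the core of `E₁₂₃ → E₁₃, E₂₃`. -/
abbrev TVS.d₁₃ : Type := DualTot E.over₂₃ E.core₃

variable {E}

/-- `κ` is the projection of `Ψ`, in the dual of the double vector bundle `E₁₂₃ → E₁₂, E₂₃` over
`E₂₃`, to the dual of its core: `⟨κ, c⟩ = ⟨Ψ, 0̃ + c⟩`, where `0̃` is the zero of `E₁₂₃ → E₂₃` over the
base point of `Ψ` and the sum is taken over `E₁₂`. -/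
def TVS.Pr₁₂ (Ψ : E.dT) (κ : E.d₁₂) : Prop :=
  κ.1 = E.D₂₃.overA.proj Ψ.1 ∧ ∀ t ∈ E.fib Ψ.1, ∀ c ∈ E.core₂ κ.1,
    E.over₁₂.proj (E.over₂₃.smul 0 t) = E.over₁₂.proj c →
      κ.val c = Ψ.val (E.over₁₂.add (E.over₂₃.smul 0 t) c)

/-- `κ` is the projection of `Ψ` to the dual of the core of `E₁₂₃ → E₁₃, E₂₃`. -/
def TVS.Pr₁₃ (Ψ : E.dT) (κ : E.d₁₃) : Prop :=
  κ.1 = E.D₂₃.overB.proj Ψ.1 ∧ ∀ t ∈ E.fib Ψ.1, ∀ c ∈ E.core₃ κ.1,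
    E.over₁₃.proj (E.over₂₃.smul 0 t) = E.over₁₃.proj c →
      κ.val c = Ψ.val (E.over₁₃.add (E.over₂₃.smul 0 t) c)

variable [AddCommGroup V₁] [Module ℝ V₁] [AddCommGroup V₂] [Module ℝ V₂]
  [AddCommGroup V₃] [Module ℝ V₃] [AddCommGroup V₁₂] [Module ℝ V₁₂] [AddCommGroup V₁₃] [Module ℝ V₁₃]
  [AddCommGroup V₂₃] [Module ℝ V₂₃] [AddCommGroup V₁₂₃] [Module ℝ V₁₂₃]
  [AddCommGroup V₀] [Module ℝ V₀] [AddCommGroup V₀₂] [Module ℝ V₀₂] [AddCommGroup V₀₃] [Module ℝ V₀₃]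
  [AddCommGroup V₀₂₃] [Module ℝ V₀₂₃]
  (b₀ : V₀ →ₗ[ℝ] V₁₂₃ →ₗ[ℝ] ℝ) (b₂ : V₀₂ →ₗ[ℝ] V₁₃ →ₗ[ℝ] ℝ) (b₃ : V₀₃ →ₗ[ℝ] V₁₂ →ₗ[ℝ] ℝ)
  (b₁ : V₀₂₃ →ₗ[ℝ] V₁ →ₗ[ℝ] ℝ)

/-- `e₀ ∈ E₀ ≅ E₁₂₃*` is the projection of `Ψ` in the dual over `E₂` of a double vector bundle with
core `E₁₂₃`: `⟨e₀, u⟩ = ⟨Ψ, 0̃ + u⟩`. -/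
def TVS.Side₂ (Ψ : E.d₁₂) (e₀ : V₀) : Prop :=
  ∀ t ∈ E.core₂ Ψ.1, ∀ u, E.over₁₃.proj (E.over₂₃.smul 0 t) = E.over₁₃.proj (E.core u) →
    b₀ e₀ u = Ψ.val (E.over₁₃.add (E.over₂₃.smul 0 t) (E.core u))

/-- `e₀ ∈ E₀ ≅ E₁₂₃*` is the projection of `Ψ` in the dual over `E₃`. -/
def TVS.Side₃ (Ψ : E.d₁₃) (e₀ : V₀) : Prop :=
  ∀ t ∈ E.core₃ Ψ.1, ∀ u, E.over₁₂.proj (E.over₂₃.smul 0 t) = E.over₁₂.proj (E.core u) →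
    b₀ e₀ u = Ψ.val (E.over₁₂.add (E.over₂₃.smul 0 t) (E.core u))

/-- `Ψ` is the element of the ultracore of the dual given by `ε ∈ E₀₂₃ ≅ E₁*`: it lies over the zero of
`E₂₃` and `⟨Ψ, t⟩` is the value of `ε` on the component of `t` in `E₁`. -/
def TVS.CoreT (ε : V₀₂₃) (Ψ : E.dT) : Prop :=
  Ψ.1 = E.D₂₃.core 0 ∧ ∀ t ∈ E.fib Ψ.1, Ψ.val t = b₁ ε (E.D₁₂.overA.proj (E.over₁₂.proj t))

/-- `Ψ` is the core element given by `ε ∈ E₀₂ ≅ E₁₃*`: it lies over the zero of `E₂` and `⟨Ψ, t⟩` is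
the value of `ε` on the component of `t` in `E₁₃`. -/
def TVS.Core₁₂ (ε : V₀₂) (Ψ : E.d₁₂) : Prop :=
  Ψ.1 = 0 ∧ ∀ t ∈ E.core₂ Ψ.1, ∀ c, E.over₁₃.proj t = E.D₁₃.core c → Ψ.val t = b₂ ε c

/-- `Ψ` is the core element given by `ε ∈ E₀₃ ≅ E₁₂*`. -/
def TVS.Core₁₃ (ε : V₀₃) (Ψ : E.d₁₃) : Prop :=
  Ψ.1 = 0 ∧ ∀ t ∈ E.core₃ Ψ.1, ∀ c, E.over₁₂.proj t = E.D₁₂.core c → Ψ.val t = b₃ ε c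

def TVS.side₂ (Ψ : E.d₁₂) : V₀ := Classical.epsilon (TVS.Side₂ b₀ Ψ)
def TVS.side₃ (Ψ : E.d₁₃) : V₀ := Classical.epsilon (TVS.Side₃ b₀ Ψ)
def TVS.pr₁₂ (Ψ : E.dT) : E.d₁₂ := @Classical.epsilon _ ⟨DualTot.zero 0⟩ (TVS.Pr₁₂ Ψ)
def TVS.pr₁₃ (Ψ : E.dT) : E.d₁₃ := @Classical.epsilon _ ⟨DualTot.zero 0⟩ (TVS.Pr₁₃ Ψ)

variable (E)

/-- The `X`-dual of a triple vector bundle: the dual of `E₁₂₃` over `E₂₃`. Its lower faces are the duals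
over `E₂` and `E₃` of the cores of the upper faces adjacent to `E₂₃`, and `E₂₃` itself. Its building
bundles are `E₀ ≅ E₁₂₃*`, `E₂`, `E₃`, `E₀₂ ≅ E₁₃*`, `E₀₃ ≅ E₁₂*`, `E₂₃`, `E₀₂₃ ≅ E₁*`, by the pairings
`b₀, b₂, b₃, b₁`. Each use of `epsilon` selects a unique element, by `TVS.Good`. -/
def TVS.dualX : TVS V₀ V₂ V₃ V₀₂ V₀₃ V₂₃ V₀₂₃ where
  D₁₂ :=
    { D := E.d₁₂
      overA := dualOth E.over₂₃ E.core₂ E.over₁₃ (.ofModule V₂) (TVS.side₂ b₀)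
      overB := dualFib E.over₂₃ E.core₂
      core := fun ε => @Classical.epsilon _ ⟨DualTot.zero 0⟩ (TVS.Core₁₂ b₂ ε) }
  D₁₃ :=
    { D := E.d₁₃
      overA := dualOth E.over₂₃ E.core₃ E.over₁₂ (.ofModule V₃) (TVS.side₃ b₀)
      overB := dualFib E.over₂₃ E.core₃
      core := fun ε => @Classical.epsilon _ ⟨DualTot.zero 0⟩ (TVS.Core₁₃ b₃ ε) }
  D₂₃ := E.D₂₃
  T := E.dT
  over₁₂ := dualOth E.over₂₃ E.fib E.over₁₂ E.D₂₃.overA TVS.pr₁₂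
  over₁₃ := dualOth E.over₂₃ E.fib E.over₁₃ E.D₂₃.overB TVS.pr₁₃
  over₂₃ := dualFib E.over₂₃ E.fib
  core := fun ε => @Classical.epsilon _ ⟨DualTot.zero (E.D₂₃.core 0)⟩ (TVS.CoreT b₁ ε)

/-- All the clauses which define the `X`-dual determine unique elements. -/
structure TVS.Good : Prop where
  pr₁₂ : ∀ Ψ : E.dT, ∃! κ, TVS.Pr₁₂ Ψ κ
  pr₁₃ : ∀ Ψ : E.dT, ∃! κ, TVS.Pr₁₃ Ψ κ
  side₂ : ∀ Ψ : E.d₁₂, ∃! e, TVS.Side₂ b₀ Ψ e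
  side₃ : ∀ Ψ : E.d₁₃, ∃! e, TVS.Side₃ b₀ Ψ e
  coreT : ∀ ε, ∃! Ψ : E.dT, TVS.CoreT b₁ ε Ψ
  core₁₂ : ∀ ε, ∃! Ψ : E.d₁₂, TVS.Core₁₂ b₂ ε Ψ
  core₁₃ : ∀ ε, ∃! Ψ : E.d₁₃, TVS.Core₁₃ b₃ ε Ψ
  u₁₂ : OthUniq E.over₂₃ E.fib E.over₁₂ E.D₂₃.overA TVS.pr₁₂
  u₁₃ : OthUniq E.over₂₃ E.fib E.over₁₃ E.D₂₃.overB TVS.pr₁₃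
  v₁₂ : OthUniq E.over₂₃ E.core₂ E.over₁₃ (.ofModule V₂) (TVS.side₂ b₀)
  v₁₃ : OthUniq E.over₂₃ E.core₃ E.over₁₂ (.ofModule V₃) (TVS.side₃ b₀)

section Transport

variable {E F : TVS V₁ V₂ V₃ V₁₂ V₁₃ V₂₃ V₁₂₃} (φ : E.Iso F)

theorem TVS.Iso.mem_fib (a x) : φ.e x ∈ F.fib (φ.i₂₃.e a) ↔ x ∈ E.fib a := by
  simp only [TVS.fib, Set.mem_ofPred_eq, φ.hom₂₃.proj]
  exact φ.i₂₃.e.injective.eq_iff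

theorem TVS.Iso.mem_core₂ (a x) : φ.e x ∈ F.core₂ (Equiv.refl V₂ a) ↔ x ∈ E.core₂ a := by
  simp only [TVS.core₂, Set.mem_ofPred_eq, φ.hom₂₃.proj, φ.hom₁₂.proj, ← φ.i₁₂.homB.smul,
    ← φ.i₂₃.homA.smul, φ.i₂₃.homA.proj, φ.i₁₂.e.injective.eq_iff, φ.i₂₃.e.injective.eq_iff]
  rfl

theorem TVS.Iso.mem_core₃ (a x) : φ.e x ∈ F.core₃ (Equiv.refl V₃ a) ↔ x ∈ E.core₃ a := by
  simp only [TVS.core₃, Set.mem_ofPred_eq, φ.hom₂₃.proj, φ.hom₁₃.proj, ← φ.i₁₃.homB.smul,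
    ← φ.i₂₃.homB.smul, φ.i₂₃.homB.proj, φ.i₁₃.e.injective.eq_iff, φ.i₂₃.e.injective.eq_iff]
  rfl

def TVS.Iso.cT : F.dT ≃ E.dT := DualTot.comap φ.hom₂₃ φ.i₂₃.e φ.mem_fib
def TVS.Iso.c₁₂ : F.d₁₂ ≃ E.d₁₂ := DualTot.comap φ.hom₂₃ (Equiv.refl V₂) φ.mem_core₂
def TVS.Iso.c₁₃ : F.d₁₃ ≃ E.d₁₃ := DualTot.comap φ.hom₂₃ (Equiv.refl V₃) φ.mem_core₃

theorem TVS.Iso.cT_pt (Ψ : F.dT) : (φ.cT Ψ).pt = φ.i₂₃.e.symm Ψ.pt := rfl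
theorem TVS.Iso.c₁₂_pt (Ψ : F.d₁₂) : (φ.c₁₂ Ψ).pt = Ψ.pt := rfl
theorem TVS.Iso.c₁₃_pt (Ψ : F.d₁₃) : (φ.c₁₃ Ψ).pt = Ψ.pt := rfl
theorem TVS.Iso.cT_val (Ψ : F.dT) (x) : (φ.cT Ψ).val x = Ψ.val (φ.e x) := rfl
theorem TVS.Iso.c₁₂_val (Ψ : F.d₁₂) (x) : (φ.c₁₂ Ψ).val x = Ψ.val (φ.e x) := rfl
theorem TVS.Iso.c₁₃_val (Ψ : F.d₁₃) (x) : (φ.c₁₃ Ψ).val x = Ψ.val (φ.e x) := rfl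

theorem TVS.Iso.mem_fib' (a x) : x ∈ E.fib (φ.i₂₃.e.symm a) ↔ φ.e x ∈ F.fib a := by
  rw [← φ.mem_fib]; simp

theorem TVS.Iso.projA_symm (d) : E.D₂₃.overA.proj (φ.i₂₃.e.symm d) = F.D₂₃.overA.proj d := by
  have := φ.i₂₃.homA.proj (φ.i₂₃.e.symm d)
  simpa using this.symm

theorem TVS.Iso.projB_symm (d) : E.D₂₃.overB.proj (φ.i₂₃.e.symm d) = F.D₂₃.overB.proj d := by
  have := φ.i₂₃.homB.proj (φ.i₂₃.e.symm d)
  simpa using this.symm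

/-- the shape shared by all "whenever composable" clauses -/
theorem hom_add_congr {X B X' B' : Type} {s : VBStr X B} {s' : VBStr X' B'}
    {e : X ≃ X'} {g : B ≃ B'} (h : s.IsHom s' e g) (x y : X) (r : ℝ) (f : X' → ℝ) :
    (s.proj x = s.proj y → r = f (e (s.add x y))) ↔
      (s'.proj (e x) = s'.proj (e y) → r = f (s'.add (e x) (e y))) := by
  rw [h.proj, h.proj, g.injective.eq_iff]
  refine imp_congr_right fun hh => ?_
  rw [h.add _ _ hh]

theorem TVS.Iso.pr₁₂_iff (Ψ : F.dT) (κ : F.d₁₂) :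
    TVS.Pr₁₂ (φ.cT Ψ) (φ.c₁₂ κ) ↔ TVS.Pr₁₂ Ψ κ := by
  unfold TVS.Pr₁₂
  rw [φ.c₁₂_pt, φ.cT_pt, φ.projA_symm]
  refine and_congr Iff.rfl (φ.e.forall_congr fun {t} => imp_congr (φ.mem_fib' _ _)
    (φ.e.forall_congr fun {c} => imp_congr (φ.mem_core₂ _ _).symm ?_))
  rw [φ.c₁₂_val, φ.cT_val, hom_add_congr φ.hom₁₂, φ.hom₂₃.smul]

theorem TVS.Iso.pr₁₃_iff (Ψ : F.dT) (κ : F.d₁₃) :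
    TVS.Pr₁₃ (φ.cT Ψ) (φ.c₁₃ κ) ↔ TVS.Pr₁₃ Ψ κ := by
  unfold TVS.Pr₁₃
  rw [φ.c₁₃_pt, φ.cT_pt, φ.projB_symm]
  refine and_congr Iff.rfl (φ.e.forall_congr fun {t} => imp_congr (φ.mem_fib' _ _)
    (φ.e.forall_congr fun {c} => imp_congr (φ.mem_core₃ _ _).symm ?_))
  rw [φ.c₁₃_val, φ.cT_val, hom_add_congr φ.hom₁₃, φ.hom₂₃.smul]

theorem TVS.Iso.side₂_iff (Ψ : F.d₁₂) (e : V₀) :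
    TVS.Side₂ b₀ (φ.c₁₂ Ψ) e ↔ TVS.Side₂ b₀ Ψ e := by
  refine φ.e.forall_congr fun {t} => imp_congr (φ.mem_core₂ _ _).symm (forall_congr' fun u => ?_)
  rw [φ.c₁₂_val, hom_add_congr φ.hom₁₃, φ.hom₂₃.smul, φ.core]

theorem TVS.Iso.side₃_iff (Ψ : F.d₁₃) (e : V₀) :
    TVS.Side₃ b₀ (φ.c₁₃ Ψ) e ↔ TVS.Side₃ b₀ Ψ e := by
  refine φ.e.forall_congr fun {t} => imp_congr (φ.mem_core₃ _ _).symm (forall_congr' fun u => ?_)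
  rw [φ.c₁₃_val, hom_add_congr φ.hom₁₂, φ.hom₂₃.smul, φ.core]

theorem TVS.Iso.coreT_iff (ε : V₀₂₃) (Ψ : F.dT) :
    TVS.CoreT b₁ ε (φ.cT Ψ) ↔ TVS.CoreT b₁ ε Ψ := by
  refine and_congr ?_ (φ.e.forall_congr fun {t} => imp_congr (φ.mem_fib' _ _) ?_)
  · rw [φ.cT_pt, Equiv.symm_apply_eq, φ.i₂₃.core]
  · rw [φ.cT_val, φ.hom₁₂.proj, φ.i₁₂.homA.proj]; rfl

theorem TVS.Iso.core₁₂_iff (ε : V₀₂) (Ψ : F.d₁₂) :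
    TVS.Core₁₂ b₂ ε (φ.c₁₂ Ψ) ↔ TVS.Core₁₂ b₂ ε Ψ := by
  refine and_congr Iff.rfl (φ.e.forall_congr fun {t} => imp_congr (φ.mem_core₂ _ _).symm
    (forall_congr' fun c => ?_))
  rw [φ.c₁₂_val, φ.hom₁₃.proj, ← φ.i₁₃.core, φ.i₁₃.e.injective.eq_iff]

theorem TVS.Iso.core₁₃_iff (ε : V₀₃) (Ψ : F.d₁₃) :
    TVS.Core₁₃ b₃ ε (φ.c₁₃ Ψ) ↔ TVS.Core₁₃ b₃ ε Ψ := by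
  refine and_congr Iff.rfl (φ.e.forall_congr fun {t} => imp_congr (φ.mem_core₃ _ _).symm
    (forall_congr' fun c => ?_))
  rw [φ.c₁₃_val, φ.hom₁₂.proj, ← φ.i₁₂.core, φ.i₁₂.e.injective.eq_iff]

theorem existsUnique_comap {α β : Type} {p : α → Prop} {q : β → Prop} (e : β ≃ α)
    (h : ∀ b, p (e b) ↔ q b) (hu : ∃! b, q b) : ∃! a, p a := (existsUnique_equiv e h).2 hu

variable {b₀ b₁ b₂ b₃}

section

theorem TVS.Iso.pr₁₂_eq (hF : F.Good b₀ b₂ b₃ b₁) (Ψ : F.dT) : TVS.pr₁₂ (φ.cT Ψ) = φ.c₁₂ (TVS.pr₁₂ Ψ) :=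
  (@eps_map _ _ ⟨DualTot.zero 0⟩ ⟨DualTot.zero 0⟩ _ _ φ.c₁₂ (φ.pr₁₂_iff Ψ)
    (existsUnique_comap _ (φ.pr₁₂_iff Ψ) (hF.pr₁₂ Ψ))).symm

theorem TVS.Iso.pr₁₃_eq (hF : F.Good b₀ b₂ b₃ b₁) (Ψ : F.dT) : TVS.pr₁₃ (φ.cT Ψ) = φ.c₁₃ (TVS.pr₁₃ Ψ) :=
  (@eps_map _ _ ⟨DualTot.zero 0⟩ ⟨DualTot.zero 0⟩ _ _ φ.c₁₃ (φ.pr₁₃_iff Ψ)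
    (existsUnique_comap _ (φ.pr₁₃_iff Ψ) (hF.pr₁₃ Ψ))).symm

theorem TVS.Iso.side₂_eq (Ψ : F.d₁₂) : TVS.side₂ b₀ (φ.c₁₂ Ψ) = Equiv.refl V₀ (TVS.side₂ b₀ Ψ) := by
  unfold TVS.side₂; congr 1; funext e; exact propext (φ.side₂_iff b₀ Ψ e)

theorem TVS.Iso.side₃_eq (Ψ : F.d₁₃) : TVS.side₃ b₀ (φ.c₁₃ Ψ) = Equiv.refl V₀ (TVS.side₃ b₀ Ψ) := by
  unfold TVS.side₃; congr 1; funext e; exact propext (φ.side₃_iff b₀ Ψ e)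

theorem TVS.Good.of_iso (φ : E.Iso F) (hF : F.Good b₀ b₂ b₃ b₁) : E.Good b₀ b₂ b₃ b₁ where
  pr₁₂ Ψ := by
    obtain ⟨Ψ, rfl⟩ := φ.cT.surjective Ψ
    exact existsUnique_comap _ (φ.pr₁₂_iff Ψ) (hF.pr₁₂ Ψ)
  pr₁₃ Ψ := by
    obtain ⟨Ψ, rfl⟩ := φ.cT.surjective Ψ
    exact existsUnique_comap _ (φ.pr₁₃_iff Ψ) (hF.pr₁₃ Ψ)
  side₂ Ψ := by
    obtain ⟨Ψ, rfl⟩ := φ.c₁₂.surjective Ψ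
    exact existsUnique_comap (Equiv.refl _) (φ.side₂_iff b₀ Ψ) (hF.side₂ Ψ)
  side₃ Ψ := by
    obtain ⟨Ψ, rfl⟩ := φ.c₁₃.surjective Ψ
    exact existsUnique_comap (Equiv.refl _) (φ.side₃_iff b₀ Ψ) (hF.side₃ Ψ)
  coreT ε := existsUnique_comap _ (φ.coreT_iff b₁ ε) (hF.coreT ε)
  core₁₂ ε := existsUnique_comap _ (φ.core₁₂_iff b₂ ε) (hF.core₁₂ ε)
  core₁₃ ε := existsUnique_comap _ (φ.core₁₃_iff b₃ ε) (hF.core₁₃ ε)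
  u₁₂ := hF.u₁₂.comap φ.hom₂₃ φ.mem_fib φ.hom₁₂ (l := Equiv.refl V₂) φ.i₂₃.homA (p := φ.c₁₂)
    (φ.pr₁₂_eq hF)
  u₁₃ := hF.u₁₃.comap φ.hom₂₃ φ.mem_fib φ.hom₁₃ (l := Equiv.refl V₃) φ.i₂₃.homB (p := φ.c₁₃)
    (φ.pr₁₃_eq hF)
  v₁₂ := hF.v₁₂.comap φ.hom₂₃ φ.mem_core₂ φ.hom₁₃ (l := Equiv.refl Unit) (.refl _)
    (p := Equiv.refl V₀) φ.side₂_eq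
  v₁₃ := hF.v₁₃.comap φ.hom₂₃ φ.mem_core₃ φ.hom₁₂ (l := Equiv.refl Unit) (.refl _)
    (p := Equiv.refl V₀) φ.side₃_eq

/-- The dual of a statomorphism `φ : E → F` is `Ψ ↦ Ψ ∘ φ`, from the dual of `F` to the dual of `E`. -/
def TVS.Iso.dualX (hF : F.Good b₀ b₂ b₃ b₁) : (F.dualX b₀ b₂ b₃ b₁).Iso (E.dualX b₀ b₂ b₃ b₁) where
  i₁₂ :=
    { e := φ.c₁₂
      homA := dualOth_hom φ.hom₂₃ φ.mem_core₂ φ.hom₁₃ (l := Equiv.refl Unit) (.refl _)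
        (p := Equiv.refl V₀) φ.side₂_eq hF.v₁₂
      homB := dualFib_hom φ.hom₂₃ (Equiv.refl V₂) φ.mem_core₂
      core := fun ε => @eps_map _ _ ⟨DualTot.zero 0⟩ ⟨DualTot.zero 0⟩ _ _ φ.c₁₂ (φ.core₁₂_iff b₂ ε)
        ((TVS.Good.of_iso φ hF).core₁₂ ε) }
  i₁₃ :=
    { e := φ.c₁₃
      homA := dualOth_hom φ.hom₂₃ φ.mem_core₃ φ.hom₁₂ (l := Equiv.refl Unit) (.refl _)
        (p := Equiv.refl V₀) φ.side₃_eq hF.v₁₃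
      homB := dualFib_hom φ.hom₂₃ (Equiv.refl V₃) φ.mem_core₃
      core := fun ε => @eps_map _ _ ⟨DualTot.zero 0⟩ ⟨DualTot.zero 0⟩ _ _ φ.c₁₃ (φ.core₁₃_iff b₃ ε)
        ((TVS.Good.of_iso φ hF).core₁₃ ε) }
  i₂₃ := φ.i₂₃.symm
  e := φ.cT
  hom₁₂ := dualOth_hom φ.hom₂₃ φ.mem_fib φ.hom₁₂ (l := Equiv.refl V₂) φ.i₂₃.homA (p := φ.c₁₂)
    (φ.pr₁₂_eq hF) hF.u₁₂
  hom₁₃ := dualOth_hom φ.hom₂₃ φ.mem_fib φ.hom₁₃ (l := Equiv.refl V₃) φ.i₂₃.homB (p := φ.c₁₃)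
    (φ.pr₁₃_eq hF) hF.u₁₃
  hom₂₃ := dualFib_hom φ.hom₂₃ φ.i₂₃.e φ.mem_fib
  core := fun ε => @eps_map _ _ ⟨DualTot.zero (E.D₂₃.core 0)⟩ ⟨DualTot.zero (F.D₂₃.core 0)⟩ _ _ φ.cT
    (φ.coreT_iff b₁ ε) ((TVS.Good.of_iso φ hF).coreT ε)

end

end Transport

section Dec

local notation "𝔇" => TVS.dec V₁ V₂ V₃ V₁₂ V₁₃ V₂₃ V₁₂₃

theorem dec_mem_fib (d : V₂ × V₃ × V₂₃) (e₁ e₂ e₃ e₁₂ e₁₃ e₂₃ u) :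
    ((e₁, e₂, e₃, e₁₂, e₁₃, e₂₃, u) : V₁ × V₂ × V₃ × V₁₂ × V₁₃ × V₂₃ × V₁₂₃) ∈ TVS.fib 𝔇 d ↔
      (e₂, e₃, e₂₃) = d := Iff.rfl

theorem dec_mem_core₂ (a : V₂) (e₁ e₂ e₃ e₁₂ e₁₃ e₂₃ u) :
    ((e₁, e₂, e₃, e₁₂, e₁₃, e₂₃, u) : V₁ × V₂ × V₃ × V₁₂ × V₁₃ × V₂₃ × V₁₂₃) ∈ TVS.core₂ 𝔇 a ↔
      e₁ = 0 ∧ e₁₂ = 0 ∧ e₃ = 0 ∧ e₂₃ = 0 ∧ e₂ = a := by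
  rw [TVS.core₂, Set.mem_ofPred_eq]
  simp [eq_comm, and_assoc]

theorem dec_mem_core₃ (a : V₃) (e₁ e₂ e₃ e₁₂ e₁₃ e₂₃ u) :
    ((e₁, e₂, e₃, e₁₂, e₁₃, e₂₃, u) : V₁ × V₂ × V₃ × V₁₂ × V₁₃ × V₂₃ × V₁₂₃) ∈ TVS.core₃ 𝔇 a ↔
      e₁ = 0 ∧ e₁₃ = 0 ∧ e₂ = 0 ∧ e₂₃ = 0 ∧ e₃ = a := by
  rw [TVS.core₃, Set.mem_ofPred_eq]
  simp [eq_comm, and_assoc]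

theorem dec_mem_core₂' (a : V₂) (t u) :
    ((0, a, 0, 0, t, 0, u) : V₁ × V₂ × V₃ × V₁₂ × V₁₃ × V₂₃ × V₁₂₃) ∈ TVS.core₂ 𝔇 a :=
  (dec_mem_core₂ _ _ _ _ _ _ _ _).2 ⟨rfl, rfl, rfl, rfl, rfl⟩

theorem dec_mem_core₃' (a : V₃) (t u) :
    ((0, 0, a, t, 0, 0, u) : V₁ × V₂ × V₃ × V₁₂ × V₁₃ × V₂₃ × V₁₂₃) ∈ TVS.core₃ 𝔇 a :=
  (dec_mem_core₃ _ _ _ _ _ _ _ _).2 ⟨rfl, rfl, rfl, rfl, rfl⟩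

open Classical in
/-- The element of the dual of the decomposed triple vector bundle with the given components:
`⟨tupT x, t⟩ = ⟨ε, t₁⟩ + ⟨x₀₃, t₁₂⟩ + ⟨x₀₂, t₁₃⟩ + ⟨x₀, t₁₂₃⟩`. -/
def tupT (x : V₀ × V₂ × V₃ × V₀₂ × V₀₃ × V₂₃ × V₀₂₃) : TVS.dT 𝔇 where
  pt := (x.2.1, x.2.2.1, x.2.2.2.2.2.1)
  fnl :=
    { toFun := fun t => if t ∈ TVS.fib 𝔇 (x.2.1, x.2.2.1, x.2.2.2.2.2.1) then
        b₁ x.2.2.2.2.2.2 t.1 + b₃ x.2.2.2.2.1 t.2.2.2.1 + b₂ x.2.2.2.1 t.2.2.2.2.1 +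
          b₀ x.1 t.2.2.2.2.2.2 else 0
      off := fun t ht => if_neg ht
      add := fun t ht t' ht' _ => by
        obtain ⟨t₁, t₂, t₃, t₁₂, t₁₃, t₂₃, u⟩ := t
        obtain ⟨s₁, s₂, s₃, s₁₂, s₁₃, s₂₃, v⟩ := t'
        rw [if_pos ht, if_pos ht', if_pos]
        · simp only [map_add]; ring
        · exact ht
      smul := fun r t ht => by
        obtain ⟨t₁, t₂, t₃, t₁₂, t₁₃, t₂₃, u⟩ := t
        rw [if_pos ht, if_pos]
        · simp only [map_smul, smul_eq_mul]; ring
        · exact ht }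

theorem tupT_val (x : V₀ × V₂ × V₃ × V₀₂ × V₀₃ × V₂₃ × V₀₂₃) (t : TVS.T 𝔇)
    (h : t ∈ TVS.fib 𝔇 (x.2.1, x.2.2.1, x.2.2.2.2.2.1)) :
    (tupT b₀ b₂ b₃ b₁ x).val t = b₁ x.2.2.2.2.2.2 t.1 + b₃ x.2.2.2.2.1 t.2.2.2.1 +
      b₂ x.2.2.2.1 t.2.2.2.2.1 + b₀ x.1 t.2.2.2.2.2.2 := if_pos h

open Classical in
def tup₁₂ (x : V₀ × V₂ × V₀₂) : TVS.d₁₂ 𝔇 where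
  pt := x.2.1
  fnl :=
    { toFun := fun t => if t ∈ TVS.core₂ 𝔇 x.2.1 then
        b₂ x.2.2 t.2.2.2.2.1 + b₀ x.1 t.2.2.2.2.2.2 else 0
      off := fun t ht => if_neg ht
      add := fun t ht t' ht' _ => by
        obtain ⟨t₁, t₂, t₃, t₁₂, t₁₃, t₂₃, u⟩ := t
        obtain ⟨s₁, s₂, s₃, s₁₂, s₁₃, s₂₃, v⟩ := t'
        rw [if_pos ht, if_pos ht', if_pos]
        · simp only [map_add]; ring
        · rw [dec_mem_core₂] at ht ht'
          refine (dec_mem_core₂ _ _ _ _ _ _ _ _).2 ?_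
          simp [ht, ht']
      smul := fun r t ht => by
        obtain ⟨t₁, t₂, t₃, t₁₂, t₁₃, t₂₃, u⟩ := t
        rw [if_pos ht, if_pos]
        · simp only [map_smul, smul_eq_mul]; ring
        · rw [dec_mem_core₂] at ht
          refine (dec_mem_core₂ _ _ _ _ _ _ _ _).2 ?_
          simp [ht] }

theorem tup₁₂_val (x : V₀ × V₂ × V₀₂) (t : TVS.T 𝔇) (h : t ∈ TVS.core₂ 𝔇 x.2.1) :
    (tup₁₂ b₀ b₂ x).val t = b₂ x.2.2 t.2.2.2.2.1 + b₀ x.1 t.2.2.2.2.2.2 := if_pos h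

open Classical in
def tup₁₃ (x : V₀ × V₃ × V₀₃) : TVS.d₁₃ 𝔇 where
  pt := x.2.1
  fnl :=
    { toFun := fun t => if t ∈ TVS.core₃ 𝔇 x.2.1 then
        b₃ x.2.2 t.2.2.2.1 + b₀ x.1 t.2.2.2.2.2.2 else 0
      off := fun t ht => if_neg ht
      add := fun t ht t' ht' _ => by
        obtain ⟨t₁, t₂, t₃, t₁₂, t₁₃, t₂₃, u⟩ := t
        obtain ⟨s₁, s₂, s₃, s₁₂, s₁₃, s₂₃, v⟩ := t'
        rw [if_pos ht, if_pos ht', if_pos]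
        · simp only [map_add]; ring
        · rw [dec_mem_core₃] at ht ht'
          refine (dec_mem_core₃ _ _ _ _ _ _ _ _).2 ?_
          simp [ht, ht']
      smul := fun r t ht => by
        obtain ⟨t₁, t₂, t₃, t₁₂, t₁₃, t₂₃, u⟩ := t
        rw [if_pos ht, if_pos]
        · simp only [map_smul, smul_eq_mul]; ring
        · rw [dec_mem_core₃] at ht
          refine (dec_mem_core₃ _ _ _ _ _ _ _ _).2 ?_
          simp [ht] }

theorem tup₁₃_val (x : V₀ × V₃ × V₀₃) (t : TVS.T 𝔇) (h : t ∈ TVS.core₃ 𝔇 x.2.1) :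
    (tup₁₃ b₀ b₃ x).val t = b₃ x.2.2 t.2.2.2.1 + b₀ x.1 t.2.2.2.2.2.2 := if_pos h

theorem tupT_val' (x₀ x₂ x₃ x₀₂ x₀₃ x₂₃ ε t₁ t₁₂ t₁₃ u) :
    (tupT b₀ b₂ b₃ b₁ (x₀, x₂, x₃, x₀₂, x₀₃, x₂₃, ε) : TVS.dT 𝔇).val
      (t₁, x₂, x₃, t₁₂, t₁₃, x₂₃, u) = b₁ ε t₁ + b₃ x₀₃ t₁₂ + b₂ x₀₂ t₁₃ + b₀ x₀ u :=
  tupT_val _ _ _ _ _ _ rfl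

theorem tup₁₂_val' (x₀ x₂ x₀₂ t u) :
    (tup₁₂ b₀ b₂ (x₀, x₂, x₀₂) : TVS.d₁₂ 𝔇).val (0, x₂, 0, 0, t, 0, u) = b₂ x₀₂ t + b₀ x₀ u :=
  tup₁₂_val _ _ _ _ (dec_mem_core₂' _ _ _)

theorem tup₁₃_val' (x₀ x₃ x₀₃ t u) :
    (tup₁₃ b₀ b₃ (x₀, x₃, x₀₃) : TVS.d₁₃ 𝔇).val (0, 0, x₃, t, 0, 0, u) = b₃ x₀₃ t + b₀ x₀ u :=
  tup₁₃_val _ _ _ _ (dec_mem_core₃' _ _ _)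

variable {b₀ b₁ b₂ b₃}
variable (h₀ : Function.Bijective b₀) (h₂ : Function.Bijective b₂) (h₃ : Function.Bijective b₃)
  (h₁ : Function.Bijective b₁)

theorem tupT_surjective (h₀ : Function.Bijective b₀) (h₂ : Function.Bijective b₂)
    (h₃ : Function.Bijective b₃) (h₁ : Function.Bijective b₁) :
    Function.Surjective (tupT b₀ b₂ b₃ b₁ :
      _ → TVS.dT 𝔇) := by
  rintro ⟨⟨e₂, e₃, e₂₃⟩, f⟩
  have hadd := fun t ht t' ht' => f.add t ht t' ht' (ht.trans ht'.symm)
  have hsm := f.smul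
  obtain ⟨e₀, he₀⟩ := h₀.2 (IsLinearMap.mk' (fun u => f.toFun (0, e₂, e₃, 0, 0, e₂₃, u))
    ⟨fun u v => by simpa using hadd (0, e₂, e₃, 0, 0, e₂₃, u) rfl (0, e₂, e₃, 0, 0, e₂₃, v) rfl,
      fun r u => by simpa using hsm r (0, e₂, e₃, 0, 0, e₂₃, u) rfl⟩)
  obtain ⟨e₀₂, he₂⟩ := h₂.2 (IsLinearMap.mk' (fun u => f.toFun (0, e₂, e₃, 0, u, e₂₃, 0))
    ⟨fun u v => by simpa using hadd (0, e₂, e₃, 0, u, e₂₃, 0) rfl (0, e₂, e₃, 0, v, e₂₃, 0) rfl,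
      fun r u => by simpa using hsm r (0, e₂, e₃, 0, u, e₂₃, 0) rfl⟩)
  obtain ⟨e₀₃, he₃⟩ := h₃.2 (IsLinearMap.mk' (fun u => f.toFun (0, e₂, e₃, u, 0, e₂₃, 0))
    ⟨fun u v => by simpa using hadd (0, e₂, e₃, u, 0, e₂₃, 0) rfl (0, e₂, e₃, v, 0, e₂₃, 0) rfl,
      fun r u => by simpa using hsm r (0, e₂, e₃, u, 0, e₂₃, 0) rfl⟩)
  obtain ⟨ε, hε⟩ := h₁.2 (IsLinearMap.mk' (fun u => f.toFun (u, e₂, e₃, 0, 0, e₂₃, 0))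
    ⟨fun u v => by simpa using hadd (u, e₂, e₃, 0, 0, e₂₃, 0) rfl (v, e₂, e₃, 0, 0, e₂₃, 0) rfl,
      fun r u => by simpa using hsm r (u, e₂, e₃, 0, 0, e₂₃, 0) rfl⟩)
  refine ⟨(e₀, e₂, e₃, e₀₂, e₀₃, e₂₃, ε), DualTot.ext rfl ?_⟩
  rintro ⟨t₁, t₂, t₃, t₁₂, t₁₃, t₂₃, u⟩ ht
  rw [tupT_val _ _ _ _ _ _ ht]
  obtain ⟨rfl, rfl, rfl⟩ : t₂ = e₂ ∧ t₃ = e₃ ∧ t₂₃ = e₂₃ := by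
    have := (dec_mem_fib _ _ _ _ _ _ _ _).1 ht
    simpa [tupT] using this
  simp only [he₀, he₂, he₃, hε, IsLinearMap.mk'_apply, DualTot.val]
  have k1 := hadd (t₁, t₂, t₃, 0, 0, t₂₃, 0) rfl (0, t₂, t₃, t₁₂, 0, t₂₃, 0) rfl
  have k2 := hadd (t₁, t₂, t₃, t₁₂, 0, t₂₃, 0) rfl (0, t₂, t₃, 0, t₁₃, t₂₃, 0) rfl
  have k3 := hadd (t₁, t₂, t₃, t₁₂, t₁₃, t₂₃, 0) rfl (0, t₂, t₃, 0, 0, t₂₃, u) rfl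
  simp only [add_zero, zero_add] at k1 k2 k3
  linarith

theorem tup₁₂_surjective (h₀ : Function.Bijective b₀) (h₂ : Function.Bijective b₂) :
    Function.Surjective (tup₁₂ b₀ b₂ : _ → TVS.d₁₂ 𝔇) := by
  rintro ⟨e₂, f⟩
  have hm : ∀ t₁₃ u, ((0, e₂, 0, 0, t₁₃, 0, u) : TVS.T 𝔇) ∈ TVS.core₂ 𝔇 e₂ :=
    fun t u => dec_mem_core₂' _ _ _
  have hadd := fun t u t' u' => f.add _ (hm t u) _ (hm t' u') rfl
  have hsm := fun r t u => f.smul r _ (hm t u)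
  simp only [add_zero, smul_zero] at hadd hsm
  obtain ⟨e₀, he₀⟩ := h₀.2 (IsLinearMap.mk' (fun u => f.toFun (0, e₂, 0, 0, 0, 0, u))
    ⟨fun u v => by simpa using hadd 0 u 0 v, fun r u => by simpa using hsm r 0 u⟩)
  obtain ⟨e₀₂, he₂⟩ := h₂.2 (IsLinearMap.mk' (fun u => f.toFun (0, e₂, 0, 0, u, 0, 0))
    ⟨fun u v => by simpa using hadd u 0 v 0, fun r u => by simpa using hsm r u 0⟩)
  refine ⟨(e₀, e₂, e₀₂), DualTot.ext rfl ?_⟩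
  rintro ⟨t₁, t₂, t₃, t₁₂, t₁₃, t₂₃, u⟩ ht
  rw [tup₁₂_val _ _ _ _ ht]
  obtain ⟨rfl, rfl, rfl, rfl, rfl⟩ := (dec_mem_core₂ _ _ _ _ _ _ _ _).1 ht
  simp only [he₀, he₂, IsLinearMap.mk'_apply, DualTot.val]
  simpa using (hadd t₁₃ 0 0 u).symm

theorem tup₁₃_surjective (h₀ : Function.Bijective b₀) (h₃ : Function.Bijective b₃) :
    Function.Surjective (tup₁₃ b₀ b₃ : _ → TVS.d₁₃ 𝔇) := by
  rintro ⟨e₂, f⟩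
  have hm : ∀ t₁₃ u, ((0, 0, e₂, t₁₃, 0, 0, u) : TVS.T 𝔇) ∈ TVS.core₃ 𝔇 e₂ :=
    fun t u => dec_mem_core₃' _ _ _
  have hadd := fun t u t' u' => f.add _ (hm t u) _ (hm t' u') rfl
  have hsm := fun r t u => f.smul r _ (hm t u)
  simp only [add_zero, smul_zero] at hadd hsm
  obtain ⟨e₀, he₀⟩ := h₀.2 (IsLinearMap.mk' (fun u => f.toFun (0, 0, e₂, 0, 0, 0, u))
    ⟨fun u v => by simpa using hadd 0 u 0 v, fun r u => by simpa using hsm r 0 u⟩)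
  obtain ⟨e₀₂, he₂⟩ := h₃.2 (IsLinearMap.mk' (fun u => f.toFun (0, 0, e₂, u, 0, 0, 0))
    ⟨fun u v => by simpa using hadd u 0 v 0, fun r u => by simpa using hsm r u 0⟩)
  refine ⟨(e₀, e₂, e₀₂), DualTot.ext rfl ?_⟩
  rintro ⟨t₁, t₂, t₃, t₁₂, t₁₃, t₂₃, u⟩ ht
  rw [tup₁₃_val _ _ _ _ ht]
  obtain ⟨rfl, rfl, rfl, rfl, rfl⟩ := (dec_mem_core₃ _ _ _ _ _ _ _ _).1 ht
  simp only [he₀, he₂, IsLinearMap.mk'_apply, DualTot.val]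
  simpa using (hadd t₁₂ 0 0 u).symm

/-- A vector is determined by its pairings. -/
theorem pair_ext {A B : Type} [AddCommGroup A] [Module ℝ A] [AddCommGroup B] [Module ℝ B]
    {b : A →ₗ[ℝ] B →ₗ[ℝ] ℝ} (h : Function.Bijective b) {x y : A} (hxy : ∀ z, b x z = b y z) :
    x = y := h.1 (LinearMap.ext hxy)

theorem tupT_ext (h₀ : Function.Bijective b₀) (h₂ : Function.Bijective b₂)
    (h₃ : Function.Bijective b₃) (h₁ : Function.Bijective b₁)
    {x₀ y₀ : V₀} {x₂ y₂ : V₀₂} {x₃ y₃ : V₀₃} {x₁ y₁ : V₀₂₃}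
    (h : ∀ t₁ t₁₂ t₁₃ u, b₁ x₁ t₁ + b₃ x₃ t₁₂ + b₂ x₂ t₁₃ + b₀ x₀ u =
      b₁ y₁ t₁ + b₃ y₃ t₁₂ + b₂ y₂ t₁₃ + b₀ y₀ u) : x₀ = y₀ ∧ x₂ = y₂ ∧ x₃ = y₃ ∧ x₁ = y₁ :=
  ⟨pair_ext h₀ fun z => by simpa using h 0 0 0 z, pair_ext h₂ fun z => by simpa using h 0 0 z 0,
    pair_ext h₃ fun z => by simpa using h 0 z 0 0, pair_ext h₁ fun z => by simpa using h z 0 0 0⟩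

theorem tup₂_ext {A A' B B' : Type} [AddCommGroup A] [Module ℝ A] [AddCommGroup B] [Module ℝ B]
    [AddCommGroup A'] [Module ℝ A'] [AddCommGroup B'] [Module ℝ B']
    {b : A →ₗ[ℝ] B →ₗ[ℝ] ℝ} {c : A' →ₗ[ℝ] B' →ₗ[ℝ] ℝ} (hb : Function.Bijective b)
    (hc : Function.Bijective c) {x y : A} {x' y' : A'}
    (h : ∀ t u, c x' t + b x u = c y' t + b y u) : x = y ∧ x' = y' :=
  ⟨pair_ext hb fun z => by simpa using h 0 z, pair_ext hc fun z => by simpa using h z 0⟩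

theorem tupT_injective (h₀ : Function.Bijective b₀) (h₂ : Function.Bijective b₂)
    (h₃ : Function.Bijective b₃) (h₁ : Function.Bijective b₁) :
    Function.Injective (tupT b₀ b₂ b₃ b₁ : _ → TVS.dT 𝔇) := by
  rintro ⟨x₀, x₂, x₃, x₀₂, x₀₃, x₂₃, xε⟩ ⟨y₀, y₂, y₃, y₀₂, y₀₃, y₂₃, yε⟩ h
  have hp : (x₂, x₃, x₂₃) = (y₂, y₃, y₂₃) := congrArg DualTot.pt h
  simp only [Prod.mk.injEq] at hp
  obtain ⟨rfl, rfl, rfl⟩ := hp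
  obtain ⟨rfl, rfl, rfl, rfl⟩ := tupT_ext h₀ h₂ h₃ h₁ (x₀ := x₀) (y₀ := y₀) (x₂ := x₀₂) (y₂ := y₀₂)
    (x₃ := x₀₃) (y₃ := y₀₃) (x₁ := xε) (y₁ := yε) fun t₁ t₁₂ t₁₃ u => by
      have e := congrArg (fun Ψ => DualTot.val Ψ (t₁, x₂, x₃, t₁₂, t₁₃, x₂₃, u)) h
      exact (tupT_val' _ _ _ _ _ _ _ _ _ _ _ _ _ _ _).symm.trans (e.trans (tupT_val' _ _ _ _ _ _ _ _ _ _ _ _ _ _ _))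
  rfl

theorem tup₁₂_injective (h₀ : Function.Bijective b₀) (h₂ : Function.Bijective b₂) :
    Function.Injective (tup₁₂ b₀ b₂ : _ → TVS.d₁₂ 𝔇) := by
  rintro ⟨x₀, x₂, x₀₂⟩ ⟨y₀, y₂, y₀₂⟩ h
  obtain rfl : x₂ = y₂ := congrArg DualTot.pt h
  obtain ⟨rfl, rfl⟩ := tup₂_ext h₀ h₂ (x := x₀) (y := y₀) (x' := x₀₂) (y' := y₀₂) fun t u => by
      have e := congrArg (fun Ψ => DualTot.val Ψ (0, x₂, 0, 0, t, 0, u)) h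
      exact (tup₁₂_val' _ _ _ _ _ _ _).symm.trans (e.trans (tup₁₂_val' _ _ _ _ _ _ _))
  rfl

theorem tup₁₃_injective (h₀ : Function.Bijective b₀) (h₃ : Function.Bijective b₃) :
    Function.Injective (tup₁₃ b₀ b₃ : _ → TVS.d₁₃ 𝔇) := by
  rintro ⟨x₀, x₂, x₀₂⟩ ⟨y₀, y₂, y₀₂⟩ h
  obtain rfl : x₂ = y₂ := congrArg DualTot.pt h
  obtain ⟨rfl, rfl⟩ := tup₂_ext h₀ h₃ (x := x₀) (y := y₀) (x' := x₀₂) (y' := y₀₂) fun t u => by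
      have e := congrArg (fun Ψ => DualTot.val Ψ (0, 0, x₂, t, 0, 0, u)) h
      exact (tup₁₃_val' _ _ _ _ _ _ _).symm.trans (e.trans (tup₁₃_val' _ _ _ _ _ _ _))
  rfl

theorem tup_pr₁₂ (h₀ : Function.Bijective b₀) (h₂ : Function.Bijective b₂)
    (x : V₀ × V₂ × V₃ × V₀₂ × V₀₃ × V₂₃ × V₀₂₃) (y : V₀ × V₂ × V₀₂) :
    TVS.Pr₁₂ (tupT b₀ b₂ b₃ b₁ x : TVS.dT 𝔇) (tup₁₂ b₀ b₂ y) ↔ y = (x.1, x.2.1, x.2.2.2.1) := by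
  obtain ⟨x₀, x₂, x₃, x₀₂, x₀₃, x₂₃, xε⟩ := x
  obtain ⟨y₀, y₂, y₀₂⟩ := y
  have key : ∀ t₁ t₁₂ t₁₃ u t v, (𝔇).over₁₂.add ((𝔇).over₂₃.smul 0 (t₁, x₂, x₃, t₁₂, t₁₃, x₂₃, u))
      (0, x₂, 0, 0, t, 0, v) = (0, x₂, x₃, 0, t, x₂₃, v) := fun _ _ _ _ _ _ => by simp
  constructor
  · rintro ⟨h, h'⟩
    obtain rfl : y₂ = x₂ := h
    obtain ⟨rfl, rfl⟩ := tup₂_ext h₀ h₂ (x := y₀) (y := x₀) (x' := y₀₂) (y' := x₀₂) fun t u => by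
      have := h' (0, y₂, x₃, 0, 0, x₂₃, 0) rfl _ (dec_mem_core₂' y₂ t u) (by simp)
      rw [key, tup₁₂_val', tupT_val'] at this
      simpa using this
    rfl
  · intro h
    obtain ⟨rfl, rfl, rfl⟩ : y₀ = x₀ ∧ y₂ = x₂ ∧ y₀₂ = x₀₂ := by simpa using h
    refine ⟨rfl, ?_⟩
    rintro ⟨t₁, t₂, t₃, t₁₂, t₁₃, t₂₃, u⟩ ht ⟨c₁, c₂, c₃, c₁₂, c₁₃, c₂₃, v⟩ hc -
    obtain ⟨rfl, rfl, rfl⟩ : t₂ = y₂ ∧ t₃ = x₃ ∧ t₂₃ = x₂₃ := by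
      simpa [tupT] using (dec_mem_fib _ _ _ _ _ _ _ _).1 ht
    obtain ⟨rfl, rfl, rfl, rfl, hh⟩ := (dec_mem_core₂ _ _ _ _ _ _ _ _).1 hc
    obtain rfl : c₂ = t₂ := hh
    rw [key, tup₁₂_val', tupT_val']
    simp

theorem tup_pr₁₃ (h₀ : Function.Bijective b₀) (h₃ : Function.Bijective b₃)
    (x : V₀ × V₂ × V₃ × V₀₂ × V₀₃ × V₂₃ × V₀₂₃) (y : V₀ × V₃ × V₀₃) :
    TVS.Pr₁₃ (tupT b₀ b₂ b₃ b₁ x : TVS.dT 𝔇) (tup₁₃ b₀ b₃ y) ↔ y = (x.1, x.2.2.1, x.2.2.2.2.1) := by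
  obtain ⟨x₀, x₂, x₃, x₀₂, x₀₃, x₂₃, xε⟩ := x
  obtain ⟨y₀, y₃, y₀₃⟩ := y
  have key : ∀ t₁ t₁₂ t₁₃ u t v, (𝔇).over₁₃.add ((𝔇).over₂₃.smul 0 (t₁, x₂, x₃, t₁₂, t₁₃, x₂₃, u))
      (0, 0, x₃, t, 0, 0, v) = (0, x₂, x₃, t, 0, x₂₃, v) := fun _ _ _ _ _ _ => by simp
  constructor
  · rintro ⟨h, h'⟩
    obtain rfl : y₃ = x₃ := h
    obtain ⟨rfl, rfl⟩ := tup₂_ext h₀ h₃ (x := y₀) (y := x₀) (x' := y₀₃) (y' := x₀₃) fun t u => by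
      have := h' (0, x₂, y₃, 0, 0, x₂₃, 0) rfl _ (dec_mem_core₃' y₃ t u) (by simp)
      rw [key, tup₁₃_val', tupT_val'] at this
      simpa using this
    rfl
  · intro h
    obtain ⟨rfl, rfl, rfl⟩ : y₀ = x₀ ∧ y₃ = x₃ ∧ y₀₃ = x₀₃ := by simpa using h
    refine ⟨rfl, ?_⟩
    rintro ⟨t₁, t₂, t₃, t₁₂, t₁₃, t₂₃, u⟩ ht ⟨c₁, c₂, c₃, c₁₂, c₁₃, c₂₃, v⟩ hc -
    obtain ⟨rfl, rfl, rfl⟩ : t₂ = x₂ ∧ t₃ = y₃ ∧ t₂₃ = x₂₃ := by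
      simpa [tupT] using (dec_mem_fib _ _ _ _ _ _ _ _).1 ht
    obtain ⟨rfl, rfl, rfl, rfl, hh⟩ := (dec_mem_core₃ _ _ _ _ _ _ _ _).1 hc
    obtain rfl : c₃ = t₃ := hh
    rw [key, tup₁₃_val', tupT_val']
    simp

theorem tup_side₂ (h₀ : Function.Bijective b₀) (x : V₀ × V₂ × V₀₂) (e : V₀) :
    TVS.Side₂ b₀ (tup₁₂ b₀ b₂ x : TVS.d₁₂ 𝔇) e ↔ e = x.1 := by
  obtain ⟨x₀, x₂, x₀₂⟩ := x
  have key : ∀ t u v, (𝔇).over₁₃.add ((𝔇).over₂₃.smul 0 (0, x₂, 0, 0, t, 0, u)) ((𝔇).core v) =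
      (0, x₂, 0, 0, 0, 0, v) := fun _ _ _ => by simp
  constructor
  · intro h
    refine pair_ext h₀ fun u => ?_
    have := h _ (dec_mem_core₂' x₂ 0 0) u (by simp)
    rw [key, tup₁₂_val'] at this
    simpa using this
  · rintro rfl ⟨t₁, t₂, t₃, t₁₂, t₁₃, t₂₃, u⟩ ht v -
    obtain ⟨rfl, rfl, rfl, rfl, hh⟩ := (dec_mem_core₂ _ _ _ _ _ _ _ _).1 ht
    obtain rfl : t₂ = x₂ := hh
    rw [key, tup₁₂_val']
    simp

theorem tup_side₃ (h₀ : Function.Bijective b₀) (x : V₀ × V₃ × V₀₃) (e : V₀) :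
    TVS.Side₃ b₀ (tup₁₃ b₀ b₃ x : TVS.d₁₃ 𝔇) e ↔ e = x.1 := by
  obtain ⟨x₀, x₃, x₀₃⟩ := x
  have key : ∀ t u v, (𝔇).over₁₂.add ((𝔇).over₂₃.smul 0 (0, 0, x₃, t, 0, 0, u)) ((𝔇).core v) =
      (0, 0, x₃, 0, 0, 0, v) := fun _ _ _ => by simp
  constructor
  · intro h
    refine pair_ext h₀ fun u => ?_
    have := h _ (dec_mem_core₃' x₃ 0 0) u (by simp)
    rw [key, tup₁₃_val'] at this
    simpa using this
  · rintro rfl ⟨t₁, t₂, t₃, t₁₂, t₁₃, t₂₃, u⟩ ht v -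
    obtain ⟨rfl, rfl, rfl, rfl, hh⟩ := (dec_mem_core₃ _ _ _ _ _ _ _ _).1 ht
    obtain rfl : t₃ = x₃ := hh
    rw [key, tup₁₃_val']
    simp

theorem tup_coreT (h₀ : Function.Bijective b₀) (h₂ : Function.Bijective b₂)
    (h₃ : Function.Bijective b₃) (h₁ : Function.Bijective b₁) (ε : V₀₂₃)
    (x : V₀ × V₂ × V₃ × V₀₂ × V₀₃ × V₂₃ × V₀₂₃) :
    TVS.CoreT b₁ ε (tupT b₀ b₂ b₃ b₁ x : TVS.dT 𝔇) ↔ x = (0, 0, 0, 0, 0, 0, ε) := by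
  obtain ⟨x₀, x₂, x₃, x₀₂, x₀₃, x₂₃, xε⟩ := x
  constructor
  · rintro ⟨h, h'⟩
    obtain ⟨rfl, rfl, rfl⟩ : x₂ = 0 ∧ x₃ = 0 ∧ x₂₃ = 0 := by simpa [tupT] using h
    obtain ⟨rfl, rfl, rfl, rfl⟩ := tupT_ext h₀ h₂ h₃ h₁ (x₀ := x₀) (y₀ := 0) (x₂ := x₀₂) (y₂ := 0)
      (x₃ := x₀₃) (y₃ := 0) (x₁ := xε) (y₁ := ε) fun t₁ t₁₂ t₁₃ u => by
        have := h' (t₁, 0, 0, t₁₂, t₁₃, 0, u) rfl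
        rw [tupT_val'] at this
        simpa using this
    rfl
  · intro h
    obtain ⟨rfl, rfl, rfl, rfl, rfl, rfl, rfl⟩ : x₀ = 0 ∧ x₂ = 0 ∧ x₃ = 0 ∧ x₀₂ = 0 ∧ x₀₃ = 0 ∧
      x₂₃ = 0 ∧ xε = ε := by simpa using h
    refine ⟨rfl, ?_⟩
    rintro ⟨t₁, t₂, t₃, t₁₂, t₁₃, t₂₃, u⟩ ht
    rw [tupT_val _ _ _ _ _ _ ht]
    simp

theorem tup_core₁₂ (h₀ : Function.Bijective b₀) (h₂ : Function.Bijective b₂) (ε : V₀₂)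
    (x : V₀ × V₂ × V₀₂) :
    TVS.Core₁₂ b₂ ε (tup₁₂ b₀ b₂ x : TVS.d₁₂ 𝔇) ↔ x = (0, 0, ε) := by
  obtain ⟨x₀, x₂, x₀₂⟩ := x
  constructor
  · rintro ⟨h, h'⟩
    obtain rfl : x₂ = 0 := h
    obtain ⟨rfl, rfl⟩ := tup₂_ext h₀ h₂ (x := x₀) (y := 0) (x' := x₀₂) (y' := ε) fun t u => by
      have := h' _ (dec_mem_core₂' 0 t u) t (by simp)
      rw [tup₁₂_val'] at this
      simpa using this
    rfl
  · intro h
    obtain ⟨rfl, rfl, rfl⟩ : x₀ = 0 ∧ x₂ = 0 ∧ x₀₂ = ε := by simpa using h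
    refine ⟨rfl, ?_⟩
    rintro ⟨t₁, t₂, t₃, t₁₂, t₁₃, t₂₃, u⟩ ht c hc
    obtain ⟨-, -, rfl⟩ : t₁ = 0 ∧ t₃ = 0 ∧ t₁₃ = c := by simpa using hc
    rw [tup₁₂_val _ _ _ _ ht]
    simp

theorem tup_core₁₃ (h₀ : Function.Bijective b₀) (h₃ : Function.Bijective b₃) (ε : V₀₃)
    (x : V₀ × V₃ × V₀₃) :
    TVS.Core₁₃ b₃ ε (tup₁₃ b₀ b₃ x : TVS.d₁₃ 𝔇) ↔ x = (0, 0, ε) := by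
  obtain ⟨x₀, x₂, x₀₂⟩ := x
  constructor
  · rintro ⟨h, h'⟩
    obtain rfl : x₂ = 0 := h
    obtain ⟨rfl, rfl⟩ := tup₂_ext h₀ h₃ (x := x₀) (y := 0) (x' := x₀₂) (y' := ε) fun t u => by
      have := h' _ (dec_mem_core₃' 0 t u) t (by simp)
      rw [tup₁₃_val'] at this
      simpa using this
    rfl
  · intro h
    obtain ⟨rfl, rfl, rfl⟩ : x₀ = 0 ∧ x₂ = 0 ∧ x₀₂ = ε := by simpa using h
    refine ⟨rfl, ?_⟩
    rintro ⟨t₁, t₂, t₃, t₁₂, t₁₃, t₂₃, u⟩ ht c hc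
    obtain ⟨-, -, rfl⟩ : t₁ = 0 ∧ t₂ = 0 ∧ t₁₂ = c := by simpa using hc
    rw [tup₁₃_val _ _ _ _ ht]
    simp

local notation "𝔇'" => TVS.dec V₀ V₂ V₃ V₀₂ V₀₃ V₂₃ V₀₂₃

theorem pr₁₂_tup (h₀ : Function.Bijective b₀) (h₂ : Function.Bijective b₂)
    (x : V₀ × V₂ × V₃ × V₀₂ × V₀₃ × V₂₃ × V₀₂₃) :
    TVS.pr₁₂ (tupT b₀ b₂ b₃ b₁ x : TVS.dT 𝔇) = tup₁₂ b₀ b₂ (x.1, x.2.1, x.2.2.2.1) := by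
  refine @eps_eq _ ⟨DualTot.zero 0⟩ _ ?_ _ ((tup_pr₁₂ h₀ h₂ x _).2 rfl)
  refine (existsUnique_equiv (Equiv.ofBijective _ ⟨tup₁₂_injective h₀ h₂, tup₁₂_surjective h₀ h₂⟩)
    fun y => tup_pr₁₂ h₀ h₂ x y).2 ⟨_, rfl, fun _ h => h⟩

theorem pr₁₃_tup (h₀ : Function.Bijective b₀) (h₃ : Function.Bijective b₃)
    (x : V₀ × V₂ × V₃ × V₀₂ × V₀₃ × V₂₃ × V₀₂₃) :
    TVS.pr₁₃ (tupT b₀ b₂ b₃ b₁ x : TVS.dT 𝔇) = tup₁₃ b₀ b₃ (x.1, x.2.2.1, x.2.2.2.2.1) := by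
  refine @eps_eq _ ⟨DualTot.zero 0⟩ _ ?_ _ ((tup_pr₁₃ h₀ h₃ x _).2 rfl)
  refine (existsUnique_equiv (Equiv.ofBijective _ ⟨tup₁₃_injective h₀ h₃, tup₁₃_surjective h₀ h₃⟩)
    fun y => tup_pr₁₃ h₀ h₃ x y).2 ⟨_, rfl, fun _ h => h⟩

theorem side₂_tup (h₀ : Function.Bijective b₀) (x : V₀ × V₂ × V₀₂) :
    TVS.side₂ b₀ (tup₁₂ b₀ b₂ x : TVS.d₁₂ 𝔇) = x.1 := by
  refine eps_eq ?_ ((tup_side₂ h₀ x _).2 rfl)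
  exact ⟨x.1, (tup_side₂ h₀ x _).2 rfl, fun y hy => (tup_side₂ h₀ x _).1 hy⟩

theorem side₃_tup (h₀ : Function.Bijective b₀) (x : V₀ × V₃ × V₀₃) :
    TVS.side₃ b₀ (tup₁₃ b₀ b₃ x : TVS.d₁₃ 𝔇) = x.1 := by
  refine eps_eq ?_ ((tup_side₃ h₀ x _).2 rfl)
  exact ⟨x.1, (tup_side₃ h₀ x _).2 rfl, fun y hy => (tup_side₃ h₀ x _).1 hy⟩

theorem tup_addT₁₂ (h₀ : Function.Bijective b₀) (h₂ : Function.Bijective b₂)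
    (h₃ : Function.Bijective b₃) (h₁ : Function.Bijective b₁)
    (x y z : V₀ × V₂ × V₃ × V₀₂ × V₀₃ × V₂₃ × V₀₂₃) (hxy : (𝔇').over₁₂.proj x = (𝔇').over₁₂.proj y) :
    OthAdd (𝔇).over₁₂ (𝔇).D₂₃.overA (tupT b₀ b₂ b₃ b₁ x : TVS.dT 𝔇) (tupT b₀ b₂ b₃ b₁ y)
      (tupT b₀ b₂ b₃ b₁ z) ↔ (𝔇').over₁₂.add x y = z := by
  obtain ⟨x₀, x₂, x₃, x₀₂, x₀₃, x₂₃, xε⟩ := x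
  obtain ⟨y₀, y₂, y₃, y₀₂, y₀₃, y₂₃, yε⟩ := y
  obtain ⟨z₀, z₂, z₃, z₀₂, z₀₃, z₂₃, zε⟩ := z
  obtain ⟨rfl, rfl, rfl⟩ : x₀ = y₀ ∧ x₂ = y₂ ∧ x₀₂ = y₀₂ := by simpa using hxy
  constructor
  · rintro ⟨h, h'⟩
    obtain ⟨rfl, rfl, rfl⟩ : z₂ = x₂ ∧ z₃ = x₃ + y₃ ∧ z₂₃ = x₂₃ + y₂₃ := by simpa [tupT] using h
    obtain ⟨rfl, rfl, rfl, rfl⟩ := tupT_ext h₀ h₂ h₃ h₁ (x₀ := z₀) (y₀ := x₀) (x₂ := z₀₂) (y₂ := x₀₂)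
      (x₃ := z₀₃) (y₃ := x₀₃ + y₀₃) (x₁ := zε) (y₁ := xε + yε) fun t₁ t₁₂ t₁₃ u => by
        have := h' (t₁, z₂, x₃, t₁₂, t₁₃, x₂₃, u) rfl (t₁, z₂, y₃, t₁₂, 0, y₂₃, 0) rfl rfl
        simp only [add_zero] at this
        rw [tupT_val', tupT_val', tupT_val'] at this
        simp only [map_add, LinearMap.add_apply, map_zero] at this ⊢
        linarith
    rfl
  · rintro h
    obtain ⟨rfl, rfl, rfl, rfl, rfl, rfl, rfl⟩ : x₀ = z₀ ∧ x₂ = z₂ ∧ x₃ + y₃ = z₃ ∧ x₀₂ = z₀₂ ∧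
      x₀₃ + y₀₃ = z₀₃ ∧ x₂₃ + y₂₃ = z₂₃ ∧ xε + yε = zε := by simpa using h
    refine ⟨rfl, ?_⟩
    rintro ⟨t₁, t₂, t₃, t₁₂, t₁₃, t₂₃, u⟩ ht ⟨s₁, s₂, s₃, s₁₂, s₁₃, s₂₃, v⟩ hs hst
    obtain ⟨rfl, rfl, rfl⟩ : s₁ = t₁ ∧ s₂ = t₂ ∧ s₁₂ = t₁₂ := by simpa [eq_comm] using hst
    obtain ⟨rfl, rfl, rfl⟩ : s₂ = x₂ ∧ t₃ = x₃ ∧ t₂₃ = x₂₃ := by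
      simpa [tupT] using (dec_mem_fib _ _ _ _ _ _ _ _).1 ht
    obtain ⟨-, rfl, rfl⟩ : s₂ = s₂ ∧ s₃ = y₃ ∧ s₂₃ = y₂₃ := by
      simpa [tupT] using (dec_mem_fib _ _ _ _ _ _ _ _).1 hs
    simp only
    rw [tupT_val', tupT_val', tupT_val']
    simp only [map_add, LinearMap.add_apply]
    ring

theorem tup_addT₁₃ (h₀ : Function.Bijective b₀) (h₂ : Function.Bijective b₂)
    (h₃ : Function.Bijective b₃) (h₁ : Function.Bijective b₁)
    (x y z : V₀ × V₂ × V₃ × V₀₂ × V₀₃ × V₂₃ × V₀₂₃) (hxy : (𝔇').over₁₃.proj x = (𝔇').over₁₃.proj y) :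
    OthAdd (𝔇).over₁₃ (𝔇).D₂₃.overB (tupT b₀ b₂ b₃ b₁ x : TVS.dT 𝔇) (tupT b₀ b₂ b₃ b₁ y)
      (tupT b₀ b₂ b₃ b₁ z) ↔ (𝔇').over₁₃.add x y = z := by
  obtain ⟨x₀, x₂, x₃, x₀₂, x₀₃, x₂₃, xε⟩ := x
  obtain ⟨y₀, y₂, y₃, y₀₂, y₀₃, y₂₃, yε⟩ := y
  obtain ⟨z₀, z₂, z₃, z₀₂, z₀₃, z₂₃, zε⟩ := z
  obtain ⟨rfl, rfl, rfl⟩ : x₀ = y₀ ∧ x₃ = y₃ ∧ x₀₃ = y₀₃ := by simpa using hxy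
  constructor
  · rintro ⟨h, h'⟩
    obtain ⟨rfl, rfl, rfl⟩ : z₂ = x₂ + y₂ ∧ z₃ = x₃ ∧ z₂₃ = x₂₃ + y₂₃ := by simpa [tupT] using h
    obtain ⟨rfl, rfl, rfl, rfl⟩ := tupT_ext h₀ h₂ h₃ h₁ (x₀ := z₀) (y₀ := x₀) (x₂ := z₀₂)
      (y₂ := x₀₂ + y₀₂)
      (x₃ := z₀₃) (y₃ := x₀₃) (x₁ := zε) (y₁ := xε + yε) fun t₁ t₁₂ t₁₃ u => by
        have := h' (t₁, x₂, z₃, t₁₂, t₁₃, x₂₃, u) rfl (t₁, y₂, z₃, 0, t₁₃, y₂₃, 0) rfl rfl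
        simp only [add_zero] at this
        rw [tupT_val', tupT_val', tupT_val'] at this
        simp only [map_add, LinearMap.add_apply, map_zero] at this ⊢
        linarith
    rfl
  · rintro h
    obtain ⟨rfl, rfl, rfl, rfl, rfl, rfl, rfl⟩ : x₀ = z₀ ∧ x₂ + y₂ = z₂ ∧ x₃ = z₃ ∧ x₀₂ + y₀₂ = z₀₂ ∧
      x₀₃ = z₀₃ ∧ x₂₃ + y₂₃ = z₂₃ ∧ xε + yε = zε := by simpa using h
    refine ⟨rfl, ?_⟩
    rintro ⟨t₁, t₂, t₃, t₁₂, t₁₃, t₂₃, u⟩ ht ⟨s₁, s₂, s₃, s₁₂, s₁₃, s₂₃, v⟩ hs hst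
    obtain ⟨rfl, rfl, rfl⟩ : s₁ = t₁ ∧ s₃ = t₃ ∧ s₁₃ = t₁₃ := by simpa [eq_comm] using hst
    obtain ⟨rfl, rfl, rfl⟩ : t₂ = x₂ ∧ s₃ = x₃ ∧ t₂₃ = x₂₃ := by
      simpa [tupT] using (dec_mem_fib _ _ _ _ _ _ _ _).1 ht
    obtain ⟨rfl, -, rfl⟩ : s₂ = y₂ ∧ s₃ = s₃ ∧ s₂₃ = y₂₃ := by
      simpa [tupT] using (dec_mem_fib _ _ _ _ _ _ _ _).1 hs
    simp only
    rw [tupT_val', tupT_val', tupT_val']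
    simp only [map_add, LinearMap.add_apply]
    ring

theorem tup_smulT₁₂ (h₀ : Function.Bijective b₀) (h₂ : Function.Bijective b₂)
    (h₃ : Function.Bijective b₃) (h₁ : Function.Bijective b₁) (r : ℝ)
    (x z : V₀ × V₂ × V₃ × V₀₂ × V₀₃ × V₂₃ × V₀₂₃) :
    OthSmul (𝔇).over₁₂ (𝔇).D₂₃.overA TVS.pr₁₂ r (tupT b₀ b₂ b₃ b₁ x : TVS.dT 𝔇)
      (tupT b₀ b₂ b₃ b₁ z) ↔ (𝔇').over₁₂.smul r x = z := by
  unfold OthSmul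
  rw [pr₁₂_tup h₀ h₂, pr₁₂_tup h₀ h₂, (tup₁₂_injective h₀ h₂).eq_iff]
  obtain ⟨x₀, x₂, x₃, x₀₂, x₀₃, x₂₃, xε⟩ := x
  obtain ⟨z₀, z₂, z₃, z₀₂, z₀₃, z₂₃, zε⟩ := z
  constructor
  · rintro ⟨h, hp, h'⟩
    obtain ⟨rfl, rfl, rfl⟩ : z₀ = x₀ ∧ z₂ = x₂ ∧ z₀₂ = x₀₂ := by simpa using hp
    obtain ⟨-, rfl, rfl⟩ : z₂ = z₂ ∧ z₃ = r • x₃ ∧ z₂₃ = r • x₂₃ := by simpa [tupT] using h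
    obtain ⟨rfl, rfl⟩ := tup₂_ext h₃ h₁ (x := z₀₃) (y := r • x₀₃) (x' := zε) (y' := r • xε)
      fun t₁ t₁₂ => by
        have := h' (t₁, z₂, x₃, t₁₂, 0, x₂₃, 0) rfl
        simp only [smul_zero] at this
        rw [tupT_val', tupT_val'] at this
        simp only [map_smul, LinearMap.smul_apply, map_zero, smul_eq_mul] at this ⊢
        linarith
    rfl
  · rintro h
    obtain ⟨rfl, rfl, rfl, rfl, rfl, rfl, rfl⟩ : x₀ = z₀ ∧ x₂ = z₂ ∧ r • x₃ = z₃ ∧ x₀₂ = z₀₂ ∧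
      r • x₀₃ = z₀₃ ∧ r • x₂₃ = z₂₃ ∧ r • xε = zε := by simpa using h
    refine ⟨rfl, rfl, ?_⟩
    rintro ⟨t₁, t₂, t₃, t₁₂, t₁₃, t₂₃, u⟩ ht
    obtain ⟨rfl, rfl, rfl⟩ : t₂ = x₂ ∧ t₃ = x₃ ∧ t₂₃ = x₂₃ := by
      simpa [tupT] using (dec_mem_fib _ _ _ _ _ _ _ _).1 ht
    simp only
    rw [tupT_val', tupT_val']
    simp only [map_smul, LinearMap.smul_apply, smul_eq_mul]
    ring

theorem tup_smulT₁₃ (h₀ : Function.Bijective b₀) (h₂ : Function.Bijective b₂)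
    (h₃ : Function.Bijective b₃) (h₁ : Function.Bijective b₁) (r : ℝ)
    (x z : V₀ × V₂ × V₃ × V₀₂ × V₀₃ × V₂₃ × V₀₂₃) :
    OthSmul (𝔇).over₁₃ (𝔇).D₂₃.overB TVS.pr₁₃ r (tupT b₀ b₂ b₃ b₁ x : TVS.dT 𝔇)
      (tupT b₀ b₂ b₃ b₁ z) ↔ (𝔇').over₁₃.smul r x = z := by
  unfold OthSmul
  rw [pr₁₃_tup h₀ h₃, pr₁₃_tup h₀ h₃, (tup₁₃_injective h₀ h₃).eq_iff]
  obtain ⟨x₀, x₂, x₃, x₀₂, x₀₃, x₂₃, xε⟩ := x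
  obtain ⟨z₀, z₂, z₃, z₀₂, z₀₃, z₂₃, zε⟩ := z
  constructor
  · rintro ⟨h, hp, h'⟩
    obtain ⟨rfl, rfl, rfl⟩ : z₀ = x₀ ∧ z₃ = x₃ ∧ z₀₃ = x₀₃ := by simpa using hp
    obtain ⟨rfl, -, rfl⟩ : z₂ = r • x₂ ∧ z₃ = z₃ ∧ z₂₃ = r • x₂₃ := by simpa [tupT] using h
    obtain ⟨rfl, rfl⟩ := tup₂_ext h₂ h₁ (x := z₀₂) (y := r • x₀₂) (x' := zε) (y' := r • xε)
      fun t₁ t₁₃ => by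
        have := h' (t₁, x₂, z₃, 0, t₁₃, x₂₃, 0) rfl
        simp only [smul_zero] at this
        rw [tupT_val', tupT_val'] at this
        simp only [map_smul, LinearMap.smul_apply, map_zero, smul_eq_mul] at this ⊢
        linarith
    rfl
  · rintro h
    obtain ⟨rfl, rfl, rfl, rfl, rfl, rfl, rfl⟩ : x₀ = z₀ ∧ r • x₂ = z₂ ∧ x₃ = z₃ ∧ r • x₀₂ = z₀₂ ∧
      x₀₃ = z₀₃ ∧ r • x₂₃ = z₂₃ ∧ r • xε = zε := by simpa using h
    refine ⟨rfl, rfl, ?_⟩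
    rintro ⟨t₁, t₂, t₃, t₁₂, t₁₃, t₂₃, u⟩ ht
    obtain ⟨rfl, rfl, rfl⟩ : t₂ = x₂ ∧ t₃ = x₃ ∧ t₂₃ = x₂₃ := by
      simpa [tupT] using (dec_mem_fib _ _ _ _ _ _ _ _).1 ht
    simp only
    rw [tupT_val', tupT_val']
    simp only [map_smul, LinearMap.smul_apply, smul_eq_mul]
    ring

theorem tup_add₁₂ (h₀ : Function.Bijective b₀) (h₂ : Function.Bijective b₂)
    (x y z : V₀ × V₂ × V₀₂) (hxy : x.1 = y.1) :
    OthAdd (𝔇).over₁₃ (.ofModule V₂) (tup₁₂ b₀ b₂ x : TVS.d₁₂ 𝔇) (tup₁₂ b₀ b₂ y)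
      (tup₁₂ b₀ b₂ z) ↔ (𝔇').D₁₂.overA.add x y = z := by
  obtain ⟨x₀, x₂, x₀₂⟩ := x
  obtain ⟨y₀, y₂, y₀₂⟩ := y
  obtain ⟨z₀, z₂, z₀₂⟩ := z
  obtain rfl : x₀ = y₀ := hxy
  have key : ∀ t u v, (𝔇).over₁₃.add (0, x₂, 0, 0, t, 0, u) (0, y₂, 0, 0, t, 0, v) =
      (0, x₂ + y₂, 0, 0, t, 0, u + v) := fun _ _ _ => by simp
  constructor
  · rintro ⟨h, h'⟩
    obtain rfl : z₂ = x₂ + y₂ := h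
    obtain ⟨rfl, rfl⟩ := tup₂_ext h₀ h₂ (x := z₀) (y := x₀) (x' := z₀₂) (y' := x₀₂ + y₀₂)
      fun t u => by
        have := h' _ (dec_mem_core₂' x₂ t u) _ (dec_mem_core₂' y₂ t 0) rfl
        rw [key, tup₁₂_val', tup₁₂_val', tup₁₂_val'] at this
        simp only [map_add, LinearMap.add_apply, map_zero] at this ⊢
        linarith
    rfl
  · rintro h
    obtain ⟨rfl, rfl, rfl⟩ : x₀ = z₀ ∧ x₂ + y₂ = z₂ ∧ x₀₂ + y₀₂ = z₀₂ := by simpa using h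
    refine ⟨rfl, ?_⟩
    rintro ⟨t₁, t₂, t₃, t₁₂, t₁₃, t₂₃, u⟩ ht ⟨s₁, s₂, s₃, s₁₂, s₁₃, s₂₃, v⟩ hs hst
    obtain ⟨-, -, hst2⟩ : s₁ = t₁ ∧ s₃ = t₃ ∧ s₁₃ = t₁₃ := by simpa [eq_comm] using hst
    obtain ⟨rfl, rfl, rfl, rfl, hh⟩ := (dec_mem_core₂ _ _ _ _ _ _ _ _).1 ht
    obtain rfl : t₂ = x₂ := hh
    obtain ⟨rfl, rfl, rfl, rfl, hh⟩ := (dec_mem_core₂ _ _ _ _ _ _ _ _).1 hs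
    obtain rfl : s₂ = y₂ := hh
    obtain rfl := hst2
    rw [key, tup₁₂_val', tup₁₂_val', tup₁₂_val']
    simp only [map_add, LinearMap.add_apply]
    ring

theorem tup_smul₁₂ (h₀ : Function.Bijective b₀) (h₂ : Function.Bijective b₂) (r : ℝ)
    (x z : V₀ × V₂ × V₀₂) :
    OthSmul (𝔇).over₁₃ (.ofModule V₂) (TVS.side₂ b₀) r (tup₁₂ b₀ b₂ x : TVS.d₁₂ 𝔇)
      (tup₁₂ b₀ b₂ z) ↔ (𝔇').D₁₂.overA.smul r x = z := by
  unfold OthSmul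
  rw [side₂_tup h₀, side₂_tup h₀]
  obtain ⟨x₀, x₂, x₀₂⟩ := x
  obtain ⟨z₀, z₂, z₀₂⟩ := z
  have key : ∀ t u, (𝔇).over₁₃.smul r (0, x₂, 0, 0, t, 0, u) =
      (0, r • x₂, 0, 0, t, 0, r • u) := fun _ _ => by simp
  constructor
  · rintro ⟨h, hp, h'⟩
    obtain rfl : z₂ = r • x₂ := h
    obtain rfl : z₀ = x₀ := hp
    obtain rfl : z₀₂ = r • x₀₂ := pair_ext h₂ fun t => by
        have := h' _ (dec_mem_core₂' x₂ t 0)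
        rw [key, tup₁₂_val', tup₁₂_val'] at this
        simp only [map_smul, LinearMap.smul_apply, map_zero, smul_eq_mul] at this ⊢
        linarith
    rfl
  · rintro h
    obtain ⟨rfl, rfl, rfl⟩ : x₀ = z₀ ∧ r • x₂ = z₂ ∧ r • x₀₂ = z₀₂ := by simpa using h
    refine ⟨rfl, rfl, ?_⟩
    rintro ⟨t₁, t₂, t₃, t₁₂, t₁₃, t₂₃, u⟩ ht
    obtain ⟨rfl, rfl, rfl, rfl, hh⟩ := (dec_mem_core₂ _ _ _ _ _ _ _ _).1 ht
    obtain rfl : t₂ = x₂ := hh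
    rw [key, tup₁₂_val', tup₁₂_val']
    simp only [map_smul, LinearMap.smul_apply, smul_eq_mul]
    ring

theorem tup_add₁₃ (h₀ : Function.Bijective b₀) (h₃ : Function.Bijective b₃)
    (x y z : V₀ × V₃ × V₀₃) (hxy : x.1 = y.1) :
    OthAdd (𝔇).over₁₂ (.ofModule V₃) (tup₁₃ b₀ b₃ x : TVS.d₁₃ 𝔇) (tup₁₃ b₀ b₃ y)
      (tup₁₃ b₀ b₃ z) ↔ (𝔇').D₁₃.overA.add x y = z := by
  obtain ⟨x₀, x₂, x₀₂⟩ := x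
  obtain ⟨y₀, y₂, y₀₂⟩ := y
  obtain ⟨z₀, z₂, z₀₂⟩ := z
  obtain rfl : x₀ = y₀ := hxy
  have key : ∀ t u v, (𝔇).over₁₂.add (0, 0, x₂, t, 0, 0, u) (0, 0, y₂, t, 0, 0, v) =
      (0, 0, x₂ + y₂, t, 0, 0, u + v) := fun _ _ _ => by simp
  constructor
  · rintro ⟨h, h'⟩
    obtain rfl : z₂ = x₂ + y₂ := h
    obtain ⟨rfl, rfl⟩ := tup₂_ext h₀ h₃ (x := z₀) (y := x₀) (x' := z₀₂) (y' := x₀₂ + y₀₂)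
      fun t u => by
        have := h' _ (dec_mem_core₃' x₂ t u) _ (dec_mem_core₃' y₂ t 0) rfl
        rw [key, tup₁₃_val', tup₁₃_val', tup₁₃_val'] at this
        simp only [map_add, LinearMap.add_apply, map_zero] at this ⊢
        linarith
    rfl
  · rintro h
    obtain ⟨rfl, rfl, rfl⟩ : x₀ = z₀ ∧ x₂ + y₂ = z₂ ∧ x₀₂ + y₀₂ = z₀₂ := by simpa using h
    refine ⟨rfl, ?_⟩
    rintro ⟨t₁, t₂, t₃, t₁₂, t₁₃, t₂₃, u⟩ ht ⟨s₁, s₂, s₃, s₁₂, s₁₃, s₂₃, v⟩ hs hst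
    obtain ⟨-, -, hst2⟩ : s₁ = t₁ ∧ s₂ = t₂ ∧ s₁₂ = t₁₂ := by simpa [eq_comm] using hst
    obtain ⟨rfl, rfl, rfl, rfl, hh⟩ := (dec_mem_core₃ _ _ _ _ _ _ _ _).1 ht
    obtain rfl : t₃ = x₂ := hh
    obtain ⟨rfl, rfl, rfl, rfl, hh⟩ := (dec_mem_core₃ _ _ _ _ _ _ _ _).1 hs
    obtain rfl : s₃ = y₂ := hh
    obtain rfl := hst2
    rw [key, tup₁₃_val', tup₁₃_val', tup₁₃_val']
    simp only [map_add, LinearMap.add_apply]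
    ring

theorem tup_smul₁₃ (h₀ : Function.Bijective b₀) (h₃ : Function.Bijective b₃) (r : ℝ)
    (x z : V₀ × V₃ × V₀₃) :
    OthSmul (𝔇).over₁₂ (.ofModule V₃) (TVS.side₃ b₀) r (tup₁₃ b₀ b₃ x : TVS.d₁₃ 𝔇)
      (tup₁₃ b₀ b₃ z) ↔ (𝔇').D₁₃.overA.smul r x = z := by
  unfold OthSmul
  rw [side₃_tup h₀, side₃_tup h₀]
  obtain ⟨x₀, x₂, x₀₂⟩ := x
  obtain ⟨z₀, z₂, z₀₂⟩ := z
  have key : ∀ t u, (𝔇).over₁₂.smul r (0, 0, x₂, t, 0, 0, u) =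
      (0, 0, r • x₂, t, 0, 0, r • u) := fun _ _ => by simp
  constructor
  · rintro ⟨h, hp, h'⟩
    obtain rfl : z₂ = r • x₂ := h
    obtain rfl : z₀ = x₀ := hp
    obtain rfl : z₀₂ = r • x₀₂ := pair_ext h₃ fun t => by
        have := h' _ (dec_mem_core₃' x₂ t 0)
        rw [key, tup₁₃_val', tup₁₃_val'] at this
        simp only [map_smul, LinearMap.smul_apply, map_zero, smul_eq_mul] at this ⊢
        linarith
    rfl
  · rintro h
    obtain ⟨rfl, rfl, rfl⟩ : x₀ = z₀ ∧ r • x₂ = z₂ ∧ r • x₀₂ = z₀₂ := by simpa using h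
    refine ⟨rfl, rfl, ?_⟩
    rintro ⟨t₁, t₂, t₃, t₁₂, t₁₃, t₂₃, u⟩ ht
    obtain ⟨rfl, rfl, rfl, rfl, hh⟩ := (dec_mem_core₃ _ _ _ _ _ _ _ _).1 ht
    obtain rfl : t₃ = x₂ := hh
    rw [key, tup₁₃_val', tup₁₃_val']
    simp only [map_smul, LinearMap.smul_apply, smul_eq_mul]
    ring

variable (b₀ b₂ b₃ b₁) in
def tupTE (h₀ : Function.Bijective b₀) (h₂ : Function.Bijective b₂)
    (h₃ : Function.Bijective b₃) (h₁ : Function.Bijective b₁) :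
    V₀ × V₂ × V₃ × V₀₂ × V₀₃ × V₂₃ × V₀₂₃ ≃ TVS.dT 𝔇 :=
  Equiv.ofBijective (tupT b₀ b₂ b₃ b₁)
    ⟨tupT_injective h₀ h₂ h₃ h₁, tupT_surjective h₀ h₂ h₃ h₁⟩

variable (b₀ b₂) in
def tup₁₂E (h₀ : Function.Bijective b₀) (h₂ : Function.Bijective b₂) :
    V₀ × V₂ × V₀₂ ≃ TVS.d₁₂ 𝔇 :=
  Equiv.ofBijective (tup₁₂ b₀ b₂) ⟨tup₁₂_injective h₀ h₂, tup₁₂_surjective h₀ h₂⟩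

variable (b₀ b₃) in
def tup₁₃E (h₀ : Function.Bijective b₀) (h₃ : Function.Bijective b₃) :
    V₀ × V₃ × V₀₃ ≃ TVS.d₁₃ 𝔇 :=
  Equiv.ofBijective (tup₁₃ b₀ b₃) ⟨tup₁₃_injective h₀ h₃, tup₁₃_surjective h₀ h₃⟩

theorem existsUnique_of_equiv {α β : Type} {p : α → Prop} (e : β ≃ α) {b : β}
    (h : ∀ z, p (e z) ↔ b = z) : ∃! a, p a :=
  (existsUnique_equiv e h).2 ⟨b, rfl, fun _ h => h.symm⟩

/-- The duals of decomposed triple vector bundles are well-defined. -/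
theorem dec_good (h₀ : Function.Bijective b₀) (h₂ : Function.Bijective b₂)
    (h₃ : Function.Bijective b₃) (h₁ : Function.Bijective b₁) : TVS.Good 𝔇 b₀ b₂ b₃ b₁ where
  pr₁₂ Ψ := by
    obtain ⟨x, rfl⟩ := tupT_surjective h₀ h₂ h₃ h₁ Ψ
    exact existsUnique_of_equiv (tup₁₂E b₀ b₂ h₀ h₂) fun y => (tup_pr₁₂ h₀ h₂ x y).trans eq_comm
  pr₁₃ Ψ := by
    obtain ⟨x, rfl⟩ := tupT_surjective h₀ h₂ h₃ h₁ Ψ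
    exact existsUnique_of_equiv (tup₁₃E b₀ b₃ h₀ h₃) fun y => (tup_pr₁₃ h₀ h₃ x y).trans eq_comm
  side₂ Ψ := by
    obtain ⟨x, rfl⟩ := tup₁₂_surjective h₀ h₂ Ψ
    exact existsUnique_of_equiv (Equiv.refl V₀) fun y => (tup_side₂ h₀ x y).trans eq_comm
  side₃ Ψ := by
    obtain ⟨x, rfl⟩ := tup₁₃_surjective h₀ h₃ Ψ
    exact existsUnique_of_equiv (Equiv.refl V₀) fun y => (tup_side₃ h₀ x y).trans eq_comm
  coreT ε := existsUnique_of_equiv (tupTE b₀ b₂ b₃ b₁ h₀ h₂ h₃ h₁) fun y =>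
    (tup_coreT h₀ h₂ h₃ h₁ ε y).trans eq_comm
  core₁₂ ε := existsUnique_of_equiv (tup₁₂E b₀ b₂ h₀ h₂) fun y =>
    (tup_core₁₂ h₀ h₂ ε y).trans eq_comm
  core₁₃ ε := existsUnique_of_equiv (tup₁₃E b₀ b₃ h₀ h₃) fun y =>
    (tup_core₁₃ h₀ h₃ ε y).trans eq_comm
  u₁₂ :=
    { compat := fun Ψ Ψ' h => by
        obtain ⟨x, rfl⟩ := tupT_surjective h₀ h₂ h₃ h₁ Ψ
        obtain ⟨y, rfl⟩ := tupT_surjective h₀ h₂ h₃ h₁ Ψ'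
        rw [pr₁₂_tup h₀ h₂, pr₁₂_tup h₀ h₂] at h
        exact congrArg DualTot.pt h
      add := fun Ψ Ψ' h => by
        obtain ⟨x, rfl⟩ := tupT_surjective h₀ h₂ h₃ h₁ Ψ
        obtain ⟨y, rfl⟩ := tupT_surjective h₀ h₂ h₃ h₁ Ψ'
        rw [pr₁₂_tup h₀ h₂, pr₁₂_tup h₀ h₂] at h
        exact existsUnique_of_equiv (tupTE b₀ b₂ b₃ b₁ h₀ h₂ h₃ h₁)
          fun z => tup_addT₁₂ h₀ h₂ h₃ h₁ x y z (tup₁₂_injective h₀ h₂ h)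
      smul := fun r Ψ => by
        obtain ⟨x, rfl⟩ := tupT_surjective h₀ h₂ h₃ h₁ Ψ
        exact existsUnique_of_equiv (tupTE b₀ b₂ b₃ b₁ h₀ h₂ h₃ h₁)
          fun z => tup_smulT₁₂ h₀ h₂ h₃ h₁ r x z }
  u₁₃ :=
    { compat := fun Ψ Ψ' h => by
        obtain ⟨x, rfl⟩ := tupT_surjective h₀ h₂ h₃ h₁ Ψ
        obtain ⟨y, rfl⟩ := tupT_surjective h₀ h₂ h₃ h₁ Ψ'
        rw [pr₁₃_tup h₀ h₃, pr₁₃_tup h₀ h₃] at h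
        exact congrArg DualTot.pt h
      add := fun Ψ Ψ' h => by
        obtain ⟨x, rfl⟩ := tupT_surjective h₀ h₂ h₃ h₁ Ψ
        obtain ⟨y, rfl⟩ := tupT_surjective h₀ h₂ h₃ h₁ Ψ'
        rw [pr₁₃_tup h₀ h₃, pr₁₃_tup h₀ h₃] at h
        exact existsUnique_of_equiv (tupTE b₀ b₂ b₃ b₁ h₀ h₂ h₃ h₁)
          fun z => tup_addT₁₃ h₀ h₂ h₃ h₁ x y z (tup₁₃_injective h₀ h₃ h)
      smul := fun r Ψ => by
        obtain ⟨x, rfl⟩ := tupT_surjective h₀ h₂ h₃ h₁ Ψ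
        exact existsUnique_of_equiv (tupTE b₀ b₂ b₃ b₁ h₀ h₂ h₃ h₁)
          fun z => tup_smulT₁₃ h₀ h₂ h₃ h₁ r x z }
  v₁₂ :=
    { compat := fun _ _ _ => rfl
      add := fun Ψ Ψ' h => by
        obtain ⟨x, rfl⟩ := tup₁₂_surjective h₀ h₂ Ψ
        obtain ⟨y, rfl⟩ := tup₁₂_surjective h₀ h₂ Ψ'
        rw [side₂_tup h₀, side₂_tup h₀] at h
        exact existsUnique_of_equiv (tup₁₂E b₀ b₂ h₀ h₂) (b := (𝔇').D₁₂.overA.add x y)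
          fun z => by exact tup_add₁₂ h₀ h₂ x y z h
      smul := fun r Ψ => by
        obtain ⟨x, rfl⟩ := tup₁₂_surjective h₀ h₂ Ψ
        exact existsUnique_of_equiv (tup₁₂E b₀ b₂ h₀ h₂) (b := (𝔇').D₁₂.overA.smul r x)
          fun z => by exact tup_smul₁₂ h₀ h₂ r x z }
  v₁₃ :=
    { compat := fun _ _ _ => rfl
      add := fun Ψ Ψ' h => by
        obtain ⟨x, rfl⟩ := tup₁₃_surjective h₀ h₃ Ψ
        obtain ⟨y, rfl⟩ := tup₁₃_surjective h₀ h₃ Ψ'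
        rw [side₃_tup h₀, side₃_tup h₀] at h
        exact existsUnique_of_equiv (tup₁₃E b₀ b₃ h₀ h₃) (b := (𝔇').D₁₃.overA.add x y)
          fun z => by exact tup_add₁₃ h₀ h₃ x y z h
      smul := fun r Ψ => by
        obtain ⟨x, rfl⟩ := tup₁₃_surjective h₀ h₃ Ψ
        exact existsUnique_of_equiv (tup₁₃E b₀ b₃ h₀ h₃) (b := (𝔇').D₁₃.overA.smul r x)
          fun z => by exact tup_smul₁₃ h₀ h₃ r x z }

theorem tupT_hom₂₃ : (𝔇').over₂₃.IsHom (dualFib (𝔇).over₂₃ (TVS.fib 𝔇)) (tupT b₀ b₂ b₃ b₁) id where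
  proj x := rfl
  add x y h := by
    obtain ⟨x₀, x₂, x₃, x₀₂, x₀₃, x₂₃, xε⟩ := x
    obtain ⟨y₀, y₂, y₃, y₀₂, y₀₃, y₂₃, yε⟩ := y
    obtain ⟨rfl, rfl, rfl⟩ : x₂ = y₂ ∧ x₃ = y₃ ∧ x₂₃ = y₂₃ := by simpa using h
    refine DualTot.ext (dualFib_add_fst (tupT b₀ b₂ b₃ b₁ (x₀, x₂, x₃, x₀₂, x₀₃, x₂₃, xε))
      (tupT b₀ b₂ b₃ b₁ (y₀, x₂, x₃, y₀₂, y₀₃, x₂₃, yε)) rfl).symm fun t ht => ?_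
    refine Eq.trans ?_ (dualFib_add_val (tupT b₀ b₂ b₃ b₁ (x₀, x₂, x₃, x₀₂, x₀₃, x₂₃, xε))
          (tupT b₀ b₂ b₃ b₁ (y₀, x₂, x₃, y₀₂, y₀₃, x₂₃, yε)) rfl t).symm
    rw [tupT_val b₀ b₂ b₃ b₁ _ t ht,
      tupT_val b₀ b₂ b₃ b₁ (x₀, x₂, x₃, x₀₂, x₀₃, x₂₃, xε) t ht,
      tupT_val b₀ b₂ b₃ b₁ (y₀, x₂, x₃, y₀₂, y₀₃, x₂₃, yε) t ht]
    simp only [map_add, LinearMap.add_apply]; ring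
  smul r x := by
    refine DualTot.ext rfl fun t ht => ?_
    refine (tupT_val b₀ b₂ b₃ b₁ _ t ht).trans (Eq.trans ?_
          (congrArg (r * ·) (tupT_val b₀ b₂ b₃ b₁ x t ht)).symm)
    simp only [map_smul, LinearMap.smul_apply, smul_eq_mul]; ring

variable (b₀ b₂ b₃ b₁) in
/-- The dual of a decomposed triple vector bundle is decomposed. -/
def decDual (h₀ : Function.Bijective b₀) (h₂ : Function.Bijective b₂)
    (h₃ : Function.Bijective b₃) (h₁ : Function.Bijective b₁) :
    (𝔇').Iso ((𝔇).dualX b₀ b₂ b₃ b₁) where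
  i₁₂ :=
    { e := tup₁₂E b₀ b₂ h₀ h₂
      homA :=
        { proj := fun x => side₂_tup h₀ x
          add := fun x y h => (@eps_eq _ ⟨tup₁₂ b₀ b₂ x⟩ _ ((dec_good h₀ h₂ h₃ h₁).v₁₂.add _ _
            ((side₂_tup h₀ x).trans (Eq.trans h (side₂_tup h₀ y).symm))) _
              ((tup_add₁₂ h₀ h₂ x y _ h).2 rfl)).symm
          smul := fun r x => (@eps_eq _ ⟨tup₁₂ b₀ b₂ x⟩ _ ((dec_good h₀ h₂ h₃ h₁).v₁₂.smul r _) _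
              ((tup_smul₁₂ h₀ h₂ r x _).2 rfl)).symm }
      homB :=
        { proj := fun x => rfl
          add := fun x y h => DualTot.ext
              (dualFib_add_fst (tup₁₂ b₀ b₂ x) (tup₁₂ b₀ b₂ y) h).symm fun t ht => by
            obtain ⟨x₀, x₂, x₀₂⟩ := x
            obtain ⟨y₀, y₂, y₀₂⟩ := y
            obtain rfl : x₂ = y₂ := h
            refine Eq.trans ?_ (dualFib_add_val (tup₁₂ b₀ b₂ (x₀, x₂, x₀₂))
              (tup₁₂ b₀ b₂ (y₀, x₂, y₀₂)) rfl t).symm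
            refine (tup₁₂_val _ _ _ _ ht).trans (Eq.trans ?_
              (congrArg₂ (· + ·) (tup₁₂_val _ _ _ _ ht) (tup₁₂_val _ _ _ _ ht)).symm)
            simp only [map_add, LinearMap.add_apply]; ring
          smul := fun r x => DualTot.ext rfl fun t ht => by
            refine (tup₁₂_val b₀ b₂ ((𝔇').D₁₂.overB.smul r x) t ht).trans (Eq.trans ?_
              (congrArg (r * ·) (tup₁₂_val b₀ b₂ x t ht)).symm)
            simp only [map_smul, LinearMap.smul_apply, smul_eq_mul]; ring }
      core := fun ε => (@eps_eq _ ⟨DualTot.zero 0⟩ _ ((dec_good h₀ h₂ h₃ h₁).core₁₂ ε) _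
              ((tup_core₁₂ h₀ h₂ ε _).2 rfl)).symm }
  i₁₃ :=
    { e := tup₁₃E b₀ b₃ h₀ h₃
      homA :=
        { proj := fun x => side₃_tup h₀ x
          add := fun x y h => (@eps_eq _ ⟨tup₁₃ b₀ b₃ x⟩ _ ((dec_good h₀ h₂ h₃ h₁).v₁₃.add _ _
            ((side₃_tup h₀ x).trans (Eq.trans h (side₃_tup h₀ y).symm))) _
              ((tup_add₁₃ h₀ h₃ x y _ h).2 rfl)).symm
          smul := fun r x => (@eps_eq _ ⟨tup₁₃ b₀ b₃ x⟩ _ ((dec_good h₀ h₂ h₃ h₁).v₁₃.smul r _) _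
              ((tup_smul₁₃ h₀ h₃ r x _).2 rfl)).symm }
      homB :=
        { proj := fun x => rfl
          add := fun x y h => DualTot.ext
              (dualFib_add_fst (tup₁₃ b₀ b₃ x) (tup₁₃ b₀ b₃ y) h).symm fun t ht => by
            obtain ⟨x₀, x₂, x₀₂⟩ := x
            obtain ⟨y₀, y₂, y₀₂⟩ := y
            obtain rfl : x₂ = y₂ := h
            refine Eq.trans ?_ (dualFib_add_val (tup₁₃ b₀ b₃ (x₀, x₂, x₀₂))
              (tup₁₃ b₀ b₃ (y₀, x₂, y₀₂)) rfl t).symm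
            refine (tup₁₃_val _ _ _ _ ht).trans (Eq.trans ?_
              (congrArg₂ (· + ·) (tup₁₃_val _ _ _ _ ht) (tup₁₃_val _ _ _ _ ht)).symm)
            simp only [map_add, LinearMap.add_apply]; ring
          smul := fun r x => DualTot.ext rfl fun t ht => by
            refine (tup₁₃_val b₀ b₃ ((𝔇').D₁₃.overB.smul r x) t ht).trans (Eq.trans ?_
              (congrArg (r * ·) (tup₁₃_val b₀ b₃ x t ht)).symm)
            simp only [map_smul, LinearMap.smul_apply, smul_eq_mul]; ring }
      core := fun ε => (@eps_eq _ ⟨DualTot.zero 0⟩ _ ((dec_good h₀ h₂ h₃ h₁).core₁₃ ε) _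
              ((tup_core₁₃ h₀ h₃ ε _).2 rfl)).symm }
  i₂₃ := .refl _
  e := tupTE b₀ b₂ b₃ b₁ h₀ h₂ h₃ h₁
  hom₁₂ :=
    { proj := fun x => pr₁₂_tup h₀ h₂ x
      add := fun x y h => (@eps_eq _ ⟨tupT b₀ b₂ b₃ b₁ x⟩ _ ((dec_good h₀ h₂ h₃ h₁).u₁₂.add _ _
            ((pr₁₂_tup h₀ h₂ x).trans ((congrArg _ h).trans (pr₁₂_tup h₀ h₂ y).symm))) _
              ((tup_addT₁₂ h₀ h₂ h₃ h₁ x y _ h).2 rfl)).symm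
      smul := fun r x => (@eps_eq _ ⟨tupT b₀ b₂ b₃ b₁ x⟩ _ ((dec_good h₀ h₂ h₃ h₁).u₁₂.smul r _) _
              ((tup_smulT₁₂ h₀ h₂ h₃ h₁ r x _).2 rfl)).symm }
  hom₁₃ :=
    { proj := fun x => pr₁₃_tup h₀ h₃ x
      add := fun x y h => (@eps_eq _ ⟨tupT b₀ b₂ b₃ b₁ x⟩ _ ((dec_good h₀ h₂ h₃ h₁).u₁₃.add _ _
            ((pr₁₃_tup h₀ h₃ x).trans ((congrArg _ h).trans (pr₁₃_tup h₀ h₃ y).symm))) _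
              ((tup_addT₁₃ h₀ h₂ h₃ h₁ x y _ h).2 rfl)).symm
      smul := fun r x => (@eps_eq _ ⟨tupT b₀ b₂ b₃ b₁ x⟩ _ ((dec_good h₀ h₂ h₃ h₁).u₁₃.smul r _) _
              ((tup_smulT₁₃ h₀ h₂ h₃ h₁ r x _).2 rfl)).symm }
  hom₂₃ := tupT_hom₂₃
  core := fun ε => (@eps_eq _ ⟨DualTot.zero (0, 0, 0)⟩ _ ((dec_good h₀ h₂ h₃ h₁).coreT ε) _
              ((tup_coreT h₀ h₂ h₃ h₁ ε _).2 rfl)).symm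

end Dec

end

end DualX

/-! ### The axioms of double and triple vector bundles -/

section Laws

/-- The axioms of a vector bundle, over each point of `B`. -/
structure VBStr.Lawful {X B : Type} (s : VBStr X B) : Prop where
  surj : ∀ b, ∃ x, s.proj x = b
  proj_add : ∀ x y, s.proj x = s.proj y → s.proj (s.add x y) = s.proj x
  proj_smul : ∀ (t : ℝ) x, s.proj (s.smul t x) = s.proj x
  add_comm : ∀ x y, s.proj x = s.proj y → s.add x y = s.add y x
  add_assoc : ∀ x y z, s.proj x = s.proj y → s.proj y = s.proj z →
    s.add (s.add x y) z = s.add x (s.add y z)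
  add_zero : ∀ x y, s.proj x = s.proj y → s.add x (s.smul 0 y) = x
  add_neg : ∀ x, s.add x (s.smul (-1) x) = s.smul 0 x
  one_smul : ∀ x, s.smul 1 x = x
  mul_smul : ∀ (t r : ℝ) x, s.smul (t * r) x = s.smul t (s.smul r x)
  add_smul : ∀ (t r : ℝ) x, s.smul (t + r) x = s.add (s.smul t x) (s.smul r x)
  smul_add : ∀ (t : ℝ) x y, s.proj x = s.proj y →
    s.smul t (s.add x y) = s.add (s.smul t x) (s.smul t y)

/-- The compatibility of the two structures of a double vector bundle: projections are linear and the
interchange laws hold. -/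
structure VBStr.Double {X B C A : Type} (s : VBStr X B) (r : VBStr X C) (sB : VBStr B A)
    (sC : VBStr C A) : Prop where
  square : ∀ x, sB.proj (s.proj x) = sC.proj (r.proj x)
  homB : ∀ x y, r.proj x = r.proj y → s.proj (r.add x y) = sB.add (s.proj x) (s.proj y)
  homC : ∀ x y, s.proj x = s.proj y → r.proj (s.add x y) = sC.add (r.proj x) (r.proj y)
  homB_smul : ∀ (t : ℝ) x, s.proj (r.smul t x) = sB.smul t (s.proj x)
  homC_smul : ∀ (t : ℝ) x, r.proj (s.smul t x) = sC.smul t (r.proj x)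
  add_add : ∀ x y z w, s.proj x = s.proj y → s.proj z = s.proj w → r.proj x = r.proj z →
    r.proj y = r.proj w → r.add (s.add x y) (s.add z w) = s.add (r.add x z) (r.add y w)
  smul_add : ∀ (t : ℝ) x y, r.proj x = r.proj y →
    s.smul t (r.add x y) = r.add (s.smul t x) (s.smul t y)
  add_smul : ∀ (t : ℝ) x y, s.proj x = s.proj y →
    r.smul t (s.add x y) = s.add (r.smul t x) (r.smul t y)
  smul_smul : ∀ (t u : ℝ) x, s.smul t (r.smul u x) = r.smul u (s.smul t x)

theorem VBStr.Lawful.of_hom {X B X' B' : Type} {s : VBStr X B} {s' : VBStr X' B'} {e : X ≃ X'}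
    {g : B ≃ B'} (h : s.IsHom s' e g) (L : s'.Lawful) : s.Lawful := by
  have hp : ∀ x y, s.proj x = s.proj y ↔ s'.proj (e x) = s'.proj (e y) := fun x y => by
    rw [h.proj, h.proj, g.injective.eq_iff]
  refine ⟨fun b => ?_, fun x y hxy => ?_, fun t x => ?_, fun x y hxy => ?_, fun x y z h1 h2 => ?_,
    fun x y hxy => ?_, fun x => ?_, fun x => ?_, fun t r x => ?_, fun t r x => ?_,
    fun t x y hxy => ?_⟩
  · obtain ⟨x, hx⟩ := L.surj (g b)
    refine ⟨e.symm x, g.injective ?_⟩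
    rw [← h.proj]; simpa using hx
  · rw [hp, h.add _ _ hxy]; exact L.proj_add _ _ ((hp _ _).1 hxy)
  · rw [hp, h.smul]; exact L.proj_smul _ _
  · apply e.injective; rw [h.add _ _ hxy, h.add _ _ hxy.symm]; exact L.add_comm _ _ ((hp _ _).1 hxy)
  · have h3 : s.proj (s.add x y) = s.proj z := by
      rw [hp, h.add _ _ h1, L.proj_add _ _ ((hp _ _).1 h1), ← hp, h1, h2]
    have h4 : s.proj x = s.proj (s.add y z) := by
      rw [hp, h.add _ _ h2, L.proj_add _ _ ((hp _ _).1 h2), ← hp, h1]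
    apply e.injective
    rw [h.add _ _ h3, h.add _ _ h1, h.add _ _ h4, h.add _ _ h2]
    exact L.add_assoc _ _ _ ((hp _ _).1 h1) ((hp _ _).1 h2)
  · have h1 : s.proj x = s.proj (s.smul 0 y) := by rw [hp, h.smul, L.proj_smul, ← hp, hxy]
    apply e.injective; rw [h.add _ _ h1, h.smul]; exact L.add_zero _ _ ((hp _ _).1 hxy)
  · have h1 : s.proj x = s.proj (s.smul (-1) x) := by rw [hp, h.smul, L.proj_smul]
    apply e.injective; rw [h.add _ _ h1, h.smul, h.smul]; exact L.add_neg _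
  · apply e.injective; rw [h.smul]; exact L.one_smul _
  · apply e.injective; rw [h.smul, h.smul, h.smul]; exact L.mul_smul _ _ _
  · have h1 : s.proj (s.smul t x) = s.proj (s.smul r x) := by
      rw [hp, h.smul, h.smul, L.proj_smul, L.proj_smul]
    apply e.injective; rw [h.add _ _ h1, h.smul, h.smul, h.smul]; exact L.add_smul _ _ _
  · have h1 : s.proj (s.smul t x) = s.proj (s.smul t y) := by
      rw [hp, h.smul, h.smul, L.proj_smul, L.proj_smul, ← hp, hxy]
    apply e.injective
    rw [h.smul, h.add _ _ hxy, h.add _ _ h1, h.smul, h.smul]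
    exact L.smul_add _ _ _ ((hp _ _).1 hxy)

theorem VBStr.Double.of_hom {X B C A X' B' C' A' : Type} {s : VBStr X B} {r : VBStr X C}
    {sB : VBStr B A} {sC : VBStr C A} {s' : VBStr X' B'} {r' : VBStr X' C'}
    {sB' : VBStr B' A'} {sC' : VBStr C' A'} {e : X ≃ X'} {b : B ≃ B'} {c : C ≃ C'} {a : A ≃ A'}
    (hs : s.IsHom s' e b) (hr : r.IsHom r' e c) (hB : sB.IsHom sB' b a) (hC : sC.IsHom sC' c a)
    (D : s'.Double r' sB' sC') : s.Double r sB sC := by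
  have ps : ∀ x y, s.proj x = s.proj y ↔ s'.proj (e x) = s'.proj (e y) := fun x y => by
    rw [hs.proj, hs.proj, b.injective.eq_iff]
  have pr : ∀ x y, r.proj x = r.proj y ↔ r'.proj (e x) = r'.proj (e y) := fun x y => by
    rw [hr.proj, hr.proj, c.injective.eq_iff]
  have sq : ∀ x, sB.proj (s.proj x) = sC.proj (r.proj x) := fun x => by
    apply a.injective; rw [← hB.proj, ← hC.proj, ← hs.proj, ← hr.proj]; exact D.square _
  have qB : ∀ x y, r.proj x = r.proj y → sB.proj (s.proj x) = sB.proj (s.proj y) := fun x y h => by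
    rw [sq, sq, h]
  have qC : ∀ x y, s.proj x = s.proj y → sC.proj (r.proj x) = sC.proj (r.proj y) := fun x y h => by
    rw [← sq, ← sq, h]
  have hB1 : ∀ x y, r.proj x = r.proj y → s.proj (r.add x y) = sB.add (s.proj x) (s.proj y) := by
    intro x y h
    apply b.injective
    rw [← hs.proj, hr.add _ _ h, D.homB _ _ ((pr _ _).1 h), hB.add _ _ (qB _ _ h), hs.proj, hs.proj]
  have hC1 : ∀ x y, s.proj x = s.proj y → r.proj (s.add x y) = sC.add (r.proj x) (r.proj y) := by
    intro x y h
    apply c.injective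
    rw [← hr.proj, hs.add _ _ h, D.homC _ _ ((ps _ _).1 h), hC.add _ _ (qC _ _ h), hr.proj, hr.proj]
  have hB2 : ∀ (t : ℝ) x, s.proj (r.smul t x) = sB.smul t (s.proj x) := by
    intro t x
    apply b.injective
    rw [← hs.proj, hr.smul, D.homB_smul, hB.smul, hs.proj]
  have hC2 : ∀ (t : ℝ) x, r.proj (s.smul t x) = sC.smul t (r.proj x) := by
    intro t x
    apply c.injective
    rw [← hr.proj, hs.smul, D.homC_smul, hC.smul, hr.proj]
  refine ⟨sq, hB1, hC1, hB2, hC2, fun x y z w h1 h2 h3 h4 => ?_, fun t x y h => ?_,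
    fun t x y h => ?_, fun t u x => ?_⟩
  · have k1 : r.proj (s.add x y) = r.proj (s.add z w) := by rw [hC1 _ _ h1, hC1 _ _ h2, h3, h4]
    have k2 : s.proj (r.add x z) = s.proj (r.add y w) := by rw [hB1 _ _ h3, hB1 _ _ h4, h1, h2]
    apply e.injective
    rw [hr.add _ _ k1, hs.add _ _ h1, hs.add _ _ h2, hs.add _ _ k2, hr.add _ _ h3, hr.add _ _ h4]
    exact D.add_add _ _ _ _ ((ps _ _).1 h1) ((ps _ _).1 h2) ((pr _ _).1 h3) ((pr _ _).1 h4)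
  · have k : r.proj (s.smul t x) = r.proj (s.smul t y) := by rw [hC2, hC2, h]
    apply e.injective
    rw [hs.smul, hr.add _ _ h, hr.add _ _ k, hs.smul, hs.smul]
    exact D.smul_add _ _ _ ((pr _ _).1 h)
  · have k : s.proj (r.smul t x) = s.proj (r.smul t y) := by rw [hB2, hB2, h]
    apply e.injective
    rw [hr.smul, hs.add _ _ h, hs.add _ _ k, hr.smul, hr.smul]
    exact D.add_smul _ _ _ ((ps _ _).1 h)
  · apply e.injective
    rw [hs.smul, hr.smul, hr.smul, hs.smul]
    exact D.smul_smul _ _ _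

variable {V₁ V₂ V₃ V₁₂ V₁₃ V₂₃ V₁₂₃ : Type} [AddCommGroup V₁] [Module ℝ V₁] [AddCommGroup V₂]
  [Module ℝ V₂] [AddCommGroup V₃] [Module ℝ V₃] [AddCommGroup V₁₂] [Module ℝ V₁₂]
  [AddCommGroup V₁₃] [Module ℝ V₁₃] [AddCommGroup V₂₃] [Module ℝ V₂₃] [AddCommGroup V₁₂₃]
  [Module ℝ V₁₂₃]

/-- The axioms of a double vector bundle with core `C`. -/
structure DVS.Lawful {A B C : Type} [AddCommGroup A] [Module ℝ A] [AddCommGroup B] [Module ℝ B]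
    [AddCommGroup C] [Module ℝ C] (E : DVS A B C) : Prop where
  overA : E.overA.Lawful
  overB : E.overB.Lawful
  double : E.overA.Double E.overB (.ofModule A) (.ofModule B)
  core_injective : Function.Injective E.core
  core_range : ∀ x, E.overA.proj x = 0 ∧ E.overB.proj x = 0 ↔ ∃ c, E.core c = x
  core_addA : ∀ c c', E.core (c + c') = E.overA.add (E.core c) (E.core c')
  core_addB : ∀ c c', E.core (c + c') = E.overB.add (E.core c) (E.core c')
  core_smulA : ∀ (t : ℝ) c, E.core (t • c) = E.overA.smul t (E.core c)
  core_smulB : ∀ (t : ℝ) c, E.core (t • c) = E.overB.smul t (E.core c)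

/-- The axioms of a triple vector bundle with ultracore `V₁₂₃`. -/
structure TVS.Lawful (E : TVS V₁ V₂ V₃ V₁₂ V₁₃ V₂₃ V₁₂₃) : Prop where
  D₁₂ : E.D₁₂.Lawful
  D₁₃ : E.D₁₃.Lawful
  D₂₃ : E.D₂₃.Lawful
  over₁₂ : E.over₁₂.Lawful
  over₁₃ : E.over₁₃.Lawful
  over₂₃ : E.over₂₃.Lawful
  double₁ : E.over₁₂.Double E.over₁₃ E.D₁₂.overA E.D₁₃.overA
  double₂ : E.over₁₂.Double E.over₂₃ E.D₁₂.overB E.D₂₃.overA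
  double₃ : E.over₁₃.Double E.over₂₃ E.D₁₃.overB E.D₂₃.overB
  core_injective : Function.Injective E.core
  core_range : ∀ x, E.over₁₂.proj x = E.D₁₂.core 0 ∧ E.over₁₃.proj x = E.D₁₃.core 0 ∧
    E.over₂₃.proj x = E.D₂₃.core 0 ↔ ∃ u, E.core u = x
  core_add₁₂ : ∀ u v, E.core (u + v) = E.over₁₂.add (E.core u) (E.core v)
  core_add₁₃ : ∀ u v, E.core (u + v) = E.over₁₃.add (E.core u) (E.core v)
  core_add₂₃ : ∀ u v, E.core (u + v) = E.over₂₃.add (E.core u) (E.core v)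
  core_smul₁₂ : ∀ (t : ℝ) u, E.core (t • u) = E.over₁₂.smul t (E.core u)
  core_smul₁₃ : ∀ (t : ℝ) u, E.core (t • u) = E.over₁₃.smul t (E.core u)
  core_smul₂₃ : ∀ (t : ℝ) u, E.core (t • u) = E.over₂₃.smul t (E.core u)

theorem DVS.Lawful.dec (A B C : Type) [AddCommGroup A] [Module ℝ A] [AddCommGroup B] [Module ℝ B]
    [AddCommGroup C] [Module ℝ C] : (DVS.dec A B C).Lawful where
  overA := by
    constructor <;> simp +contextual [add_comm, add_left_comm, mul_smul, add_smul]
  overB := by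
    constructor <;> simp +contextual [add_comm, add_left_comm, mul_smul, add_smul]
  double := by
    refine ⟨?_, ?_, ?_, ?_, ?_, ?_, ?_, ?_, fun t u x => by simp [smul_comm t u]⟩ <;>
      simp +contextual [add_comm, add_left_comm, VBStr.ofModule]
  core_injective := fun c c' h => by simpa using h
  core_range := by simp [eq_comm, and_comm]
  core_addA := by simp
  core_addB := by simp
  core_smulA := by simp
  core_smulB := by simp

theorem TVS.Lawful.dec_double₁ : VBStr.Double (TVS.dec V₁ V₂ V₃ V₁₂ V₁₃ V₂₃ V₁₂₃).over₁₂
    (TVS.dec V₁ V₂ V₃ V₁₂ V₁₃ V₂₃ V₁₂₃).over₁₃ (DVS.dec V₁ V₂ V₁₂).overA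
    (DVS.dec V₁ V₃ V₁₃).overA := by
  refine ⟨?_, ?_, ?_, ?_, ?_, ?_, ?_, ?_, fun t u x => by simp [smul_comm t u]⟩ <;>
    simp +contextual [add_comm, add_left_comm]

theorem TVS.Lawful.dec_double₂ : VBStr.Double (TVS.dec V₁ V₂ V₃ V₁₂ V₁₃ V₂₃ V₁₂₃).over₁₂
    (TVS.dec V₁ V₂ V₃ V₁₂ V₁₃ V₂₃ V₁₂₃).over₂₃ (DVS.dec V₁ V₂ V₁₂).overB
    (DVS.dec V₂ V₃ V₂₃).overA := by
  refine ⟨?_, ?_, ?_, ?_, ?_, ?_, ?_, ?_, fun t u x => by simp [smul_comm t u]⟩ <;>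
    simp +contextual [add_comm, add_left_comm]

theorem TVS.Lawful.dec_double₃ : VBStr.Double (TVS.dec V₁ V₂ V₃ V₁₂ V₁₃ V₂₃ V₁₂₃).over₁₃
    (TVS.dec V₁ V₂ V₃ V₁₂ V₁₃ V₂₃ V₁₂₃).over₂₃ (DVS.dec V₁ V₃ V₁₃).overB
    (DVS.dec V₂ V₃ V₂₃).overB := by
  refine ⟨?_, ?_, ?_, ?_, ?_, ?_, ?_, ?_, fun t u x => by simp [smul_comm t u]⟩ <;>
    simp +contextual [add_comm, add_left_comm]

theorem TVS.Lawful.dec_over : (TVS.dec V₁ V₂ V₃ V₁₂ V₁₃ V₂₃ V₁₂₃).over₁₂.Lawful ∧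
    (TVS.dec V₁ V₂ V₃ V₁₂ V₁₃ V₂₃ V₁₂₃).over₁₃.Lawful ∧
    (TVS.dec V₁ V₂ V₃ V₁₂ V₁₃ V₂₃ V₁₂₃).over₂₃.Lawful := by
  refine ⟨?_, ?_, ?_⟩ <;> constructor <;>
    simp +contextual [add_comm, add_left_comm, mul_smul, add_smul]

theorem TVS.Lawful.dec : (TVS.dec V₁ V₂ V₃ V₁₂ V₁₃ V₂₃ V₁₂₃).Lawful where
  D₁₂ := .dec _ _ _
  D₁₃ := .dec _ _ _
  D₂₃ := .dec _ _ _
  over₁₂ := dec_over.1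
  over₁₃ := dec_over.2.1
  over₂₃ := dec_over.2.2
  double₁ := dec_double₁
  double₂ := dec_double₂
  double₃ := dec_double₃
  core_injective := fun c c' h => by simpa using h
  core_range := by
    rintro ⟨e₁, e₂, e₃, e₁₂, e₁₃, e₂₃, u⟩
    constructor
    · rintro ⟨h, h', h''⟩
      obtain ⟨rfl, rfl, rfl⟩ : e₁ = 0 ∧ e₂ = 0 ∧ e₁₂ = 0 := by simpa using h
      obtain ⟨-, rfl, rfl⟩ : (0 : V₁) = 0 ∧ e₃ = 0 ∧ e₁₃ = 0 := by simpa using h'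
      obtain ⟨-, -, rfl⟩ : (0 : V₂) = 0 ∧ (0 : V₃) = 0 ∧ e₂₃ = 0 := by simpa using h''
      exact ⟨u, rfl⟩
    · rintro ⟨v, hv⟩
      obtain ⟨rfl, rfl, rfl, rfl, rfl, rfl, rfl⟩ : 0 = e₁ ∧ 0 = e₂ ∧ 0 = e₃ ∧ 0 = e₁₂ ∧ 0 = e₁₃ ∧
        0 = e₂₃ ∧ v = u := by simpa using hv
      exact ⟨rfl, rfl, rfl⟩
  core_add₁₂ := by simp
  core_add₁₃ := by simp
  core_add₂₃ := by simp
  core_smul₁₂ := by simp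
  core_smul₁₃ := by simp
  core_smul₂₃ := by simp

theorem core_range_aux {A B C : Type} [AddCommGroup A] [Module ℝ A] [AddCommGroup B] [Module ℝ B]
    [AddCommGroup C] [Module ℝ C] {E F : DVS A B C} (φ : E.Iso F) (L : F.Lawful) (c : C) :
    E.overA.proj (E.core c) = 0 ∧ E.overB.proj (E.core c) = 0 := by
  have h := (L.core_range (F.core c)).2 ⟨c, rfl⟩
  rwa [← φ.core, φ.homA.proj, φ.homB.proj] at h

theorem DVS.Lawful.of_iso {A B C : Type} [AddCommGroup A] [Module ℝ A] [AddCommGroup B] [Module ℝ B]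
    [AddCommGroup C] [Module ℝ C] {E F : DVS A B C} (φ : E.Iso F) (L : F.Lawful) : E.Lawful where
  overA := .of_hom (g := Equiv.refl A) φ.homA L.overA
  overB := .of_hom (g := Equiv.refl B) φ.homB L.overB
  double := .of_hom (b := Equiv.refl A) (c := Equiv.refl B) (a := Equiv.refl Unit) φ.homA φ.homB
    (.refl _) (.refl _) L.double
  core_injective c c' h := L.core_injective (by rw [← φ.core, ← φ.core, h])
  core_range x := by
    have h := L.core_range (φ.e x)
    rw [φ.homA.proj, φ.homB.proj] at h
    refine h.trans (exists_congr fun c => ?_)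
    rw [← φ.core, φ.e.injective.eq_iff]
  core_addA c c' := φ.e.injective (by
    rw [φ.homA.add _ _ (((core_range_aux φ L c).1).trans ((core_range_aux φ L c').1).symm),
      φ.core, φ.core, φ.core, L.core_addA])
  core_addB c c' := φ.e.injective (by
    rw [φ.homB.add _ _ (((core_range_aux φ L c).2).trans ((core_range_aux φ L c').2).symm),
      φ.core, φ.core, φ.core, L.core_addB])
  core_smulA t c := φ.e.injective (by rw [φ.homA.smul, φ.core, φ.core, L.core_smulA])
  core_smulB t c := φ.e.injective (by rw [φ.homB.smul, φ.core, φ.core, L.core_smulB])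

theorem TVS.Lawful.of_iso {E F : TVS V₁ V₂ V₃ V₁₂ V₁₃ V₂₃ V₁₂₃} (φ : E.Iso F) (L : F.Lawful) :
    E.Lawful :=
  have key : ∀ u, E.over₁₂.proj (E.core u) = E.D₁₂.core 0 ∧
      E.over₁₃.proj (E.core u) = E.D₁₃.core 0 ∧ E.over₂₃.proj (E.core u) = E.D₂₃.core 0 := fun u => by
    have h := (L.core_range (F.core u)).2 ⟨u, rfl⟩
    rwa [← φ.core, φ.hom₁₂.proj, φ.hom₁₃.proj, φ.hom₂₃.proj, ← φ.i₁₂.core, ← φ.i₁₃.core,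
      ← φ.i₂₃.core, φ.i₁₂.e.injective.eq_iff, φ.i₁₃.e.injective.eq_iff,
      φ.i₂₃.e.injective.eq_iff] at h
  { D₁₂ := .of_iso φ.i₁₂ L.D₁₂
    D₁₃ := .of_iso φ.i₁₃ L.D₁₃
    D₂₃ := .of_iso φ.i₂₃ L.D₂₃
    over₁₂ := .of_hom φ.hom₁₂ L.over₁₂
    over₁₃ := .of_hom φ.hom₁₃ L.over₁₃
    over₂₃ := .of_hom φ.hom₂₃ L.over₂₃
    double₁ := .of_hom (a := Equiv.refl V₁) φ.hom₁₂ φ.hom₁₃ φ.i₁₂.homA φ.i₁₃.homA L.double₁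
    double₂ := .of_hom (a := Equiv.refl V₂) φ.hom₁₂ φ.hom₂₃ φ.i₁₂.homB φ.i₂₃.homA L.double₂
    double₃ := .of_hom (a := Equiv.refl V₃) φ.hom₁₃ φ.hom₂₃ φ.i₁₃.homB φ.i₂₃.homB L.double₃
    core_injective := fun c c' h => L.core_injective (by rw [← φ.core, ← φ.core, h])
    core_range := fun x => by
      have h := L.core_range (φ.e x)
      rw [φ.hom₁₂.proj, φ.hom₁₃.proj, φ.hom₂₃.proj, ← φ.i₁₂.core, ← φ.i₁₃.core,
        ← φ.i₂₃.core, φ.i₁₂.e.injective.eq_iff, φ.i₁₃.e.injective.eq_iff,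
        φ.i₂₃.e.injective.eq_iff] at h
      refine h.trans (exists_congr fun c => ?_)
      rw [← φ.core, φ.e.injective.eq_iff]
    core_add₁₂ := fun u v => φ.e.injective (by
      rw [φ.hom₁₂.add _ _ ((key u).1.trans (key v).1.symm), φ.core, φ.core, φ.core, L.core_add₁₂])
    core_add₁₃ := fun u v => φ.e.injective (by
      rw [φ.hom₁₃.add _ _ ((key u).2.1.trans (key v).2.1.symm), φ.core, φ.core, φ.core,
        L.core_add₁₃])
    core_add₂₃ := fun u v => φ.e.injective (by
      rw [φ.hom₂₃.add _ _ ((key u).2.2.trans (key v).2.2.symm), φ.core, φ.core, φ.core,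
        L.core_add₂₃])
    core_smul₁₂ := fun t u => φ.e.injective (by rw [φ.hom₁₂.smul, φ.core, φ.core, L.core_smul₁₂])
    core_smul₁₃ := fun t u => φ.e.injective (by rw [φ.hom₁₃.smul, φ.core, φ.core, L.core_smul₁₃])
    core_smul₂₃ := fun t u => φ.e.injective (by rw [φ.hom₂₃.smul, φ.core, φ.core, L.core_smul₂₃]) }

end Laws

section DecIso

variable {V₁ V₂ V₃ V₁₂ V₁₃ V₂₃ V₁₂₃ V₀ V₀₂ V₀₃ V₀₂₃ : Type}
variable [AddCommGroup V₁] [Module ℝ V₁] [AddCommGroup V₂] [Module ℝ V₂]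
  [AddCommGroup V₃] [Module ℝ V₃] [AddCommGroup V₁₂] [Module ℝ V₁₂] [AddCommGroup V₁₃] [Module ℝ V₁₃]
  [AddCommGroup V₂₃] [Module ℝ V₂₃] [AddCommGroup V₁₂₃] [Module ℝ V₁₂₃]
  [AddCommGroup V₀] [Module ℝ V₀] [AddCommGroup V₀₂] [Module ℝ V₀₂] [AddCommGroup V₀₃] [Module ℝ V₀₃]
  [AddCommGroup V₀₂₃] [Module ℝ V₀₂₃]
  {b₀ : V₀ →ₗ[ℝ] V₁₂₃ →ₗ[ℝ] ℝ} {b₂ : V₀₂ →ₗ[ℝ] V₁₃ →ₗ[ℝ] ℝ} {b₃ : V₀₃ →ₗ[ℝ] V₁₂ →ₗ[ℝ] ℝ}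
  {b₁ : V₀₂₃ →ₗ[ℝ] V₁ →ₗ[ℝ] ℝ}

local notation "𝔇" => TVS.dec V₁ V₂ V₃ V₁₂ V₁₃ V₂₃ V₁₂₃

theorem tupT_cT (χ : (𝔇).Iso 𝔇) {y y' : V₀ × V₂ × V₃ × V₀₂ × V₀₃ × V₂₃ × V₀₂₃}
    (h : (tupT b₀ b₂ b₃ b₁ y' : TVS.dT 𝔇) = χ.cT (tupT b₀ b₂ b₃ b₁ y)) :
    y'.2.1 = y.2.1 ∧ y'.2.2.1 = y.2.2.1 ∧
    y'.2.2.2.2.2.1 = (χ.i₂₃.e.symm (y.2.1, y.2.2.1, y.2.2.2.2.2.1)).2.2 ∧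
    ∀ (t₁ : V₁) (t₁₂ : V₁₂) (t₁₃ : V₁₃) (u : V₁₂₃),
      b₁ y'.2.2.2.2.2.2 t₁ + b₃ y'.2.2.2.2.1 t₁₂ + b₂ y'.2.2.2.1 t₁₃ + b₀ y'.1 u =
        b₁ y.2.2.2.2.2.2 (χ.e (t₁, y.2.1, y.2.2.1, t₁₂, t₁₃, y'.2.2.2.2.2.1, u)).1 +
        b₃ y.2.2.2.2.1 (χ.e (t₁, y.2.1, y.2.2.1, t₁₂, t₁₃, y'.2.2.2.2.2.1, u)).2.2.2.1 +
        b₂ y.2.2.2.1 (χ.e (t₁, y.2.1, y.2.2.1, t₁₂, t₁₃, y'.2.2.2.2.2.1, u)).2.2.2.2.1 +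
        b₀ y.1 (χ.e (t₁, y.2.1, y.2.2.1, t₁₂, t₁₃, y'.2.2.2.2.2.1, u)).2.2.2.2.2.2 := by
  obtain ⟨y₀, y₂, y₃, y₀₂, y₀₃, y₂₃, yε⟩ := y
  obtain ⟨z₀, z₂, z₃, z₀₂, z₀₃, z₂₃, zε⟩ := y'
  have hp : (z₂, z₃, z₂₃) = χ.i₂₃.e.symm (y₂, y₃, y₂₃) := congrArg DualTot.pt h
  have h2 : z₂ = y₂ := (congrArg (fun x => x.1) hp).trans (χ.projA_symm (y₂, y₃, y₂₃))
  have h3 : z₃ = y₃ := (congrArg (fun x => x.2.1) hp).trans (χ.projB_symm (y₂, y₃, y₂₃))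
  subst h2 h3
  refine ⟨rfl, rfl, congrArg (fun x => x.2.2) hp, fun t₁ t₁₂ t₁₃ u => ?_⟩
  have hm : χ.e (t₁, z₂, z₃, t₁₂, t₁₃, z₂₃, u) ∈ TVS.fib 𝔇 (z₂, z₃, y₂₃) :=
    (χ.mem_fib' _ _).1 (by rw [← hp]; exact rfl)
  have hv := congrArg (fun Ψ => DualTot.val Ψ (t₁, z₂, z₃, t₁₂, t₁₃, z₂₃, u)) h
  refine (tupT_val' b₀ b₂ b₃ b₁ _ _ _ _ _ _ _ _ _ _ _).symm.trans (hv.trans ?_)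
  exact tupT_val b₀ b₂ b₃ b₁ (y₀, z₂, z₃, y₀₂, y₀₃, y₂₃, yε) _ hm

theorem tup₁₂_c₁₂ (χ : (𝔇).Iso 𝔇) {y y' : V₀ × V₂ × V₀₂}
    (h : (tup₁₂ b₀ b₂ y' : TVS.d₁₂ 𝔇) = χ.c₁₂ (tup₁₂ b₀ b₂ y)) :
    y'.2.1 = y.2.1 ∧ ∀ (t : V₁₃) (u : V₁₂₃), b₂ y'.2.2 t + b₀ y'.1 u =
        b₂ y.2.2 (χ.e (0, y.2.1, 0, 0, t, 0, u)).2.2.2.2.1 +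
        b₀ y.1 (χ.e (0, y.2.1, 0, 0, t, 0, u)).2.2.2.2.2.2 := by
  obtain ⟨y₀, y₂, y₀₂⟩ := y
  obtain ⟨z₀, z₂, z₀₂⟩ := y'
  obtain rfl : z₂ = y₂ := congrArg DualTot.pt h
  refine ⟨rfl, fun t u => ?_⟩
  have hm : χ.e (0, z₂, 0, 0, t, 0, u) ∈ TVS.core₂ 𝔇 z₂ :=
    (χ.mem_core₂ _ _).2 (dec_mem_core₂' _ _ _)
  have hv := congrArg (fun Ψ => DualTot.val Ψ (0, z₂, 0, 0, t, 0, u)) h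
  refine (tup₁₂_val' b₀ b₂ _ _ _ _ _).symm.trans (hv.trans ?_)
  exact tup₁₂_val b₀ b₂ (y₀, z₂, y₀₂) _ hm

theorem tup₁₃_c₁₃ (χ : (𝔇).Iso 𝔇) {y y' : V₀ × V₃ × V₀₃}
    (h : (tup₁₃ b₀ b₃ y' : TVS.d₁₃ 𝔇) = χ.c₁₃ (tup₁₃ b₀ b₃ y)) :
    y'.2.1 = y.2.1 ∧ ∀ (t : V₁₂) (u : V₁₂₃), b₃ y'.2.2 t + b₀ y'.1 u =
        b₃ y.2.2 (χ.e (0, 0, y.2.1, t, 0, 0, u)).2.2.2.1 +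
        b₀ y.1 (χ.e (0, 0, y.2.1, t, 0, 0, u)).2.2.2.2.2.2 := by
  obtain ⟨y₀, y₃, y₀₃⟩ := y
  obtain ⟨z₀, z₃, z₀₃⟩ := y'
  obtain rfl : z₃ = y₃ := congrArg DualTot.pt h
  refine ⟨rfl, fun t u => ?_⟩
  have hm : χ.e (0, 0, z₃, t, 0, 0, u) ∈ TVS.core₃ 𝔇 z₃ :=
    (χ.mem_core₃ _ _).2 (dec_mem_core₃' _ _ _)
  have hv := congrArg (fun Ψ => DualTot.val Ψ (0, 0, z₃, t, 0, 0, u)) h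
  refine (tup₁₃_val' b₀ b₃ _ _ _ _ _).symm.trans (hv.trans ?_)
  exact tup₁₃_val b₀ b₃ (y₀, z₃, y₀₃) _ hm

end DecIso
/-! ### Smooth structures -/

open scoped Manifold ContDiff
open Bundle

/-- A finite-dimensional smooth manifold (second countable and Hausdorff). -/
structure Base where
  dim : ℕ
  pt : Type
  [top : TopologicalSpace pt]
  [charted : ChartedSpace (EuclideanSpace ℝ (Fin dim)) pt]
  [mfd : IsManifold (𝓡 dim) ∞ pt]
  [t2 : T2Space pt]
  [sc : SecondCountableTopology pt]

attribute [instance] Base.top Base.charted Base.mfd Base.t2 Base.sc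

/-- A smooth real vector bundle of finite rank over `M`. -/
structure VecBdl (M : Base) where
  F : Type
  fib : M.pt → Type
  [normed : NormedAddCommGroup F]
  [space : NormedSpace ℝ F]
  [findim : FiniteDimensional ℝ F]
  [group : ∀ m, AddCommGroup (fib m)]
  [module : ∀ m, Module ℝ (fib m)]
  [fibTop : ∀ m, TopologicalSpace (fib m)]
  [top : TopologicalSpace (TotalSpace F fib)]
  [fiber : FiberBundle F fib]
  [vector : VectorBundle ℝ F fib]
  [smooth : ContMDiffVectorBundle ∞ F fib (𝓡 M.dim)]

attribute [instance] VecBdl.normed VecBdl.space VecBdl.findim VecBdl.group VecBdl.module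
  VecBdl.fibTop VecBdl.top VecBdl.fiber VecBdl.vector VecBdl.smooth

/-- The total space. -/
abbrev VecBdl.Tot {M : Base} (V : VecBdl M) : Type := TotalSpace V.F V.fib

/-- The model of the total space as a manifold. -/
abbrev VecBdl.I {M : Base} (V : VecBdl M) := (𝓡 M.dim).prod 𝓘(ℝ, V.F)

/-- The Whitney sum, fibrewise the product. -/
def VecBdl.prod {M : Base} (V W : VecBdl M) : VecBdl M where
  F := V.F × W.F
  fib := V.fib ×ᵇ W.fib

section Smooth

variable {M : Base} {V W : VecBdl M}
variable {E H N : Type} [NormedAddCommGroup E] [NormedSpace ℝ E] [TopologicalSpace H]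
  {J : ModelWithCorners ℝ E H} [TopologicalSpace N] [ChartedSpace H N]

theorem contMDiffAt_prod_iff {b : N → M.pt} {v : ∀ n, V.fib (b n)} {w : ∀ n, W.fib (b n)} {n₀ : N} :
    ContMDiffAt J (V.prod W).I ∞ (fun n => (⟨b n, (v n, w n)⟩ : (V.prod W).Tot)) n₀ ↔
      ContMDiffAt J V.I ∞ (fun n => (⟨b n, v n⟩ : V.Tot)) n₀ ∧
      ContMDiffAt J W.I ∞ (fun n => (⟨b n, w n⟩ : W.Tot)) n₀ := by
  rw [contMDiffAt_totalSpace, contMDiffAt_totalSpace, contMDiffAt_totalSpace]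
  simp only
  have e : ContMDiffAt J 𝓘(ℝ, (V.prod W).F) ∞ (fun n =>
      ((trivializationAt (V.prod W).F (V.prod W).fib (b n₀)) ⟨b n, (v n, w n)⟩).2) n₀ ↔
      ContMDiffAt J 𝓘(ℝ, V.F) ∞ (fun n => ((trivializationAt V.F V.fib (b n₀)) ⟨b n, v n⟩).2) n₀ ∧
      ContMDiffAt J 𝓘(ℝ, W.F) ∞ (fun n => ((trivializationAt W.F W.fib (b n₀)) ⟨b n, w n⟩).2) n₀ :=
    contMDiffAt_prod_module_iff (fun n => (((trivializationAt V.F V.fib (b n₀)) ⟨b n, v n⟩).2,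
      ((trivializationAt W.F W.fib (b n₀)) ⟨b n, w n⟩).2))
  rw [e]
  tauto

theorem contMDiffAt_zero {b : N → M.pt} {n₀ : N} (hb : ContMDiffAt J (𝓡 M.dim) ∞ b n₀) :
    ContMDiffAt J V.I ∞ (fun n => (⟨b n, 0⟩ : V.Tot)) n₀ :=
  ContMDiffAt.comp n₀ (Bundle.contMDiff_zeroSection ℝ V.fib (b n₀)) hb

/-- A smooth fibrewise perfect pairing of `V` and `W`: an identification of `V` with the dual of `W`. -/
structure SmoothPairing (V W : VecBdl M) where
  b : ∀ m, V.fib m →ₗ[ℝ] W.fib m →ₗ[ℝ] ℝ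
  perfect : ∀ m, Function.Bijective (b m)
  smooth : ContMDiff (V.prod W).I 𝓘(ℝ) ∞ (fun p : (V.prod W).Tot => b p.proj p.2.1 p.2.2)

theorem contMDiffAt_of_pairing (P : SmoothPairing V W) {b : N → M.pt} {v : ∀ n, V.fib (b n)} {n₀ : N}
    (hb : ContMDiffAt J (𝓡 M.dim) ∞ b n₀)
    (h : ∀ ξ : ∀ m, W.fib m, ContMDiffAt (𝓡 M.dim) W.I ∞ (fun m => (⟨m, ξ m⟩ : W.Tot)) (b n₀) →
      ContMDiffAt J 𝓘(ℝ) ∞ (fun n => P.b (b n) (v n) (ξ (b n))) n₀) :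
    ContMDiffAt J V.I ∞ (fun n => (⟨b n, v n⟩ : V.Tot)) n₀ := by
  let eV := trivializationAt V.F V.fib (b n₀)
  let eW := trivializationAt W.F W.fib (b n₀)
  have hV : b n₀ ∈ eV.baseSet := mem_baseSet_trivializationAt _ _ _
  have hW : b n₀ ∈ eW.baseSet := mem_baseSet_trivializationAt _ _ _
  let β := Module.finBasis ℝ V.F
  let γ := Module.finBasis ℝ W.F
  rw [contMDiffAt_totalSpace]
  refine ⟨hb, ?_⟩
  simp only
  -- the frames
  let ξ := fun j => eV.localFrame β j
  let η := fun i => eW.localFrame γ i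
  have hξ : ∀ j, ContMDiffAt (𝓡 M.dim) V.I ∞ (fun m => (⟨m, ξ j m⟩ : V.Tot)) (b n₀) :=
    fun j => contMDiffAt_localFrame_of_mem _ _ _ _ hV
  have hη : ∀ i, ContMDiffAt (𝓡 M.dim) W.I ∞ (fun m => (⟨m, η i m⟩ : W.Tot)) (b n₀) :=
    fun j => contMDiffAt_localFrame_of_mem _ _ _ _ hW
  let g : _ → _ → M.pt → ℝ := fun j i m => P.b m (ξ j m) (η i m)
  have hg : ∀ j i, ContMDiffAt (𝓡 M.dim) 𝓘(ℝ) ∞ (g j i) (b n₀) := fun j i =>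
    ContMDiffAt.comp (b n₀) (P.smooth _) (contMDiffAt_prod_iff.2 ⟨hξ j, hη i⟩)
  let κ := Fin (Module.finrank ℝ W.F)
  let U : _ → κ → V.F →L[ℝ] (κ → ℝ) := fun j i =>
    (LinearMap.toContinuousLinearMap (β.coord j)).smulRight (Pi.single i 1)
  let G : N → V.F →L[ℝ] (κ → ℝ) := fun n => ∑ j, ∑ i, g j i (b n) • U j i
  have hG : ContMDiffAt J 𝓘(ℝ, V.F →L[ℝ] (κ → ℝ)) ∞ G n₀ :=
    ContMDiffAt.sum fun j _ => ContMDiffAt.sum fun i _ =>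
      ((hg j i).comp n₀ hb).smul contMDiffAt_const
  have key : ∀ n, b n ∈ eV.baseSet → b n ∈ eW.baseSet → ∃ L : V.F ≃L[ℝ] (κ → ℝ),
      (L : V.F →L[ℝ] (κ → ℝ)) = G n ∧
        L (eV ⟨b n, v n⟩).2 = fun i => P.b (b n) (v n) (η i (b n)) := by
    intro n h1 h2
    let L : V.F ≃ₗ[ℝ] (κ → ℝ) := (eV.linearEquivAt (R := ℝ) (b n) h1).symm ≪≫ₗ
      LinearEquiv.ofBijective (P.b (b n)) (P.perfect _) ≪≫ₗ ((eW.basisAt γ h2).constr ℝ).symm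
    have hL : ∀ x i, L x i = P.b (b n) ((eV.linearEquivAt (R := ℝ) (b n) h1).symm x)
        (η i (b n)) := by
      intro x i
      simp only [η, eW.localFrame_apply_of_mem_baseSet γ h2]
      rfl
    refine ⟨L.toContinuousLinearEquiv, ?_, ?_⟩
    · refine ContinuousLinearMap.coe_injective (β.ext fun j => funext fun i => ?_)
      change L (β j) i = G n (β j) i
      rw [hL]
      simp only [G, U, _root_.sum_apply, _root_.smul_apply,
        ContinuousLinearMap.smulRight_apply, LinearMap.coe_toContinuousLinearMap', Module.Basis.coord_apply,
        Module.Basis.repr_self, Finset.sum_apply, Pi.smul_apply, smul_eq_mul, Finsupp.single_apply,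
        Pi.single_apply]
      simp only [g, ξ, eV.localFrame_apply_of_mem_baseSet β h1]
      simp [Bundle.Trivialization.basisAt]
    · funext i
      change L _ i = _
      rw [hL]
      congr 2
      rw [LinearEquiv.symm_apply_eq]
      rfl
  have hl : ContMDiffAt J 𝓘(ℝ, κ → ℝ) ∞ (fun n i => P.b (b n) (v n) (η i (b n))) n₀ :=
    contMDiffAt_pi_space.2 fun i => h _ (hη i)
  obtain ⟨L₀, hL₀, -⟩ := key n₀ hV hW
  have hinv : ContMDiffAt J 𝓘(ℝ, (κ → ℝ) →L[ℝ] V.F) ∞ (fun n => (G n).inverse) n₀ := by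
    have h1 : ContDiffAt ℝ ∞ ContinuousLinearMap.inverse (G n₀) := by
      rw [← hL₀]; exact contDiffAt_map_inverse L₀
    exact h1.contMDiffAt.comp n₀ hG
  refine (hinv.clm_apply hl).congr_of_eventuallyEq ?_
  have e1 := hb.continuousAt.preimage_mem_nhds (eV.open_baseSet.mem_nhds hV)
  have e2 := hb.continuousAt.preimage_mem_nhds (eW.open_baseSet.mem_nhds hW)
  filter_upwards [e1, e2] with n h1 h2
  obtain ⟨L, hL, hL'⟩ := key n h1 h2
  rw [← hL, ContinuousLinearMap.inverse_equiv, ← hL']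
  simp [eV]

end Smooth

/-- The structure of a smooth manifold on the set `S`, given by a bijection with a finite-dimensional
smooth manifold without boundary. -/
structure SmoothStr (S : Type) where
  X : Type
  E : Type
  H : Type
  [normed : NormedAddCommGroup E]
  [space : NormedSpace ℝ E]
  [findim : FiniteDimensional ℝ E]
  [topH : TopologicalSpace H]
  I : ModelWithCorners ℝ E H
  [boundaryless : I.Boundaryless]
  [top : TopologicalSpace X]
  [charted : ChartedSpace H X]
  [mfd : IsManifold I ∞ X]
  e : S ≃ X

attribute [instance] SmoothStr.normed SmoothStr.space SmoothStr.findim SmoothStr.topH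
  SmoothStr.boundaryless SmoothStr.top SmoothStr.charted SmoothStr.mfd

/-- Smooth maps. -/
def SmoothStr.Smooth {S S' : Type} (A : SmoothStr S) (B : SmoothStr S') (f : S → S') : Prop :=
  ContMDiff A.I B.I ∞ (fun x => B.e (f (A.e.symm x)))

/-- Transport of a smooth structure along a bijection. -/
def SmoothStr.pullback {S S' : Type} (B : SmoothStr S') (f : S ≃ S') : SmoothStr S :=
  { B with e := f.trans B.e }

/-- The smooth structure of the total space of a vector bundle. -/
def VecBdl.str {M : Base} (V : VecBdl M) : SmoothStr (Σ m, V.fib m) where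
  X := V.Tot
  E := _
  H := _
  I := V.I
  e := ⟨fun p => ⟨p.1, p.2⟩, fun p => ⟨p.1, p.2⟩, fun _ => rfl, fun _ => rfl⟩

/-- Diffeomorphisms. -/
def IsDiffeo {S S' : Type} (A : SmoothStr S) (B : SmoothStr S') (f : S ≃ S') : Prop :=
  A.Smooth B f ∧ B.Smooth A f.symm

theorem SmoothStr.Smooth.comp {S S' S'' : Type} {A : SmoothStr S} {B : SmoothStr S'}
    {C : SmoothStr S''} {g : S' → S''} {f : S → S'} (hg : B.Smooth C g) (hf : A.Smooth B f) :
    A.Smooth C (g ∘ f) := by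
  have := ContMDiff.comp (g := fun x => C.e (g (B.e.symm x))) hg hf
  simpa [Function.comp_def] using! this

theorem SmoothStr.Smooth.id {S : Type} (A : SmoothStr S) : A.Smooth A id := by
  have h : (fun x => A.e (_root_.id (A.e.symm x))) = _root_.id := by funext x; simp
  unfold Smooth
  rw [h]
  exact contMDiff_id

theorem IsDiffeo.refl {S : Type} (A : SmoothStr S) : IsDiffeo A A (Equiv.refl S) :=
  ⟨.id A, .id A⟩

theorem IsDiffeo.symm {S S' : Type} {A : SmoothStr S} {B : SmoothStr S'} {f : S ≃ S'}
    (h : IsDiffeo A B f) : IsDiffeo B A f.symm := ⟨h.2, h.1⟩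

theorem IsDiffeo.trans {S S' S'' : Type} {A : SmoothStr S} {B : SmoothStr S'} {C : SmoothStr S''}
    {f : S ≃ S'} {g : S' ≃ S''} (h : IsDiffeo A B f) (h' : IsDiffeo B C g) :
    IsDiffeo A C (f.trans g) := ⟨h'.1.comp h.1, h.2.comp h'.2⟩

theorem IsDiffeo.pullback {S S' : Type} (B : SmoothStr S') (f : S ≃ S') :
    IsDiffeo (B.pullback f) B f := by
  have h₁ : (fun x => B.e (f ((f.trans B.e).symm x))) = id := by funext x; simp
  have h₂ : (fun x => (f.trans B.e) (f.symm (B.e.symm x))) = id := by funext x; simp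
  constructor
  · change ContMDiff B.I B.I ∞ (fun x => B.e (f ((f.trans B.e).symm x)))
    rw [h₁]; exact contMDiff_id
  · change ContMDiff B.I B.I ∞ (fun x => (f.trans B.e) (f.symm (B.e.symm x)))
    rw [h₂]; exact contMDiff_id

/-- The bijection of total spaces given by a family of bijections of fibres. -/
abbrev tot {M : Type} {A B : M → Type} (f : ∀ m, A m ≃ B m) : (Σ m, A m) ≃ Σ m, B m :=
  Equiv.sigmaCongrRight f

/-- The data of a triple vector bundle with building bundles `V₁, …, V₁₂₃` over `M`: its fibres over the
points of `M` and the smooth structures on the total spaces of the lower faces and of `T`. -/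
structure PreTVB {M : Base} (V₁ V₂ V₃ V₁₂ V₁₃ V₂₃ V₁₂₃ : VecBdl M) where
  fibre : ∀ m, TVS (V₁.fib m) (V₂.fib m) (V₃.fib m) (V₁₂.fib m) (V₁₃.fib m) (V₂₃.fib m) (V₁₂₃.fib m)
  s₁₂ : SmoothStr (Σ m, (fibre m).D₁₂.D)
  s₁₃ : SmoothStr (Σ m, (fibre m).D₁₃.D)
  s₂₃ : SmoothStr (Σ m, (fibre m).D₂₃.D)
  sT : SmoothStr (Σ m, (fibre m).T)

section PreTVB

variable {M : Base} {V₁ V₂ V₃ V₁₂ V₁₃ V₂₃ V₁₂₃ : VecBdl M}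

/-- Smooth statomorphisms. -/
structure PreTVB.Iso (E F : PreTVB V₁ V₂ V₃ V₁₂ V₁₃ V₂₃ V₁₂₃) where
  iso : ∀ m, (E.fibre m).Iso (F.fibre m)
  smooth₁₂ : IsDiffeo E.s₁₂ F.s₁₂ (tot fun m => (iso m).i₁₂.e)
  smooth₁₃ : IsDiffeo E.s₁₃ F.s₁₃ (tot fun m => (iso m).i₁₃.e)
  smooth₂₃ : IsDiffeo E.s₂₃ F.s₂₃ (tot fun m => (iso m).i₂₃.e)
  smoothT : IsDiffeo E.sT F.sT (tot fun m => (iso m).e)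

theorem PreTVB.Iso.ext' {E F : PreTVB V₁ V₂ V₃ V₁₂ V₁₃ V₂₃ V₁₂₃} {φ ψ : E.Iso F}
    (h : ∀ m, φ.iso m = ψ.iso m) : φ = ψ := by
  cases φ; cases ψ; congr; exact funext h

def PreTVB.Iso.refl (E : PreTVB V₁ V₂ V₃ V₁₂ V₁₃ V₂₃ V₁₂₃) : E.Iso E :=
  ⟨fun _ => .refl _, .refl _, .refl _, .refl _, .refl _⟩

def PreTVB.Iso.symm {E F : PreTVB V₁ V₂ V₃ V₁₂ V₁₃ V₂₃ V₁₂₃} (φ : E.Iso F) : F.Iso E :=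
  ⟨fun m => (φ.iso m).symm, φ.smooth₁₂.symm, φ.smooth₁₃.symm, φ.smooth₂₃.symm, φ.smoothT.symm⟩

def PreTVB.Iso.trans {E F G : PreTVB V₁ V₂ V₃ V₁₂ V₁₃ V₂₃ V₁₂₃} (φ : E.Iso F) (ψ : F.Iso G) :
    E.Iso G :=
  ⟨fun m => (φ.iso m).trans (ψ.iso m), φ.smooth₁₂.trans ψ.smooth₁₂, φ.smooth₁₃.trans ψ.smooth₁₃,
    φ.smooth₂₃.trans ψ.smooth₂₃, φ.smoothT.trans ψ.smoothT⟩

variable (V₁ V₂ V₃ V₁₂ V₁₃ V₂₃ V₁₂₃) in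
/-- The decomposed triple vector bundle, with total space the Whitney sum of its building bundles. -/
abbrev PreTVB.dec : PreTVB V₁ V₂ V₃ V₁₂ V₁₃ V₂₃ V₁₂₃ where
  fibre m := TVS.dec (V₁.fib m) (V₂.fib m) (V₃.fib m) (V₁₂.fib m) (V₁₃.fib m) (V₂₃.fib m)
    (V₁₂₃.fib m)
  s₁₂ := (V₁.prod (V₂.prod V₁₂)).str
  s₁₃ := (V₁.prod (V₃.prod V₁₃)).str
  s₂₃ := (V₂.prod (V₃.prod V₂₃)).str
  sT := (V₁.prod (V₂.prod (V₃.prod (V₁₂.prod (V₁₃.prod (V₂₃.prod V₁₂₃)))))).str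

variable (V₁ V₂ V₃ V₁₂ V₁₃ V₂₃ V₁₂₃) in
/-- Triple vector bundles with building bundles `V₁, …, V₁₂₃`: a triple vector bundle is required to
admit a splitting, that is, a statomorphism to the decomposed triple vector bundle on its building
bundles. All other axioms follow from this: see `TVB.lawful`. -/
structure TVB extends PreTVB V₁ V₂ V₃ V₁₂ V₁₃ V₂₃ V₁₂₃ where
  split : Nonempty (toPreTVB.Iso (PreTVB.dec V₁ V₂ V₃ V₁₂ V₁₃ V₂₃ V₁₂₃))

end PreTVB

section DualSmooth

variable {M : Base} {V₁ V₂ V₃ V₁₂ V₁₃ V₂₃ V₁₂₃ V₀ V₀₂ V₀₃ V₀₂₃ : VecBdl M}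
variable (P₀ : SmoothPairing V₀ V₁₂₃) (P₂ : SmoothPairing V₀₂ V₁₃) (P₃ : SmoothPairing V₀₃ V₁₂)
  (P₁ : SmoothPairing V₀₂₃ V₁)

local notation "𝔓" => PreTVB.dec V₁ V₂ V₃ V₁₂ V₁₃ V₂₃ V₁₂₃
local notation "𝔓'" => PreTVB.dec V₀ V₂ V₃ V₀₂ V₀₃ V₂₃ V₀₂₃

/-- The total space of the decomposed triple vector bundle. -/
abbrev BT (V₁ V₂ V₃ V₁₂ V₁₃ V₂₃ V₁₂₃ : VecBdl M) : VecBdl M :=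
  V₁.prod (V₂.prod (V₃.prod (V₁₂.prod (V₁₃.prod (V₂₃.prod V₁₂₃)))))

/-- The fibres of `BT`. -/
abbrev FT (V₁ V₂ V₃ V₁₂ V₁₃ V₂₃ V₁₂₃ : VecBdl M) (m : M.pt) : Type :=
  V₁.fib m × V₂.fib m × V₃.fib m × V₁₂.fib m × V₁₃.fib m × V₂₃.fib m × V₁₂₃.fib m

section
variable {E H N : Type} [NormedAddCommGroup E] [NormedSpace ℝ E] [TopologicalSpace H]
  {J : ModelWithCorners ℝ E H} [TopologicalSpace N] [ChartedSpace H N]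

theorem SmoothPairing.contMDiffAt {V W : VecBdl M} (P : SmoothPairing V W) {b : N → M.pt}
    {v : ∀ n, V.fib (b n)} {w : ∀ n, W.fib (b n)} {n₀ : N}
    (hv : ContMDiffAt J V.I ∞ (fun n => (⟨b n, v n⟩ : V.Tot)) n₀)
    (hw : ContMDiffAt J W.I ∞ (fun n => (⟨b n, w n⟩ : W.Tot)) n₀) :
    ContMDiffAt J 𝓘(ℝ) ∞ (fun n => P.b (b n) (v n) (w n)) n₀ :=
  ContMDiffAt.comp n₀ (P.smooth _) (contMDiffAt_prod_iff.2 ⟨hv, hw⟩)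

theorem contMDiffAt_tuple {b : N → M.pt} {f : ∀ n, FT V₁ V₂ V₃ V₁₂ V₁₃ V₂₃ V₁₂₃ (b n)} {n₀ : N} :
    ContMDiffAt J (BT V₁ V₂ V₃ V₁₂ V₁₃ V₂₃ V₁₂₃).I ∞
      (fun n => (⟨b n, f n⟩ : (BT V₁ V₂ V₃ V₁₂ V₁₃ V₂₃ V₁₂₃).Tot)) n₀ ↔
    ContMDiffAt J V₁.I ∞ (fun n => (⟨b n, (f n).1⟩ : V₁.Tot)) n₀ ∧
    ContMDiffAt J V₂.I ∞ (fun n => (⟨b n, (f n).2.1⟩ : V₂.Tot)) n₀ ∧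
    ContMDiffAt J V₃.I ∞ (fun n => (⟨b n, (f n).2.2.1⟩ : V₃.Tot)) n₀ ∧
    ContMDiffAt J V₁₂.I ∞ (fun n => (⟨b n, (f n).2.2.2.1⟩ : V₁₂.Tot)) n₀ ∧
    ContMDiffAt J V₁₃.I ∞ (fun n => (⟨b n, (f n).2.2.2.2.1⟩ : V₁₃.Tot)) n₀ ∧
    ContMDiffAt J V₂₃.I ∞ (fun n => (⟨b n, (f n).2.2.2.2.2.1⟩ : V₂₃.Tot)) n₀ ∧
    ContMDiffAt J V₁₂₃.I ∞ (fun n => (⟨b n, (f n).2.2.2.2.2.2⟩ : V₁₂₃.Tot)) n₀ := by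
  refine contMDiffAt_prod_iff.trans (and_congr_right fun _ => ?_)
  refine contMDiffAt_prod_iff.trans (and_congr_right fun _ => ?_)
  refine contMDiffAt_prod_iff.trans (and_congr_right fun _ => ?_)
  refine contMDiffAt_prod_iff.trans (and_congr_right fun _ => ?_)
  refine contMDiffAt_prod_iff.trans (and_congr_right fun _ => ?_)
  exact contMDiffAt_prod_iff

theorem contMDiffAt_triple {A B C : VecBdl M} {b : N → M.pt}
    {f : ∀ n, A.fib (b n) × B.fib (b n) × C.fib (b n)} {n₀ : N} :
    ContMDiffAt J (A.prod (B.prod C)).I ∞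
      (fun n => (⟨b n, f n⟩ : (A.prod (B.prod C)).Tot)) n₀ ↔
    ContMDiffAt J A.I ∞ (fun n => (⟨b n, (f n).1⟩ : A.Tot)) n₀ ∧
    ContMDiffAt J B.I ∞ (fun n => (⟨b n, (f n).2.1⟩ : B.Tot)) n₀ ∧
    ContMDiffAt J C.I ∞ (fun n => (⟨b n, (f n).2.2⟩ : C.Tot)) n₀ := by
  refine contMDiffAt_prod_iff.trans (and_congr_right fun _ => ?_)
  exact contMDiffAt_prod_iff

theorem contMDiffAt_isoT (χ : PreTVB.Iso 𝔓 𝔓) {b : N → M.pt}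
    {f : ∀ n, FT V₁ V₂ V₃ V₁₂ V₁₃ V₂₃ V₁₂₃ (b n)} {n₀ : N}
    (h : ContMDiffAt J (BT V₁ V₂ V₃ V₁₂ V₁₃ V₂₃ V₁₂₃).I ∞
      (fun n => (⟨b n, f n⟩ : (BT V₁ V₂ V₃ V₁₂ V₁₃ V₂₃ V₁₂₃).Tot)) n₀) :
    ContMDiffAt J (BT V₁ V₂ V₃ V₁₂ V₁₃ V₂₃ V₁₂₃).I ∞ (fun n =>
      (⟨b n, (χ.iso (b n)).e (f n)⟩ : (BT V₁ V₂ V₃ V₁₂ V₁₃ V₂₃ V₁₂₃).Tot)) n₀ :=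
  ContMDiffAt.comp n₀ (χ.smoothT.1 (⟨b n₀, f n₀⟩ : (BT V₁ V₂ V₃ V₁₂ V₁₃ V₂₃ V₁₂₃).Tot)) h

end

/-- The dual of a statomorphism `χ` of the decomposed triple vector bundle, as a map from the
decomposed dual to itself. -/
def dT (χ : PreTVB.Iso 𝔓 𝔓) (m : M.pt) :
    FT V₀ V₂ V₃ V₀₂ V₀₃ V₂₃ V₀₂₃ m ≃ FT V₀ V₂ V₃ V₀₂ V₀₃ V₂₃ V₀₂₃ m :=
  (tupTE (P₀.b m) (P₂.b m) (P₃.b m) (P₁.b m) (P₀.perfect _) (P₂.perfect _) (P₃.perfect _)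
    (P₁.perfect _)).trans ((χ.iso m).cT.trans
      (tupTE (P₀.b m) (P₂.b m) (P₃.b m) (P₁.b m) (P₀.perfect _) (P₂.perfect _) (P₃.perfect _)
        (P₁.perfect _)).symm)

def d₁₂ (χ : PreTVB.Iso 𝔓 𝔓) (m : M.pt) :
    V₀.fib m × V₂.fib m × V₀₂.fib m ≃ V₀.fib m × V₂.fib m × V₀₂.fib m :=
  (tup₁₂E (P₀.b m) (P₂.b m) (P₀.perfect _) (P₂.perfect _)).trans ((χ.iso m).c₁₂.trans
      (tup₁₂E (P₀.b m) (P₂.b m) (P₀.perfect _) (P₂.perfect _)).symm)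

def d₁₃ (χ : PreTVB.Iso 𝔓 𝔓) (m : M.pt) :
    V₀.fib m × V₃.fib m × V₀₃.fib m ≃ V₀.fib m × V₃.fib m × V₀₃.fib m :=
  (tup₁₃E (P₀.b m) (P₃.b m) (P₀.perfect _) (P₃.perfect _)).trans ((χ.iso m).c₁₃.trans
      (tup₁₃E (P₀.b m) (P₃.b m) (P₀.perfect _) (P₃.perfect _)).symm)

/-- The dual of a smooth statomorphism is smooth. Hence the smooth structure of a dual, which is defined
by means of a splitting in `TVB.dualX`, does not depend on the splitting. -/
theorem smooth_dT (χ : PreTVB.Iso 𝔓 𝔓) :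
    (𝔓').sT.Smooth (𝔓').sT (tot (dT P₀ P₂ P₃ P₁ χ)) := by
  let N := (BT V₀ V₂ V₃ V₀₂ V₀₃ V₂₃ V₀₂₃).Tot
  suffices h : ∀ n₀ : N, ContMDiffAt (BT V₀ V₂ V₃ V₀₂ V₀₃ V₂₃ V₀₂₃).I
      (BT V₀ V₂ V₃ V₀₂ V₀₃ V₂₃ V₀₂₃).I ∞
      (fun n : N => (⟨n.1, dT P₀ P₂ P₃ P₁ χ n.1 n.2⟩ : N)) n₀ from h
  intro n₀
  let y : ∀ n : N, FT V₀ V₂ V₃ V₀₂ V₀₃ V₂₃ V₀₂₃ n.1 := fun n => n.2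
  let z : ∀ n : N, FT V₀ V₂ V₃ V₀₂ V₀₃ V₂₃ V₀₂₃ n.1 := fun n => dT P₀ P₂ P₃ P₁ χ n.1 (y n)
  have hz : ∀ n : N, (tupT (P₀.b n.1) (P₂.b n.1) (P₃.b n.1) (P₁.b n.1) (z n) :
      TVS.dT ((𝔓).fibre n.1)) = (χ.iso n.1).cT (tupT (P₀.b n.1) (P₂.b n.1) (P₃.b n.1) (P₁.b n.1)
        (y n)) := fun n => Equiv.apply_symm_apply (tupTE (P₀.b n.1) (P₂.b n.1) (P₃.b n.1) (P₁.b n.1)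
          (P₀.perfect _) (P₂.perfect _) (P₃.perfect _) (P₁.perfect _)) _
  have hs := fun n => tupT_cT (χ.iso n.1) (hz n)
  have hb : ContMDiffAt (BT V₀ V₂ V₃ V₀₂ V₀₃ V₂₃ V₀₂₃).I (𝓡 M.dim) ∞ (fun n : N => n.1) n₀ :=
    Bundle.contMDiffAt_proj (n := ∞) (BT V₀ V₂ V₃ V₀₂ V₀₃ V₂₃ V₀₂₃).fib
  obtain ⟨y₀, y₂, y₃, y₀₂, y₀₃, y₂₃, yε⟩ := (contMDiffAt_tuple
    (J := (BT V₀ V₂ V₃ V₀₂ V₀₃ V₂₃ V₀₂₃).I) (b := fun n : N => n.1) (f := y) (n₀ := n₀)).1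
      contMDiffAt_id
  have z₂ : ContMDiffAt (BT V₀ V₂ V₃ V₀₂ V₀₃ V₂₃ V₀₂₃).I V₂.I ∞
      (fun n : N => (⟨n.1, (z n).2.1⟩ : V₂.Tot)) n₀ := by
    simpa only [(hs _).1] using y₂
  have z₃ : ContMDiffAt (BT V₀ V₂ V₃ V₀₂ V₀₃ V₂₃ V₀₂₃).I V₃.I ∞
      (fun n : N => (⟨n.1, (z n).2.2.1⟩ : V₃.Tot)) n₀ := by
    simpa only [(hs _).2.1] using y₃
  have z₂₃ : ContMDiffAt (BT V₀ V₂ V₃ V₀₂ V₀₃ V₂₃ V₀₂₃).I V₂₃.I ∞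
      (fun n : N => (⟨n.1, (z n).2.2.2.2.2.1⟩ : V₂₃.Tot)) n₀ := by
    simp only [(hs _).2.2.1]
    have h1 := (contMDiffAt_triple (J := (BT V₀ V₂ V₃ V₀₂ V₀₃ V₂₃ V₀₂₃).I)
      (f := fun n : N => ((y n).2.1, (y n).2.2.1, (y n).2.2.2.2.2.1))).2 ⟨y₂, y₃, y₂₃⟩
    exact ((contMDiffAt_triple (b := fun n : N => n.1)
      (f := fun n : N => (χ.iso n.1).i₂₃.e.symm ((y n).2.1, (y n).2.2.1, (y n).2.2.2.2.2.1))).1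
        (ContMDiffAt.comp n₀ (χ.smooth₂₃.2 (⟨n₀.1, ((y n₀).2.1, (y n₀).2.2.1, (y n₀).2.2.2.2.2.1)⟩ :
          (V₂.prod (V₃.prod V₂₃)).Tot)) h1)).2.2
  have main : ∀ (t₁ : ∀ n : N, V₁.fib n.1) (t₁₂ : ∀ n : N, V₁₂.fib n.1) (t₁₃ : ∀ n : N, V₁₃.fib n.1)
      (u : ∀ n : N, V₁₂₃.fib n.1),
      ContMDiffAt (BT V₀ V₂ V₃ V₀₂ V₀₃ V₂₃ V₀₂₃).I V₁.I ∞
        (fun n : N => (⟨n.1, t₁ n⟩ : V₁.Tot)) n₀ →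
      ContMDiffAt (BT V₀ V₂ V₃ V₀₂ V₀₃ V₂₃ V₀₂₃).I V₁₂.I ∞
        (fun n : N => (⟨n.1, t₁₂ n⟩ : V₁₂.Tot)) n₀ →
      ContMDiffAt (BT V₀ V₂ V₃ V₀₂ V₀₃ V₂₃ V₀₂₃).I V₁₃.I ∞
        (fun n : N => (⟨n.1, t₁₃ n⟩ : V₁₃.Tot)) n₀ →
      ContMDiffAt (BT V₀ V₂ V₃ V₀₂ V₀₃ V₂₃ V₀₂₃).I V₁₂₃.I ∞
        (fun n : N => (⟨n.1, u n⟩ : V₁₂₃.Tot)) n₀ →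
      ContMDiffAt (BT V₀ V₂ V₃ V₀₂ V₀₃ V₂₃ V₀₂₃).I 𝓘(ℝ) ∞ (fun n : N =>
        P₁.b n.1 (z n).2.2.2.2.2.2 (t₁ n) + P₃.b n.1 (z n).2.2.2.2.1 (t₁₂ n) +
        P₂.b n.1 (z n).2.2.2.1 (t₁₃ n) + P₀.b n.1 (z n).1 (u n)) n₀ := by
    intro t₁ t₁₂ t₁₃ u h1 h2 h3 h4
    simp only [(hs _).2.2.2]
    obtain ⟨c₁, -, -, c₁₂, c₁₃, -, cu⟩ := contMDiffAt_tuple.1 (contMDiffAt_isoT χ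
      (b := fun n : N => n.1) ((contMDiffAt_tuple
      (f := fun n => (t₁ n, (y n).2.1, (y n).2.2.1, t₁₂ n, t₁₃ n, (z n).2.2.2.2.2.1, u n))).2
      ⟨h1, y₂, y₃, h2, h3, z₂₃, h4⟩))
    exact (((P₁.contMDiffAt yε c₁).add (P₃.contMDiffAt y₀₃ c₁₂)).add (P₂.contMDiffAt y₀₂ c₁₃)).add
      (P₀.contMDiffAt y₀ cu)
  refine (contMDiffAt_tuple (b := fun n : N => n.1) (f := z)).2 ⟨?_, z₂, z₃, ?_, ?_, z₂₃, ?_⟩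
  · refine contMDiffAt_of_pairing P₀ hb fun ξ hξ => ?_
    simpa only [map_zero, zero_add, add_zero] using main (fun _ => 0) (fun _ => 0) (fun _ => 0)
      (fun n => ξ n.1) (contMDiffAt_zero hb) (contMDiffAt_zero hb) (contMDiffAt_zero hb)
      (ContMDiffAt.comp n₀ hξ hb)
  · refine contMDiffAt_of_pairing P₂ hb fun ξ hξ => ?_
    simpa only [map_zero, zero_add, add_zero] using main (fun _ => 0) (fun _ => 0)
      (fun n => ξ n.1) (fun _ => 0) (contMDiffAt_zero hb) (contMDiffAt_zero hb)
      (ContMDiffAt.comp n₀ hξ hb) (contMDiffAt_zero hb)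
  · refine contMDiffAt_of_pairing P₃ hb fun ξ hξ => ?_
    simpa only [map_zero, zero_add, add_zero] using main (fun _ => 0)
      (fun n => ξ n.1) (fun _ => 0) (fun _ => 0) (contMDiffAt_zero hb)
      (ContMDiffAt.comp n₀ hξ hb) (contMDiffAt_zero hb) (contMDiffAt_zero hb)
  · refine contMDiffAt_of_pairing P₁ hb fun ξ hξ => ?_
    simpa only [map_zero, zero_add, add_zero] using main
      (fun n => ξ n.1) (fun _ => 0) (fun _ => 0) (fun _ => 0)
      (ContMDiffAt.comp n₀ hξ hb) (contMDiffAt_zero hb) (contMDiffAt_zero hb) (contMDiffAt_zero hb)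

theorem smooth_d₁₂ (χ : PreTVB.Iso 𝔓 𝔓) :
    (𝔓').s₁₂.Smooth (𝔓').s₁₂ (tot (d₁₂ P₀ P₂ χ)) := by
  let N := (V₀.prod (V₂.prod V₀₂)).Tot
  suffices h : ∀ n₀ : N, ContMDiffAt (V₀.prod (V₂.prod V₀₂)).I (V₀.prod (V₂.prod V₀₂)).I ∞
      (fun n : N => (⟨n.1, d₁₂ P₀ P₂ χ n.1 n.2⟩ : N)) n₀ from h
  intro n₀
  let y : ∀ n : N, V₀.fib n.1 × V₂.fib n.1 × V₀₂.fib n.1 := fun n => n.2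
  let z : ∀ n : N, V₀.fib n.1 × V₂.fib n.1 × V₀₂.fib n.1 := fun n => d₁₂ P₀ P₂ χ n.1 (y n)
  have hz : ∀ n : N, (tup₁₂ (P₀.b n.1) (P₂.b n.1) (z n) : TVS.d₁₂ ((𝔓).fibre n.1)) =
      (χ.iso n.1).c₁₂ (tup₁₂ (P₀.b n.1) (P₂.b n.1) (y n)) := fun n =>
    Equiv.apply_symm_apply (tup₁₂E (P₀.b n.1) (P₂.b n.1) (P₀.perfect _) (P₂.perfect _)) _
  have hs := fun n => tup₁₂_c₁₂ (χ.iso n.1) (hz n)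
  have hb : ContMDiffAt (V₀.prod (V₂.prod V₀₂)).I (𝓡 M.dim) ∞ (fun n : N => n.1) n₀ :=
    Bundle.contMDiffAt_proj (n := ∞) (V₀.prod (V₂.prod V₀₂)).fib
  obtain ⟨y₀, y₂, y₀₂⟩ := (contMDiffAt_triple
    (J := (V₀.prod (V₂.prod V₀₂)).I) (b := fun n : N => n.1) (f := y) (n₀ := n₀)).1 contMDiffAt_id
  have z₂ : ContMDiffAt (V₀.prod (V₂.prod V₀₂)).I V₂.I ∞ (fun n : N => (⟨n.1, (z n).2.1⟩ : V₂.Tot)) n₀ := by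
    simpa only [(hs _).1] using y₂
  have main : ∀ (t : ∀ n : N, V₁₃.fib n.1) (u : ∀ n : N, V₁₂₃.fib n.1),
      ContMDiffAt (V₀.prod (V₂.prod V₀₂)).I V₁₃.I ∞ (fun n : N => (⟨n.1, t n⟩ : V₁₃.Tot)) n₀ →
      ContMDiffAt (V₀.prod (V₂.prod V₀₂)).I V₁₂₃.I ∞ (fun n : N => (⟨n.1, u n⟩ : V₁₂₃.Tot)) n₀ →
      ContMDiffAt (V₀.prod (V₂.prod V₀₂)).I 𝓘(ℝ) ∞
        (fun n : N => P₂.b n.1 (z n).2.2 (t n) + P₀.b n.1 (z n).1 (u n)) n₀ := by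
    intro t u h1 h2
    simp only [(hs _).2]
    obtain ⟨-, -, -, -, c₁, -, cu⟩ := contMDiffAt_tuple.1 (contMDiffAt_isoT χ
      (b := fun n : N => n.1) ((contMDiffAt_tuple
      (f := fun n => (0, (y n).2.1, 0, 0, t n, 0, u n))).2
      ⟨contMDiffAt_zero hb, y₂, contMDiffAt_zero hb, contMDiffAt_zero hb, h1, contMDiffAt_zero hb, h2⟩))
    exact (P₂.contMDiffAt y₀₂ c₁).add (P₀.contMDiffAt y₀ cu)
  refine (contMDiffAt_triple (b := fun n : N => n.1) (f := z)).2 ⟨?_, z₂, ?_⟩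
  · refine contMDiffAt_of_pairing P₀ hb fun ξ hξ => ?_
    simpa only [map_zero, zero_add, add_zero] using main (fun _ => 0) (fun n => ξ n.1)
      (contMDiffAt_zero hb) (ContMDiffAt.comp n₀ hξ hb)
  · refine contMDiffAt_of_pairing P₂ hb fun ξ hξ => ?_
    simpa only [map_zero, zero_add, add_zero] using main (fun n => ξ n.1) (fun _ => 0)
      (ContMDiffAt.comp n₀ hξ hb) (contMDiffAt_zero hb)

theorem smooth_d₁₃ (χ : PreTVB.Iso 𝔓 𝔓) :
    (𝔓').s₁₃.Smooth (𝔓').s₁₃ (tot (d₁₃ P₀ P₃ χ)) := by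
  let N := (V₀.prod (V₃.prod V₀₃)).Tot
  suffices h : ∀ n₀ : N, ContMDiffAt (V₀.prod (V₃.prod V₀₃)).I (V₀.prod (V₃.prod V₀₃)).I ∞
      (fun n : N => (⟨n.1, d₁₃ P₀ P₃ χ n.1 n.2⟩ : N)) n₀ from h
  intro n₀
  let y : ∀ n : N, V₀.fib n.1 × V₃.fib n.1 × V₀₃.fib n.1 := fun n => n.2
  let z : ∀ n : N, V₀.fib n.1 × V₃.fib n.1 × V₀₃.fib n.1 := fun n => d₁₃ P₀ P₃ χ n.1 (y n)
  have hz : ∀ n : N, (tup₁₃ (P₀.b n.1) (P₃.b n.1) (z n) : TVS.d₁₃ ((𝔓).fibre n.1)) =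
      (χ.iso n.1).c₁₃ (tup₁₃ (P₀.b n.1) (P₃.b n.1) (y n)) := fun n =>
    Equiv.apply_symm_apply (tup₁₃E (P₀.b n.1) (P₃.b n.1) (P₀.perfect _) (P₃.perfect _)) _
  have hs := fun n => tup₁₃_c₁₃ (χ.iso n.1) (hz n)
  have hb : ContMDiffAt (V₀.prod (V₃.prod V₀₃)).I (𝓡 M.dim) ∞ (fun n : N => n.1) n₀ :=
    Bundle.contMDiffAt_proj (n := ∞) (V₀.prod (V₃.prod V₀₃)).fib
  obtain ⟨y₀, y₂, y₀₂⟩ := (contMDiffAt_triple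
    (J := (V₀.prod (V₃.prod V₀₃)).I) (b := fun n : N => n.1) (f := y) (n₀ := n₀)).1 contMDiffAt_id
  have z₂ : ContMDiffAt (V₀.prod (V₃.prod V₀₃)).I V₃.I ∞ (fun n : N => (⟨n.1, (z n).2.1⟩ : V₃.Tot)) n₀ := by
    simpa only [(hs _).1] using y₂
  have main : ∀ (t : ∀ n : N, V₁₂.fib n.1) (u : ∀ n : N, V₁₂₃.fib n.1),
      ContMDiffAt (V₀.prod (V₃.prod V₀₃)).I V₁₂.I ∞ (fun n : N => (⟨n.1, t n⟩ : V₁₂.Tot)) n₀ →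
      ContMDiffAt (V₀.prod (V₃.prod V₀₃)).I V₁₂₃.I ∞ (fun n : N => (⟨n.1, u n⟩ : V₁₂₃.Tot)) n₀ →
      ContMDiffAt (V₀.prod (V₃.prod V₀₃)).I 𝓘(ℝ) ∞
        (fun n : N => P₃.b n.1 (z n).2.2 (t n) + P₀.b n.1 (z n).1 (u n)) n₀ := by
    intro t u h1 h2
    simp only [(hs _).2]
    obtain ⟨-, -, -, c₁, -, -, cu⟩ := contMDiffAt_tuple.1 (contMDiffAt_isoT χ
      (b := fun n : N => n.1) ((contMDiffAt_tuple
      (f := fun n => (0, 0, (y n).2.1, t n, 0, 0, u n))).2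
      ⟨contMDiffAt_zero hb, contMDiffAt_zero hb, y₂, h1, contMDiffAt_zero hb, contMDiffAt_zero hb, h2⟩))
    exact (P₃.contMDiffAt y₀₂ c₁).add (P₀.contMDiffAt y₀ cu)
  refine (contMDiffAt_triple (b := fun n : N => n.1) (f := z)).2 ⟨?_, z₂, ?_⟩
  · refine contMDiffAt_of_pairing P₀ hb fun ξ hξ => ?_
    simpa only [map_zero, zero_add, add_zero] using main (fun _ => 0) (fun n => ξ n.1)
      (contMDiffAt_zero hb) (ContMDiffAt.comp n₀ hξ hb)
  · refine contMDiffAt_of_pairing P₃ hb fun ξ hξ => ?_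
    simpa only [map_zero, zero_add, add_zero] using main (fun n => ξ n.1) (fun _ => 0)
      (ContMDiffAt.comp n₀ hξ hb) (contMDiffAt_zero hb)

end DualSmooth

section DualTVB

section

variable {V₁ V₂ V₃ V₁₂ V₁₃ V₂₃ V₁₂₃ : Type} [AddCommGroup V₁] [Module ℝ V₁] [AddCommGroup V₂]
  [Module ℝ V₂] [AddCommGroup V₃] [Module ℝ V₃] [AddCommGroup V₁₂] [Module ℝ V₁₂]
  [AddCommGroup V₁₃] [Module ℝ V₁₃] [AddCommGroup V₂₃] [Module ℝ V₂₃] [AddCommGroup V₁₂₃]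
  [Module ℝ V₁₂₃] {E F G : TVS V₁ V₂ V₃ V₁₂ V₁₃ V₂₃ V₁₂₃}

theorem cT_conj {E' : TVS V₁ V₂ V₃ V₁₂ V₁₃ V₂₃ V₁₂₃} (φ : E.Iso E') (ψ : E.Iso F) (φ' : F.Iso G)
    (Ψ : G.dT) : φ.cT ((φ.symm.trans (ψ.trans φ')).cT Ψ) = ψ.cT (φ'.cT Ψ) :=
  φ.cT.apply_symm_apply (ψ.cT (φ'.cT Ψ))

theorem c₁₂_conj {E' : TVS V₁ V₂ V₃ V₁₂ V₁₃ V₂₃ V₁₂₃} (φ : E.Iso E') (ψ : E.Iso F) (φ' : F.Iso G)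
    (Ψ : G.d₁₂) : φ.c₁₂ ((φ.symm.trans (ψ.trans φ')).c₁₂ Ψ) = ψ.c₁₂ (φ'.c₁₂ Ψ) :=
  φ.c₁₂.apply_symm_apply (ψ.c₁₂ (φ'.c₁₂ Ψ))

theorem c₁₃_conj {E' : TVS V₁ V₂ V₃ V₁₂ V₁₃ V₂₃ V₁₂₃} (φ : E.Iso E') (ψ : E.Iso F) (φ' : F.Iso G)
    (Ψ : G.d₁₃) : φ.c₁₃ ((φ.symm.trans (ψ.trans φ')).c₁₃ Ψ) = ψ.c₁₃ (φ'.c₁₃ Ψ) :=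
  φ.c₁₃.apply_symm_apply (ψ.c₁₃ (φ'.c₁₃ Ψ))

end

theorem IsDiffeo.congr {S S' : Type} {A : SmoothStr S} {B : SmoothStr S'} {f g : S ≃ S'}
    (h : IsDiffeo A B f) (e : ∀ x, f x = g x) : IsDiffeo A B g := by
  rwa [← Equiv.ext e]

variable {M : Base} {V₁ V₂ V₃ V₁₂ V₁₃ V₂₃ V₁₂₃ V₀ V₀₂ V₀₃ V₀₂₃ : VecBdl M}

local notation "𝔓" => PreTVB.dec V₁ V₂ V₃ V₁₂ V₁₃ V₂₃ V₁₂₃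
local notation "𝔓'" => PreTVB.dec V₀ V₂ V₃ V₀₂ V₀₃ V₂₃ V₀₂₃

variable (P₀ : SmoothPairing V₀ V₁₂₃) (P₂ : SmoothPairing V₀₂ V₁₃) (P₃ : SmoothPairing V₀₃ V₁₂)
  (P₁ : SmoothPairing V₀₂₃ V₁)

theorem diffeo_dT (χ : PreTVB.Iso 𝔓 𝔓) : IsDiffeo (𝔓').sT (𝔓').sT (tot (dT P₀ P₂ P₃ P₁ χ)) :=
  ⟨smooth_dT P₀ P₂ P₃ P₁ χ, smooth_dT P₀ P₂ P₃ P₁ χ.symm⟩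

theorem diffeo_d₁₂ (χ : PreTVB.Iso 𝔓 𝔓) : IsDiffeo (𝔓').s₁₂ (𝔓').s₁₂ (tot (d₁₂ P₀ P₂ χ)) :=
  ⟨smooth_d₁₂ P₀ P₂ χ, smooth_d₁₂ P₀ P₂ χ.symm⟩

theorem diffeo_d₁₃ (χ : PreTVB.Iso 𝔓 𝔓) : IsDiffeo (𝔓').s₁₃ (𝔓').s₁₃ (tot (d₁₃ P₀ P₃ χ)) :=
  ⟨smooth_d₁₃ P₀ P₃ χ, smooth_d₁₃ P₀ P₃ χ.symm⟩

/-- A splitting. -/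
def TVB.decomp (E : TVB V₁ V₂ V₃ V₁₂ V₁₃ V₂₃ V₁₂₃) : E.toPreTVB.Iso 𝔓 := Classical.choice E.split

/-- The dual of a triple vector bundle is well-defined. -/
theorem TVB.good (E : TVB V₁ V₂ V₃ V₁₂ V₁₃ V₂₃ V₁₂₃) (m : M.pt) :
    (E.fibre m).Good (P₀.b m) (P₂.b m) (P₃.b m) (P₁.b m) :=
  TVS.Good.of_iso (E.decomp.iso m)
    (dec_good (P₀.perfect m) (P₂.perfect m) (P₃.perfect m) (P₁.perfect m))

/-- The splitting of the dual induced by a splitting of `E`. -/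
def TVB.dualDec (E : TVB V₁ V₂ V₃ V₁₂ V₁₃ V₂₃ V₁₂₃) (m : M.pt) :
    ((𝔓').fibre m).Iso ((E.fibre m).dualX (P₀.b m) (P₂.b m) (P₃.b m) (P₁.b m)) :=
  (decDual (P₀.b m) (P₂.b m) (P₃.b m) (P₁.b m) (P₀.perfect m) (P₂.perfect m) (P₃.perfect m)
    (P₁.perfect m)).trans
    ((E.decomp.iso m).dualX (dec_good (P₀.perfect m) (P₂.perfect m) (P₃.perfect m) (P₁.perfect m)))

/-- The `X`-dual of a triple vector bundle. -/
def TVB.dualX (E : TVB V₁ V₂ V₃ V₁₂ V₁₃ V₂₃ V₁₂₃) : TVB V₀ V₂ V₃ V₀₂ V₀₃ V₂₃ V₀₂₃ where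
  fibre m := (E.fibre m).dualX (P₀.b m) (P₂.b m) (P₃.b m) (P₁.b m)
  s₁₂ := (𝔓').s₁₂.pullback (tot fun m => (E.dualDec P₀ P₂ P₃ P₁ m).symm.i₁₂.e)
  s₁₃ := (𝔓').s₁₃.pullback (tot fun m => (E.dualDec P₀ P₂ P₃ P₁ m).symm.i₁₃.e)
  s₂₃ := E.s₂₃
  sT := (𝔓').sT.pullback (tot fun m => (E.dualDec P₀ P₂ P₃ P₁ m).symm.e)
  split := ⟨fun m => (E.dualDec P₀ P₂ P₃ P₁ m).symm, .pullback _ _, .pullback _ _,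
    E.decomp.smooth₂₃, .pullback _ _⟩

/-- The `X`-dual of a statomorphism. -/
def TVB.dualXMap {E F : TVB V₁ V₂ V₃ V₁₂ V₁₃ V₂₃ V₁₂₃} (ψ : E.toPreTVB.Iso F.toPreTVB) :
    (F.dualX P₀ P₂ P₃ P₁).toPreTVB.Iso (E.dualX P₀ P₂ P₃ P₁).toPreTVB where
  iso m := (ψ.iso m).dualX (F.good P₀ P₂ P₃ P₁ m)
  smooth₁₂ := by
    have h := ((IsDiffeo.pullback (𝔓').s₁₂ (tot fun m => (F.dualDec P₀ P₂ P₃ P₁ m).symm.i₁₂.e)).trans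
      (diffeo_d₁₂ P₀ P₂ (E.decomp.symm.trans (ψ.trans F.decomp)))).trans
      (IsDiffeo.pullback (𝔓').s₁₂ (tot fun m => (E.dualDec P₀ P₂ P₃ P₁ m).symm.i₁₂.e)).symm
    refine h.congr fun ⟨m, Ψ⟩ => congrArg (Sigma.mk m) ?_
    obtain ⟨y, rfl⟩ := (F.dualDec P₀ P₂ P₃ P₁ m).i₁₂.e.surjective Ψ
    refine (congrArg (fun z => (E.dualDec P₀ P₂ P₃ P₁ m).i₁₂.e (d₁₂ P₀ P₂ _ m z))
      (Equiv.symm_apply_apply _ y)).trans ?_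
    refine (congrArg (E.decomp.iso m).c₁₂ (Equiv.apply_symm_apply (tup₁₂E (P₀.b m) (P₂.b m) (P₀.perfect m) (P₂.perfect m)) _)).trans ?_
    exact c₁₂_conj _ _ _ _
  smooth₁₃ := by
    have h := ((IsDiffeo.pullback (𝔓').s₁₃ (tot fun m => (F.dualDec P₀ P₂ P₃ P₁ m).symm.i₁₃.e)).trans
      (diffeo_d₁₃ P₀ P₃ (E.decomp.symm.trans (ψ.trans F.decomp)))).trans
      (IsDiffeo.pullback (𝔓').s₁₃ (tot fun m => (E.dualDec P₀ P₂ P₃ P₁ m).symm.i₁₃.e)).symm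
    refine h.congr fun ⟨m, Ψ⟩ => congrArg (Sigma.mk m) ?_
    obtain ⟨y, rfl⟩ := (F.dualDec P₀ P₂ P₃ P₁ m).i₁₃.e.surjective Ψ
    refine (congrArg (fun z => (E.dualDec P₀ P₂ P₃ P₁ m).i₁₃.e (d₁₃ P₀ P₃ _ m z))
      (Equiv.symm_apply_apply _ y)).trans ?_
    refine (congrArg (E.decomp.iso m).c₁₃ (Equiv.apply_symm_apply (tup₁₃E (P₀.b m) (P₃.b m) (P₀.perfect m) (P₃.perfect m)) _)).trans ?_
    exact c₁₃_conj _ _ _ _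
  smooth₂₃ := ψ.smooth₂₃.symm
  smoothT := by
    have h := ((IsDiffeo.pullback (𝔓').sT (tot fun m => (F.dualDec P₀ P₂ P₃ P₁ m).symm.e)).trans
      (diffeo_dT P₀ P₂ P₃ P₁ (E.decomp.symm.trans (ψ.trans F.decomp)))).trans
      (IsDiffeo.pullback (𝔓').sT (tot fun m => (E.dualDec P₀ P₂ P₃ P₁ m).symm.e)).symm
    refine h.congr fun ⟨m, Ψ⟩ => congrArg (Sigma.mk m) ?_
    obtain ⟨y, rfl⟩ := (F.dualDec P₀ P₂ P₃ P₁ m).e.surjective Ψ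
    refine (congrArg (fun z => (E.dualDec P₀ P₂ P₃ P₁ m).e (dT P₀ P₂ P₃ P₁ _ m z))
      (Equiv.symm_apply_apply _ y)).trans ?_
    refine (congrArg (E.decomp.iso m).cT (Equiv.apply_symm_apply (tupTE (P₀.b m) (P₂.b m) (P₃.b m) (P₁.b m)
      (P₀.perfect m) (P₂.perfect m) (P₃.perfect m) (P₁.perfect m)) _)).trans ?_
    exact cT_conj _ _ _ _

end DualTVB

/-- A triple vector bundle satisfies, over every point, all the axioms of a triple vector bundle: the
splitting condition implies them. -/
theorem TVB.lawful {M : Base} {V₁ V₂ V₃ V₁₂ V₁₃ V₂₃ V₁₂₃ : VecBdl M}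
    (E : TVB V₁ V₂ V₃ V₁₂ V₁₃ V₂₃ V₁₂₃) (m : M.pt) : (E.fibre m).Lawful :=
  .of_iso (E.decomp.iso m) .dec

section Flips

theorem SmoothStr.smooth_flip {M : Base} (A B C : VecBdl M) :
    (A.prod (B.prod C)).str.Smooth (B.prod (A.prod C)).str
      (fun p : Σ m, A.fib m × B.fib m × C.fib m => ⟨p.1, (p.2.2.1, p.2.1, p.2.2.2)⟩) := by
  let N := (A.prod (B.prod C)).Tot
  suffices h : ∀ n₀ : N, ContMDiffAt (A.prod (B.prod C)).I (B.prod (A.prod C)).I ∞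
      (fun n : N => (⟨n.1, (n.2.2.1, n.2.1, n.2.2.2)⟩ : (B.prod (A.prod C)).Tot)) n₀ from h
  intro n₀
  obtain ⟨h1, h2, h3⟩ := (contMDiffAt_triple (J := (A.prod (B.prod C)).I) (b := fun n : N => n.1)
    (f := fun n : N => n.2) (n₀ := n₀)).1 contMDiffAt_id
  exact contMDiffAt_triple.2 ⟨h2, h1, h3⟩

abbrev flipE (A B C : Type) : A × B × C ≃ B × A × C :=
  ⟨fun p => (p.2.1, p.1, p.2.2), fun p => (p.2.1, p.1, p.2.2), fun _ => rfl, fun _ => rfl⟩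

theorem diffeo_flip {M : Base} (A B C : VecBdl M) :
    IsDiffeo (A.prod (B.prod C)).str (B.prod (A.prod C)).str
      (tot fun m => flipE (A.fib m) (B.fib m) (C.fib m)) :=
  ⟨SmoothStr.smooth_flip A B C, SmoothStr.smooth_flip B A C⟩

def DVS.decFlip (A B C : Type) [AddCommGroup A] [Module ℝ A] [AddCommGroup B] [Module ℝ B]
    [AddCommGroup C] [Module ℝ C] : (DVS.dec A B C).flip.Iso (DVS.dec B A C) where
  e := flipE A B C
  homA := ⟨fun _ => rfl, fun _ _ _ => rfl, fun _ _ => rfl⟩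
  homB := ⟨fun _ => rfl, fun _ _ _ => rfl, fun _ _ => rfl⟩
  core _ := rfl

section

variable (V₁ V₂ V₃ V₁₂ V₁₃ V₂₃ V₁₂₃ : Type) [AddCommGroup V₁] [Module ℝ V₁] [AddCommGroup V₂]
  [Module ℝ V₂] [AddCommGroup V₃] [Module ℝ V₃] [AddCommGroup V₁₂] [Module ℝ V₁₂]
  [AddCommGroup V₁₃] [Module ℝ V₁₃] [AddCommGroup V₂₃] [Module ℝ V₂₃] [AddCommGroup V₁₂₃]
  [Module ℝ V₁₂₃]

def TVS.decFlip₁₂ : (TVS.dec V₁ V₂ V₃ V₁₂ V₁₃ V₂₃ V₁₂₃).flip₁₂.Iso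
    (TVS.dec V₂ V₁ V₃ V₁₂ V₂₃ V₁₃ V₁₂₃) where
  i₁₂ := DVS.decFlip V₁ V₂ V₁₂
  i₁₃ := .refl _
  i₂₃ := .refl _
  e := ⟨fun (e₁, e₂, e₃, e₁₂, e₁₃, e₂₃, u) => (e₂, e₁, e₃, e₁₂, e₂₃, e₁₃, u),
    fun (e₂, e₁, e₃, e₁₂, e₂₃, e₁₃, u) => (e₁, e₂, e₃, e₁₂, e₁₃, e₂₃, u), fun _ => rfl, fun _ => rfl⟩
  hom₁₂ := ⟨fun _ => rfl, fun _ _ _ => rfl, fun _ _ => rfl⟩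
  hom₁₃ := ⟨fun _ => rfl, fun _ _ _ => rfl, fun _ _ => rfl⟩
  hom₂₃ := ⟨fun _ => rfl, fun _ _ _ => rfl, fun _ _ => rfl⟩
  core _ := rfl

def TVS.decFlip₁₃ : (TVS.dec V₁ V₂ V₃ V₁₂ V₁₃ V₂₃ V₁₂₃).flip₁₃.Iso
    (TVS.dec V₃ V₂ V₁ V₂₃ V₁₃ V₁₂ V₁₂₃) where
  i₁₂ := DVS.decFlip V₂ V₃ V₂₃
  i₁₃ := DVS.decFlip V₁ V₃ V₁₃
  i₂₃ := DVS.decFlip V₁ V₂ V₁₂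
  e := ⟨fun (e₁, e₂, e₃, e₁₂, e₁₃, e₂₃, u) => (e₃, e₂, e₁, e₂₃, e₁₃, e₁₂, u),
    fun (e₃, e₂, e₁, e₂₃, e₁₃, e₁₂, u) => (e₁, e₂, e₃, e₁₂, e₁₃, e₂₃, u), fun _ => rfl, fun _ => rfl⟩
  hom₁₂ := ⟨fun _ => rfl, fun _ _ _ => rfl, fun _ _ => rfl⟩
  hom₁₃ := ⟨fun _ => rfl, fun _ _ _ => rfl, fun _ _ => rfl⟩
  hom₂₃ := ⟨fun _ => rfl, fun _ _ _ => rfl, fun _ _ => rfl⟩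
  core _ := rfl

end

variable {M : Base} {V₁ V₂ V₃ V₁₂ V₁₃ V₂₃ V₁₂₃ : VecBdl M}

variable (V₁ V₂ V₃ V₁₂ V₁₃ V₂₃ V₁₂₃) in
theorem smooth_flipT₁₂ : (BT V₁ V₂ V₃ V₁₂ V₁₃ V₂₃ V₁₂₃).str.Smooth
    (BT V₂ V₁ V₃ V₁₂ V₂₃ V₁₃ V₁₂₃).str (tot fun m => (TVS.decFlip₁₂ (V₁.fib m) (V₂.fib m)
      (V₃.fib m) (V₁₂.fib m) (V₁₃.fib m) (V₂₃.fib m) (V₁₂₃.fib m)).e) := by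
  let N := (BT V₁ V₂ V₃ V₁₂ V₁₃ V₂₃ V₁₂₃).Tot
  let f : ∀ n : N, FT V₁ V₂ V₃ V₁₂ V₁₃ V₂₃ V₁₂₃ n.1 := fun n => n.2
  suffices h : ∀ n₀ : N, ContMDiffAt (BT V₁ V₂ V₃ V₁₂ V₁₃ V₂₃ V₁₂₃).I
      (BT V₂ V₁ V₃ V₁₂ V₂₃ V₁₃ V₁₂₃).I ∞
      (fun n : N => (⟨n.1, ((f n).2.1, (f n).1, (f n).2.2.1, (f n).2.2.2.1, (f n).2.2.2.2.2.1,
        (f n).2.2.2.2.1, (f n).2.2.2.2.2.2)⟩ : (BT V₂ V₁ V₃ V₁₂ V₂₃ V₁₃ V₁₂₃).Tot)) n₀ from h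
  intro n₀
  obtain ⟨h1, h2, h3, h4, h5, h6, h7⟩ := (contMDiffAt_tuple
    (J := (BT V₁ V₂ V₃ V₁₂ V₁₃ V₂₃ V₁₂₃).I) (b := fun n : N => n.1) (f := f) (n₀ := n₀)).1
    contMDiffAt_id
  exact contMDiffAt_tuple.2 ⟨h2, h1, h3, h4, h6, h5, h7⟩

variable (V₁ V₂ V₃ V₁₂ V₁₃ V₂₃ V₁₂₃) in
theorem smooth_flipT₁₃ : (BT V₁ V₂ V₃ V₁₂ V₁₃ V₂₃ V₁₂₃).str.Smooth
    (BT V₃ V₂ V₁ V₂₃ V₁₃ V₁₂ V₁₂₃).str (tot fun m => (TVS.decFlip₁₃ (V₁.fib m) (V₂.fib m)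
      (V₃.fib m) (V₁₂.fib m) (V₁₃.fib m) (V₂₃.fib m) (V₁₂₃.fib m)).e) := by
  let N := (BT V₁ V₂ V₃ V₁₂ V₁₃ V₂₃ V₁₂₃).Tot
  let f : ∀ n : N, FT V₁ V₂ V₃ V₁₂ V₁₃ V₂₃ V₁₂₃ n.1 := fun n => n.2
  suffices h : ∀ n₀ : N, ContMDiffAt (BT V₁ V₂ V₃ V₁₂ V₁₃ V₂₃ V₁₂₃).I
      (BT V₃ V₂ V₁ V₂₃ V₁₃ V₁₂ V₁₂₃).I ∞
      (fun n : N => (⟨n.1, ((f n).2.2.1, (f n).2.1, (f n).1, (f n).2.2.2.2.2.1, (f n).2.2.2.2.1,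
        (f n).2.2.2.1, (f n).2.2.2.2.2.2)⟩ : (BT V₃ V₂ V₁ V₂₃ V₁₃ V₁₂ V₁₂₃).Tot)) n₀ from h
  intro n₀
  obtain ⟨h1, h2, h3, h4, h5, h6, h7⟩ := (contMDiffAt_tuple
    (J := (BT V₁ V₂ V₃ V₁₂ V₁₃ V₂₃ V₁₂₃).I) (b := fun n : N => n.1) (f := f) (n₀ := n₀)).1
    contMDiffAt_id
  exact contMDiffAt_tuple.2 ⟨h3, h2, h1, h6, h5, h4, h7⟩

def PreTVB.flip₁₂ (E : PreTVB V₁ V₂ V₃ V₁₂ V₁₃ V₂₃ V₁₂₃) : PreTVB V₂ V₁ V₃ V₁₂ V₂₃ V₁₃ V₁₂₃ where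
  fibre m := (E.fibre m).flip₁₂
  s₁₂ := E.s₁₂
  s₁₃ := E.s₂₃
  s₂₃ := E.s₁₃
  sT := E.sT

def PreTVB.flip₁₃ (E : PreTVB V₁ V₂ V₃ V₁₂ V₁₃ V₂₃ V₁₂₃) : PreTVB V₃ V₂ V₁ V₂₃ V₁₃ V₁₂ V₁₂₃ where
  fibre m := (E.fibre m).flip₁₃
  s₁₂ := E.s₂₃
  s₁₃ := E.s₁₃
  s₂₃ := E.s₁₂
  sT := E.sT

def PreTVB.Iso.flip₁₂ {E F : PreTVB V₁ V₂ V₃ V₁₂ V₁₃ V₂₃ V₁₂₃} (φ : E.Iso F) :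
    E.flip₁₂.Iso F.flip₁₂ :=
  ⟨fun m => (φ.iso m).flip₁₂, φ.smooth₁₂, φ.smooth₂₃, φ.smooth₁₃, φ.smoothT⟩

def PreTVB.Iso.flip₁₃ {E F : PreTVB V₁ V₂ V₃ V₁₂ V₁₃ V₂₃ V₁₂₃} (φ : E.Iso F) :
    E.flip₁₃.Iso F.flip₁₃ :=
  ⟨fun m => (φ.iso m).flip₁₃, φ.smooth₂₃, φ.smooth₁₃, φ.smooth₁₂, φ.smoothT⟩

variable (V₁ V₂ V₃ V₁₂ V₁₃ V₂₃ V₁₂₃) in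
def PreTVB.decFlip₁₂ : (PreTVB.dec V₁ V₂ V₃ V₁₂ V₁₃ V₂₃ V₁₂₃).flip₁₂.Iso
    (PreTVB.dec V₂ V₁ V₃ V₁₂ V₂₃ V₁₃ V₁₂₃) :=
  ⟨fun _ => TVS.decFlip₁₂ _ _ _ _ _ _ _, diffeo_flip V₁ V₂ V₁₂, .refl _, .refl _,
    smooth_flipT₁₂ V₁ V₂ V₃ V₁₂ V₁₃ V₂₃ V₁₂₃, smooth_flipT₁₂ V₂ V₁ V₃ V₁₂ V₂₃ V₁₃ V₁₂₃⟩

variable (V₁ V₂ V₃ V₁₂ V₁₃ V₂₃ V₁₂₃) in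
def PreTVB.decFlip₁₃ : (PreTVB.dec V₁ V₂ V₃ V₁₂ V₁₃ V₂₃ V₁₂₃).flip₁₃.Iso
    (PreTVB.dec V₃ V₂ V₁ V₂₃ V₁₃ V₁₂ V₁₂₃) :=
  ⟨fun _ => TVS.decFlip₁₃ _ _ _ _ _ _ _, diffeo_flip V₂ V₃ V₂₃, diffeo_flip V₁ V₃ V₁₃,
    diffeo_flip V₁ V₂ V₁₂,
    smooth_flipT₁₃ V₁ V₂ V₃ V₁₂ V₁₃ V₂₃ V₁₂₃, smooth_flipT₁₃ V₃ V₂ V₁ V₂₃ V₁₃ V₁₂ V₁₂₃⟩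

def TVB.flip₁₂ (E : TVB V₁ V₂ V₃ V₁₂ V₁₃ V₂₃ V₁₂₃) : TVB V₂ V₁ V₃ V₁₂ V₂₃ V₁₃ V₁₂₃ where
  toPreTVB := E.toPreTVB.flip₁₂
  split := E.split.map fun φ => φ.flip₁₂.trans (PreTVB.decFlip₁₂ _ _ _ _ _ _ _)

def TVB.flip₁₃ (E : TVB V₁ V₂ V₃ V₁₂ V₁₃ V₂₃ V₁₂₃) : TVB V₃ V₂ V₁ V₂₃ V₁₃ V₁₂ V₁₂₃ where
  toPreTVB := E.toPreTVB.flip₁₃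
  split := E.split.map fun φ => φ.flip₁₃.trans (PreTVB.decFlip₁₃ _ _ _ _ _ _ _)

end Flips

section Functors

open CategoryTheory

variable {M : Base} {V₁ V₂ V₃ V₁₂ V₁₃ V₂₃ V₁₂₃ V₀ V₀₂ V₀₃ V₀₂₃ : VecBdl M}

/-- Triple vector bundles with given building bundles form a groupoid under statomorphisms. -/
instance : Groupoid (TVB V₁ V₂ V₃ V₁₂ V₁₃ V₂₃ V₁₂₃) where
  Hom E F := E.toPreTVB.Iso F.toPreTVB
  id _ := .refl _
  comp φ ψ := φ.trans ψ
  inv φ := φ.symm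
  id_comp _ := rfl
  comp_id _ := rfl
  assoc _ _ _ := rfl
  inv_comp φ := PreTVB.Iso.ext' fun m => TVS.Iso.ext'
    (fun x => (φ.iso m).i₁₂.e.apply_symm_apply x) (fun x => (φ.iso m).i₁₃.e.apply_symm_apply x)
    (fun x => (φ.iso m).i₂₃.e.apply_symm_apply x) (fun x => (φ.iso m).e.apply_symm_apply x)
  comp_inv φ := PreTVB.Iso.ext' fun m => TVS.Iso.ext'
    (fun x => (φ.iso m).i₁₂.e.symm_apply_apply x) (fun x => (φ.iso m).i₁₃.e.symm_apply_apply x)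
    (fun x => (φ.iso m).i₂₃.e.symm_apply_apply x) (fun x => (φ.iso m).e.symm_apply_apply x)

/-- Exchange of the axes 1 and 2. -/
def flip₁₂Functor : TVB V₁ V₂ V₃ V₁₂ V₁₃ V₂₃ V₁₂₃ ⥤ TVB V₂ V₁ V₃ V₁₂ V₂₃ V₁₃ V₁₂₃ where
  obj E := E.flip₁₂
  map φ := PreTVB.Iso.flip₁₂ φ
  map_id _ := rfl
  map_comp _ _ := rfl

/-- Exchange of the axes 1 and 3. -/
def flip₁₃Functor : TVB V₁ V₂ V₃ V₁₂ V₁₃ V₂₃ V₁₂₃ ⥤ TVB V₃ V₂ V₁ V₂₃ V₁₃ V₁₂ V₁₂₃ where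
  obj E := E.flip₁₃
  map φ := PreTVB.Iso.flip₁₃ φ
  map_id _ := rfl
  map_comp _ _ := rfl

variable (P₀ : SmoothPairing V₀ V₁₂₃) (P₂ : SmoothPairing V₀₂ V₁₃) (P₃ : SmoothPairing V₀₃ V₁₂)
  (P₁ : SmoothPairing V₀₂₃ V₁)

/-- Dualization along the axis 1, a contravariant functor. -/
def dualXFunctor : TVB V₁ V₂ V₃ V₁₂ V₁₃ V₂₃ V₁₂₃ ⥤ (TVB V₀ V₂ V₃ V₀₂ V₀₃ V₂₃ V₀₂₃)ᵒᵖ where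
  obj E := Opposite.op (E.dualX P₀ P₂ P₃ P₁)
  map φ := Quiver.Hom.op (TVB.dualXMap P₀ P₂ P₃ P₁ φ :)
  map_id _ := rfl
  map_comp _ _ := rfl

end Functors

/-! ### Building bundles and the functors `X`, `Y`, `Z` -/

/-- Subsets of `{0, 1, 2, 3}`. -/
structure Four where
  c₀ : Bool
  c₁ : Bool
  c₂ : Bool
  c₃ : Bool

/-- Membership. -/
def Four.mem (l : Four) : Fin 4 → Bool
  | 0 => l.c₀
  | 1 => l.c₁
  | 2 => l.c₂
  | 3 => l.c₃

/-- The image of a subset under a permutation. -/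
def Four.perm (σ : Equiv.Perm (Fin 4)) (l : Four) : Four :=
  ⟨l.mem (σ.symm 0), l.mem (σ.symm 1), l.mem (σ.symm 2), l.mem (σ.symm 3)⟩

theorem Four.mem_perm (σ : Equiv.Perm (Fin 4)) (l : Four) (i : Fin 4) :
    (l.perm σ).mem i = l.mem (σ.symm i) := by
  fin_cases i <;> rfl

/-- Proper non-empty subsets of `{0, 1, 2, 3}`. -/
abbrev Lab : Type := {l : Four // (∃ i, l.mem i = true) ∧ ∃ i, l.mem i = false}

/-- The image of a proper non-empty subset under a permutation. -/
def Lab.perm (σ : Equiv.Perm (Fin 4)) (l : Lab) : Lab :=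
  ⟨l.1.perm σ, l.2.1.imp' σ (fun i h => by rw [Four.mem_perm]; simpa using h),
    l.2.2.imp' σ (fun i h => by rw [Four.mem_perm]; simpa using h)⟩

/-- `l'` is the complement of `l`. -/
def Lab.Opp (l l' : Lab) : Prop := ∀ i, l'.1.mem i = !l.1.mem i

theorem Lab.Opp.perm {l l' : Lab} (h : l.Opp l') (σ : Equiv.Perm (Fin 4)) :
    (l.perm σ).Opp (l'.perm σ) := fun i => by
  change (l'.1.perm σ).mem i = !(l.1.perm σ).mem i
  rw [Four.mem_perm, Four.mem_perm, h]

/-- The subset with the given characteristic function. -/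
def Lab.mk (a b c d : Bool) (h : (∃ i, (Four.mk a b c d).mem i = true) ∧
    ∃ i, (Four.mk a b c d).mem i = false := by decide) : Lab := ⟨⟨a, b, c, d⟩, h⟩

abbrev I₀ : Lab := Lab.mk true false false false
abbrev I₁ : Lab := Lab.mk false true false false
abbrev I₂ : Lab := Lab.mk false false true false
abbrev I₃ : Lab := Lab.mk false false false true
abbrev I₀₁ : Lab := Lab.mk true true false false
abbrev I₀₂ : Lab := Lab.mk true false true false
abbrev I₀₃ : Lab := Lab.mk true false false true
abbrev I₁₂ : Lab := Lab.mk false true true false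
abbrev I₁₃ : Lab := Lab.mk false true false true
abbrev I₂₃ : Lab := Lab.mk false false true true
abbrev I₀₁₂ : Lab := Lab.mk true true true false
abbrev I₀₁₃ : Lab := Lab.mk true true false true
abbrev I₀₂₃ : Lab := Lab.mk true false true true
abbrev I₁₂₃ : Lab := Lab.mk false true true true

/-- A system of building bundles: vector bundles `E_I` over `M` for all proper non-empty subsets `I` of
`{0, 1, 2, 3}`, with `E_I` identified with the dual of `E_J` for complementary `I` and `J`, compatibly
with the canonical isomorphism between a bundle and its second dual. So `E₀, E₀₁, …, E₀₂₃` are the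
duals of `E₁₂₃, E₂₃, …, E₁`. -/
structure Building where
  base : Base
  bundle : Lab → VecBdl base
  pair : ∀ l l' : Lab, l.Opp l' → SmoothPairing (bundle l) (bundle l')
  pair_symm : ∀ (l l' : Lab) (h : l.Opp l') (h' : l'.Opp l) (m : base.pt) (v : (bundle l).fib m)
    (w : (bundle l').fib m), (pair l l' h).b m v w = (pair l' l h').b m w v

/-- Relabelling of the building bundles: `E_I` is replaced by `E_{σ(I)}`. -/
def Building.perm (B : Building) (σ : Equiv.Perm (Fin 4)) : Building where
  base := B.base
  bundle l := B.bundle (l.perm σ)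
  pair _ _ h := B.pair _ _ (h.perm σ)
  pair_symm _ _ h h' := B.pair_symm _ _ (h.perm σ) (h'.perm σ)

/-- Triple vector bundles whose building bundles are the members of `B` with index
`1, 2, 3, 12, 13, 23, 123`. -/
abbrev Building.TVB (B : Building) : Type 1 :=
  TripleVB.TVB (B.bundle I₁) (B.bundle I₂) (B.bundle I₃) (B.bundle I₁₂) (B.bundle I₁₃)
    (B.bundle I₂₃) (B.bundle I₁₂₃)

open CategoryTheory Equiv

/-- The category of triple vector bundles, over all bases and with all building bundles. Its morphisms
are the statomorphisms. -/
abbrev TripleVectorBundle : Type 1 := Σ B : Building, B.TVB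

/-- `X` on the triple vector bundles with given building bundles: the dual over `E₂₃`. The contravariant
functor is made covariant by inverting statomorphisms. -/
def dualXOn (B : Building) : B.TVB ⥤ (B.perm (swap 0 1)).TVB :=
  dualXFunctor (B.pair I₀ I₁₂₃ (by unfold Lab.Opp; decide)) (B.pair I₀₂ I₁₃ (by unfold Lab.Opp; decide))
    (B.pair I₀₃ I₁₂ (by unfold Lab.Opp; decide)) (B.pair I₀₂₃ I₁ (by unfold Lab.Opp; decide)) ⋙
    (Groupoid.invEquivalence _).inverse

/-- `Y` on the triple vector bundles with given building bundles: the dual over `E₁₃`. -/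
def dualYOn (B : Building) : B.TVB ⥤ (B.perm (swap 0 2)).TVB :=
  flip₁₂Functor ⋙
  dualXFunctor (B.pair I₀ I₁₂₃ (by unfold Lab.Opp; decide)) (B.pair I₀₁ I₂₃ (by unfold Lab.Opp; decide))
    (B.pair I₀₃ I₁₂ (by unfold Lab.Opp; decide)) (B.pair I₀₁₃ I₂ (by unfold Lab.Opp; decide)) ⋙
    (Groupoid.invEquivalence _).inverse ⋙ flip₁₂Functor

/-- `Z` on the triple vector bundles with given building bundles: the dual over `E₁₂`. -/
def dualZOn (B : Building) : B.TVB ⥤ (B.perm (swap 0 3)).TVB :=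
  flip₁₃Functor ⋙
  dualXFunctor (B.pair I₀ I₁₂₃ (by unfold Lab.Opp; decide)) (B.pair I₀₂ I₁₃ (by unfold Lab.Opp; decide))
    (B.pair I₀₁ I₂₃ (by unfold Lab.Opp; decide)) (B.pair I₀₁₂ I₃ (by unfold Lab.Opp; decide)) ⋙
    (Groupoid.invEquivalence _).inverse ⋙ flip₁₃Functor

/-- The dualization functor along the axis 1. -/
def X : TripleVectorBundle ⥤ TripleVectorBundle := Sigma.desc fun B => dualXOn B ⋙ Sigma.incl (B.perm (swap 0 1))
/-- The dualization functor along the axis 2. -/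
def Y : TripleVectorBundle ⥤ TripleVectorBundle := Sigma.desc fun B => dualYOn B ⋙ Sigma.incl (B.perm (swap 0 2))
/-- The dualization functor along the axis 3. -/
def Z : TripleVectorBundle ⥤ TripleVectorBundle := Sigma.desc fun B => dualZOn B ⋙ Sigma.incl (B.perm (swap 0 3))

/-- Functors from triple vector bundles to triple vector bundles, modulo natural isomorphism. As the
morphisms of `TripleVectorBundle` are the statomorphisms, these are natural isomorphisms through
statomorphisms. -/
def FunctorClass : Type 1 :=
  Quotient (isIsomorphicSetoid (TripleVectorBundle ⥤ TripleVectorBundle))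

/-- The class `[F]` of a functor. -/
def FunctorClass.of (F : TripleVectorBundle ⥤ TripleVectorBundle) : FunctorClass :=
  Quotient.mk _ F

theorem FunctorClass.of_eq {F G : TripleVectorBundle ⥤ TripleVectorBundle} :
    FunctorClass.of F = FunctorClass.of G ↔ Nonempty (F ≅ G) :=
  Quotient.eq

/-- Composition of functors, written from left to right: `[F] * [G]` is `E ↦ (E^F)^G`. -/
instance : Monoid FunctorClass where
  mul := Quotient.map₂ (fun F G => F ⋙ G)
    fun _ _ h _ _ k => h.elim fun h => k.elim fun k => ⟨NatIso.hcomp h k⟩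
  one := .of (𝟭 TripleVectorBundle)
  mul_assoc := by
    rintro ⟨F⟩ ⟨G⟩ ⟨H⟩
    exact Quotient.sound ⟨Functor.associator F G H⟩
  one_mul := by
    rintro ⟨F⟩
    exact Quotient.sound ⟨Functor.leftUnitor F⟩
  mul_one := by
    rintro ⟨F⟩
    exact Quotient.sound ⟨Functor.rightUnitor F⟩

theorem FunctorClass.of_mul (F G : TripleVectorBundle ⥤ TripleVectorBundle) :
    FunctorClass.of F * FunctorClass.of G = FunctorClass.of (F ⋙ G) := rfl

theorem FunctorClass.one_eq : (1 : FunctorClass) = FunctorClass.of (𝟭 TripleVectorBundle) := rfl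

/-- The group `DG₃`: the group generated by the classes of `X`, `Y` and `Z`, inside the group of
invertible classes of functors. -/
def DG₃ : Subgroup FunctorClassˣ :=
  Subgroup.closure {w | (w : FunctorClass) = .of X ∨ (w : FunctorClass) = .of Y ∨
    (w : FunctorClass) = .of Z}

end TripleVB

end

/-!
A triple vector bundle is isomorphic to the decomposed one with the same building bundles, so the
category is determined by the automorphism groups of the decomposed bundles. Such an automorphism
`χ` has six bilinear components `f₁₂, f₁₃, f₂₃, g₁, g₂, g₃` and one trilinear component `rho`, which
may be arbitrary smooth maps. The automorphism is unipotent, and `rho` is best replaced by the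
trilinear component `logRho = rho - (g₁ ∘ f₂₃ + g₂ ∘ f₁₃ + g₃ ∘ f₁₂) / 2` of its logarithm.

After pairing with the dual of its target, a bilinear component becomes a trilinear form on three
building bundles whose labels form a partition of `{0, 1, 2, 3}` with exactly one block of two
elements, and `logRho` becomes a form on `E₀ × E₁ × E₂ × E₃`. In these coordinates the dualization
along the axis `k`, with the inversion that makes it covariant, relabels the forms by the
transposition `(0 k)` and changes all signs except that of the form with label `{0, k}`
(`hasType_X`, `hasType_Y`, `hasType_Z`). Its composites act by signed permutations, which are called
types.

A functor with a type is determined by it up to isomorphism, because the coordinates separate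
automorphisms (`HasType.nonempty_iso`). Conversely a functor determines its permutation and its
signs on the two-element labels (`HasType.unique`): bilinear coordinates are additive, hence
invariant under conjugation, and over trivial line bundles on a point there is an automorphism whose
coordinates are distinguishable up to sign.

Thus the group in question is the group of signed permutations generated by three explicit
involutions. It maps onto `S₄`, as the transpositions `(0 k)` generate it. The signs satisfy
relations which are stable under composition (`SignedPerm.Admissible`); on the kernel these say that
`logRho` keeps its sign, that complementary labels have equal signs, and that the signs `s` satisfy
`s₀₁ * s₀₂ * s₀₃ = 1`. So there are at most four elements in the kernel, each of order at most two,
and the fourth powers of `XYZ` and `XZY` show that all four occur. The order is `4 * 24 = 96`.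
-/

noncomputable section

set_option linter.unusedSectionVars false

namespace TripleVB

/-! ### Statomorphisms of a decomposed triple vector bundle -/

section Components

variable {V₁ V₂ V₃ V₁₂ V₁₃ V₂₃ V₁₂₃ : Type} [AddCommGroup V₁] [Module ℝ V₁] [AddCommGroup V₂]
  [Module ℝ V₂] [AddCommGroup V₃] [Module ℝ V₃] [AddCommGroup V₁₂] [Module ℝ V₁₂]
  [AddCommGroup V₁₃] [Module ℝ V₁₃] [AddCommGroup V₂₃] [Module ℝ V₂₃] [AddCommGroup V₁₂₃]
  [Module ℝ V₁₂₃]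

/-- A statomorphism of a decomposed double vector bundle is `(a, b, c) ↦ (a, b, c + f (a, b))`. -/
theorem DVS.Iso.dec_apply {A B C : Type} [AddCommGroup A] [Module ℝ A] [AddCommGroup B] [Module ℝ B]
    [AddCommGroup C] [Module ℝ C] (χ : (DVS.dec A B C).Iso (DVS.dec A B C)) (a : A) (b : B) (c : C) :
    χ.e (a, b, c) = (a, b, c + (χ.e (a, b, 0)).2.2) := by
  have hA : ∀ x, (χ.e x).1 = x.1 := χ.homA.proj
  have hB : ∀ x, (χ.e x).2.1 = x.2.1 := χ.homB.proj
  have h0 := χ.homA.smul 0 (a, 0, 0)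
  have h1 := χ.homA.add (a, b, 0) (a, 0, c) rfl
  have h2 := χ.homB.add (a, 0, 0) (0, 0, c) rfl
  have h3 := χ.core c
  refine Prod.ext (hA _) (Prod.ext (hB _) ?_)
  simp only [smul_zero, zero_smul, add_zero, zero_add] at h0 h1 h2 h3
  rw [h1, h2, h3, h0]
  simp [add_comm]

variable (χ ψ : (TVS.dec V₁ V₂ V₃ V₁₂ V₁₃ V₂₃ V₁₂₃).Iso (TVS.dec V₁ V₂ V₃ V₁₂ V₁₃ V₂₃ V₁₂₃))

/-- The component `E₁ × E₂ → E₁₂` of a statomorphism. -/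
def TVS.Iso.f₁₂ (a : V₁) (b : V₂) : V₁₂ := (χ.i₁₂.e (a, b, 0)).2.2
/-- The component `E₁ × E₃ → E₁₃` of a statomorphism. -/
def TVS.Iso.f₁₃ (a : V₁) (c : V₃) : V₁₃ := (χ.i₁₃.e (a, c, 0)).2.2
/-- The component `E₂ × E₃ → E₂₃` of a statomorphism. -/
def TVS.Iso.f₂₃ (b : V₂) (c : V₃) : V₂₃ := (χ.i₂₃.e (b, c, 0)).2.2
/-- The component `E₁ × E₂₃ → E₁₂₃` of a statomorphism. -/
def TVS.Iso.g₁ (a : V₁) (x : V₂₃) : V₁₂₃ := (χ.e (a, 0, 0, 0, 0, x, 0)).2.2.2.2.2.2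
/-- The component `E₂ × E₁₃ → E₁₂₃` of a statomorphism. -/
def TVS.Iso.g₂ (b : V₂) (x : V₁₃) : V₁₂₃ := (χ.e (0, b, 0, 0, x, 0, 0)).2.2.2.2.2.2
/-- The component `E₃ × E₁₂ → E₁₂₃` of a statomorphism. -/
def TVS.Iso.g₃ (c : V₃) (x : V₁₂) : V₁₂₃ := (χ.e (0, 0, c, x, 0, 0, 0)).2.2.2.2.2.2
/-- The component `E₁ × E₂ × E₃ → E₁₂₃` of a statomorphism. -/
def TVS.Iso.rho (a : V₁) (b : V₂) (c : V₃) : V₁₂₃ := (χ.e (a, b, c, 0, 0, 0, 0)).2.2.2.2.2.2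
/-- The trilinear component of the logarithm of a statomorphism, which is a unipotent map. -/
def TVS.Iso.logRho (a : V₁) (b : V₂) (c : V₃) : V₁₂₃ :=
  χ.rho a b c - (1 / 2 : ℝ) •
    (χ.g₁ a (χ.f₂₃ b c) + χ.g₂ b (χ.f₁₃ a c) + χ.g₃ c (χ.f₁₂ a b))

theorem TVS.Iso.e_apply_fst (a b c x y z u) : (χ.e (a, b, c, x, y, z, u)) =
    (a, b, c, x + χ.f₁₂ a b, y + χ.f₁₃ a c, z + χ.f₂₃ b c,
      (χ.e (a, b, c, x, y, z, u)).2.2.2.2.2.2) := by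
  have h1 := (χ.hom₁₂.proj (a, b, c, x, y, z, u)).trans (χ.i₁₂.dec_apply a b x)
  have h2 := (χ.hom₁₃.proj (a, b, c, x, y, z, u)).trans (χ.i₁₃.dec_apply a c y)
  have h3 := (χ.hom₂₃.proj (a, b, c, x, y, z, u)).trans (χ.i₂₃.dec_apply b c z)
  generalize χ.e (a, b, c, x, y, z, u) = t at *
  obtain ⟨a', b', c', x', y', z', u'⟩ := t
  simp only [Prod.mk.injEq] at h1 h2 h3
  obtain ⟨rfl, rfl, rfl⟩ := h1
  obtain ⟨-, rfl, rfl⟩ := h2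
  obtain ⟨-, -, rfl⟩ := h3
  rfl

/-- The last component of a statomorphism. -/
def TVS.Iso.last (a : V₁) (b : V₂) (c : V₃) (x : V₁₂) (y : V₁₃) (z : V₂₃) (u : V₁₂₃) : V₁₂₃ :=
  (χ.e (a, b, c, x, y, z, u)).2.2.2.2.2.2

theorem TVS.Iso.last_add₁₂ (a b c x y z u c' y' z' u') :
    χ.last a b (c + c') x (y + y') (z + z') (u + u') =
    χ.last a b c x y z u + χ.last a b c' x y' z' u' := by
  have h := χ.hom₁₂.add (a, b, c, x, y, z, u) (a, b, c', x, y', z', u') rfl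
  rw [χ.e_apply_fst a b c, χ.e_apply_fst a b c'] at h
  exact congrArg (fun t => t.2.2.2.2.2.2) h

theorem TVS.Iso.last_add₁₃ (a b c x y z u b' x' z' u') :
    χ.last a (b + b') c (x + x') y (z + z') (u + u') =
    χ.last a b c x y z u + χ.last a b' c x' y z' u' := by
  have h := χ.hom₁₃.add (a, b, c, x, y, z, u) (a, b', c, x', y, z', u') rfl
  rw [χ.e_apply_fst a b c, χ.e_apply_fst a b' c] at h
  exact congrArg (fun t => t.2.2.2.2.2.2) h

theorem TVS.Iso.last_add₂₃ (a b c x y z u a' x' y' u') :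
    χ.last (a + a') b c (x + x') (y + y') z (u + u') =
    χ.last a b c x y z u + χ.last a' b c x' y' z u' := by
  have h := χ.hom₂₃.add (a, b, c, x, y, z, u) (a', b, c, x', y', z, u') rfl
  rw [χ.e_apply_fst a b c, χ.e_apply_fst a' b c] at h
  exact congrArg (fun t => t.2.2.2.2.2.2) h

theorem TVS.Iso.last_zero₁₂ (a b x) : χ.last a b 0 x 0 0 0 = 0 := by
  simpa using χ.last_add₁₂ a b 0 x 0 0 0 0 0 0 0

theorem TVS.Iso.last_zero₁₃ (a c y) : χ.last a 0 c 0 y 0 0 = 0 := by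
  simpa using χ.last_add₁₃ a 0 c 0 y 0 0 0 0 0 0

theorem TVS.Iso.last_zero₂₃ (b c z) : χ.last 0 b c 0 0 z 0 = 0 := by
  simpa using χ.last_add₂₃ 0 b c 0 0 z 0 0 0 0 0

theorem TVS.Iso.last_core (u) : χ.last 0 0 0 0 0 0 u = u :=
  congrArg (fun t => t.2.2.2.2.2.2) (χ.core u)

theorem TVS.Iso.last_apply (a b c x y z u) : χ.last a b c x y z u =
    u + χ.g₁ a z + χ.g₂ b y + χ.g₃ c x + χ.rho a b c := by
  change _ = u + χ.last a 0 0 0 0 z 0 + χ.last 0 b 0 0 y 0 0 + χ.last 0 0 c x 0 0 0 +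
    χ.last a b c 0 0 0 0
  have e₁ : χ.last a b c x y z u = χ.last a b c x 0 0 0 + χ.last a b 0 x y z u := by
    simpa using χ.last_add₁₂ a b c x 0 0 0 0 y z u
  have e₂ : χ.last a b c x 0 0 0 = χ.last a b c 0 0 0 0 + χ.last a 0 c x 0 0 0 := by
    simpa using χ.last_add₁₃ a b c 0 0 0 0 0 x 0 0
  have e₃ : χ.last a 0 c x 0 0 0 = χ.last a 0 c 0 0 0 0 + χ.last 0 0 c x 0 0 0 := by
    simpa using χ.last_add₂₃ a 0 c 0 0 0 0 0 x 0 0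
  have e₄ : χ.last a b 0 x y z u = χ.last a b 0 x y 0 0 + χ.last a b 0 x 0 z u := by
    simpa using χ.last_add₁₂ a b 0 x y 0 0 0 0 z u
  have e₅ : χ.last a b 0 x y 0 0 = χ.last a b 0 x 0 0 0 + χ.last 0 b 0 0 y 0 0 := by
    simpa using χ.last_add₂₃ a b 0 x 0 0 0 0 0 y 0
  have e₆ : χ.last a b 0 x 0 z u = χ.last a b 0 x 0 0 0 + χ.last a 0 0 0 0 z u := by
    simpa using χ.last_add₁₃ a b 0 x 0 0 0 0 0 z u
  have e₇ : χ.last a 0 0 0 0 z u = χ.last a 0 0 0 0 z 0 + χ.last a 0 0 0 0 0 u := by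
    simpa using χ.last_add₁₂ a 0 0 0 0 z 0 0 0 0 u
  have e₈ : χ.last a 0 0 0 0 0 u = χ.last a 0 0 0 0 0 0 + χ.last 0 0 0 0 0 0 u := by
    simpa using χ.last_add₂₃ a 0 0 0 0 0 0 0 0 0 u
  rw [e₁, e₂, e₃, e₄, e₅, e₆, e₇, e₈]
  simp only [last_zero₁₂, last_zero₁₃, last_core]
  abel

theorem TVS.Iso.e_apply (a b c x y z u) : χ.e (a, b, c, x, y, z, u) =
    (a, b, c, x + χ.f₁₂ a b, y + χ.f₁₃ a c, z + χ.f₂₃ b c,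
      u + χ.g₁ a z + χ.g₂ b y + χ.g₃ c x + χ.rho a b c) := by
  rw [χ.e_apply_fst]
  exact congrArg (fun t => (a, b, c, x + χ.f₁₂ a b, y + χ.f₁₃ a c, z + χ.f₂₃ b c, t))
    (χ.last_apply a b c x y z u)

theorem TVS.Iso.i₁₂_apply (a b x) : χ.i₁₂.e (a, b, x) = (a, b, x + χ.f₁₂ a b) := χ.i₁₂.dec_apply a b x
theorem TVS.Iso.i₁₃_apply (a c y) : χ.i₁₃.e (a, c, y) = (a, c, y + χ.f₁₃ a c) := χ.i₁₃.dec_apply a c y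
theorem TVS.Iso.i₂₃_apply (b c z) : χ.i₂₃.e (b, c, z) = (b, c, z + χ.f₂₃ b c) := χ.i₂₃.dec_apply b c z

theorem TVS.Iso.g₁_add (a z z') : χ.g₁ a (z + z') = χ.g₁ a z + χ.g₁ a z' := by
  change χ.last a 0 0 0 0 (z + z') 0 = χ.last a 0 0 0 0 z 0 + χ.last a 0 0 0 0 z' 0
  simpa using χ.last_add₁₂ a 0 0 0 0 z 0 0 0 z' 0
theorem TVS.Iso.g₂_add (b y y') : χ.g₂ b (y + y') = χ.g₂ b y + χ.g₂ b y' := by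
  change χ.last 0 b 0 0 (y + y') 0 0 = χ.last 0 b 0 0 y 0 0 + χ.last 0 b 0 0 y' 0 0
  simpa using χ.last_add₁₂ 0 b 0 0 y 0 0 0 y' 0 0
theorem TVS.Iso.g₃_add (c x x') : χ.g₃ c (x + x') = χ.g₃ c x + χ.g₃ c x' := by
  change χ.last 0 0 c (x + x') 0 0 0 = χ.last 0 0 c x 0 0 0 + χ.last 0 0 c x' 0 0 0
  simpa using χ.last_add₁₃ 0 0 c x 0 0 0 0 x' 0 0

theorem TVS.Iso.g₁_zero (a) : χ.g₁ a 0 = 0 := χ.last_zero₁₂ a 0 0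
theorem TVS.Iso.g₂_zero (b) : χ.g₂ b 0 = 0 := χ.last_zero₁₂ 0 b 0
theorem TVS.Iso.g₃_zero (c) : χ.g₃ c 0 = 0 := χ.last_zero₁₃ 0 c 0
theorem TVS.Iso.g₁_zero' (z) : χ.g₁ 0 z = 0 := χ.last_zero₂₃ 0 0 z
theorem TVS.Iso.g₂_zero' (y) : χ.g₂ 0 y = 0 := χ.last_zero₁₃ 0 0 y
theorem TVS.Iso.g₃_zero' (x) : χ.g₃ 0 x = 0 := χ.last_zero₁₂ 0 0 x
theorem TVS.Iso.rho_zero₁ (b c) : χ.rho 0 b c = 0 := χ.last_zero₂₃ b c 0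
theorem TVS.Iso.rho_zero₂ (a c) : χ.rho a 0 c = 0 := χ.last_zero₁₃ a c 0
theorem TVS.Iso.rho_zero₃ (a b) : χ.rho a b 0 = 0 := χ.last_zero₁₂ a b 0

theorem TVS.Iso.g₁_neg (a z) : χ.g₁ a (-z) = -χ.g₁ a z :=
  eq_neg_of_add_eq_zero_left (by rw [← g₁_add, neg_add_cancel, g₁_zero])
theorem TVS.Iso.g₂_neg (b y) : χ.g₂ b (-y) = -χ.g₂ b y :=
  eq_neg_of_add_eq_zero_left (by rw [← g₂_add, neg_add_cancel, g₂_zero])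
theorem TVS.Iso.g₃_neg (c x) : χ.g₃ c (-x) = -χ.g₃ c x :=
  eq_neg_of_add_eq_zero_left (by rw [← g₃_add, neg_add_cancel, g₃_zero])

theorem TVS.Iso.f₁₂_zero (a) : χ.f₁₂ a 0 = 0 :=
  congrArg (fun t => t.2.2) (by simpa using χ.i₁₂.homA.smul 0 (a, 0, 0) :
    χ.i₁₂.e (a, 0, 0) = ((χ.i₁₂.e (a, 0, 0)).1, 0, 0))
theorem TVS.Iso.f₁₂_zero' (b) : χ.f₁₂ 0 b = 0 :=
  congrArg (fun t => t.2.2) (by simpa using χ.i₁₂.homB.smul 0 (0, b, 0) :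
    χ.i₁₂.e (0, b, 0) = (0, (χ.i₁₂.e (0, b, 0)).2.1, 0))
theorem TVS.Iso.f₁₃_zero (a) : χ.f₁₃ a 0 = 0 :=
  congrArg (fun t => t.2.2) (by simpa using χ.i₁₃.homA.smul 0 (a, 0, 0) :
    χ.i₁₃.e (a, 0, 0) = ((χ.i₁₃.e (a, 0, 0)).1, 0, 0))
theorem TVS.Iso.f₁₃_zero' (b) : χ.f₁₃ 0 b = 0 :=
  congrArg (fun t => t.2.2) (by simpa using χ.i₁₃.homB.smul 0 (0, b, 0) :
    χ.i₁₃.e (0, b, 0) = (0, (χ.i₁₃.e (0, b, 0)).2.1, 0))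
theorem TVS.Iso.f₂₃_zero (a) : χ.f₂₃ a 0 = 0 :=
  congrArg (fun t => t.2.2) (by simpa using χ.i₂₃.homA.smul 0 (a, 0, 0) :
    χ.i₂₃.e (a, 0, 0) = ((χ.i₂₃.e (a, 0, 0)).1, 0, 0))
theorem TVS.Iso.f₂₃_zero' (b) : χ.f₂₃ 0 b = 0 :=
  congrArg (fun t => t.2.2) (by simpa using χ.i₂₃.homB.smul 0 (0, b, 0) :
    χ.i₂₃.e (0, b, 0) = (0, (χ.i₂₃.e (0, b, 0)).2.1, 0))

/-- A statomorphism is determined by its bilinear components and by the trilinear component of its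
logarithm. -/
theorem TVS.Iso.ext_components
    {χ ψ : (TVS.dec V₁ V₂ V₃ V₁₂ V₁₃ V₂₃ V₁₂₃).Iso (TVS.dec V₁ V₂ V₃ V₁₂ V₁₃ V₂₃ V₁₂₃)}
    (h₁₂ : ∀ a b, χ.f₁₂ a b = ψ.f₁₂ a b)
    (h₁₃ : ∀ a b, χ.f₁₃ a b = ψ.f₁₃ a b) (h₂₃ : ∀ a b, χ.f₂₃ a b = ψ.f₂₃ a b)
    (k₁ : ∀ a b, χ.g₁ a b = ψ.g₁ a b) (k₂ : ∀ a b, χ.g₂ a b = ψ.g₂ a b)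
    (k₃ : ∀ a b, χ.g₃ a b = ψ.g₃ a b) (hr : ∀ a b c, χ.logRho a b c = ψ.logRho a b c) : χ = ψ := by
  have hr' : ∀ a b c, χ.rho a b c = ψ.rho a b c := fun a b c => by
    have := hr a b c
    simpa only [logRho, h₁₂, h₁₃, h₂₃, k₁, k₂, k₃, sub_left_inj] using this
  refine TVS.Iso.ext' ?_ ?_ ?_ ?_
  · rintro ⟨a, b, x⟩; rw [i₁₂_apply, i₁₂_apply, h₁₂]
  · rintro ⟨a, b, x⟩; rw [i₁₃_apply, i₁₃_apply, h₁₃]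
  · rintro ⟨a, b, x⟩; rw [i₂₃_apply, i₂₃_apply, h₂₃]
  · rintro ⟨a, b, c, x, y, z, u⟩; rw [e_apply, e_apply, h₁₂, h₁₃, h₂₃, k₁, k₂, k₃, hr']

theorem TVS.Iso.f₁₂_trans (a b) : (χ.trans ψ).f₁₂ a b = χ.f₁₂ a b + ψ.f₁₂ a b := by
  change (ψ.i₁₂.e (χ.i₁₂.e (a, b, 0))).2.2 = _
  rw [i₁₂_apply, i₁₂_apply, zero_add]
theorem TVS.Iso.f₁₃_trans (a b) : (χ.trans ψ).f₁₃ a b = χ.f₁₃ a b + ψ.f₁₃ a b := by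
  change (ψ.i₁₃.e (χ.i₁₃.e (a, b, 0))).2.2 = _
  rw [i₁₃_apply, i₁₃_apply, zero_add]
theorem TVS.Iso.f₂₃_trans (a b) : (χ.trans ψ).f₂₃ a b = χ.f₂₃ a b + ψ.f₂₃ a b := by
  change (ψ.i₂₃.e (χ.i₂₃.e (a, b, 0))).2.2 = _
  rw [i₂₃_apply, i₂₃_apply, zero_add]

theorem TVS.Iso.last_trans (a b c x y z u) : (χ.trans ψ).last a b c x y z u =
    ψ.last a b c (x + χ.f₁₂ a b) (y + χ.f₁₃ a c) (z + χ.f₂₃ b c) (χ.last a b c x y z u) := by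
  change (ψ.e (χ.e (a, b, c, x, y, z, u))).2.2.2.2.2.2 = _
  rw [χ.e_apply_fst]; rfl

theorem TVS.Iso.g₁_trans (a z) : (χ.trans ψ).g₁ a z = χ.g₁ a z + ψ.g₁ a z := by
  refine (χ.last_trans ψ a 0 0 0 0 z 0).trans ?_
  simp [last_apply, f₁₂_zero, f₁₃_zero, f₂₃_zero, g₂_zero', g₃_zero', rho_zero₂]
theorem TVS.Iso.g₂_trans (b y) : (χ.trans ψ).g₂ b y = χ.g₂ b y + ψ.g₂ b y := by
  refine (χ.last_trans ψ 0 b 0 0 y 0 0).trans ?_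
  simp [last_apply, f₁₂_zero', f₁₃_zero, f₂₃_zero, g₁_zero', g₃_zero', rho_zero₃]
theorem TVS.Iso.g₃_trans (c x) : (χ.trans ψ).g₃ c x = χ.g₃ c x + ψ.g₃ c x := by
  refine (χ.last_trans ψ 0 0 c x 0 0 0).trans ?_
  simp [last_apply, f₁₂_zero', f₁₃_zero', f₂₃_zero', g₁_zero', g₂_zero', rho_zero₁]
theorem TVS.Iso.rho_trans (a b c) : (χ.trans ψ).rho a b c = χ.rho a b c + ψ.rho a b c +
    ψ.g₁ a (χ.f₂₃ b c) + ψ.g₂ b (χ.f₁₃ a c) + ψ.g₃ c (χ.f₁₂ a b) := by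
  refine (χ.last_trans ψ a b c 0 0 0 0).trans ?_
  simp only [last_apply, zero_add, g₁_zero, g₂_zero, g₃_zero]
  abel

theorem TVS.Iso.symm_trans_self :
    χ.symm.trans χ = TVS.Iso.refl (TVS.dec V₁ V₂ V₃ V₁₂ V₁₃ V₂₃ V₁₂₃) :=
  TVS.Iso.ext' (fun x => χ.i₁₂.e.apply_symm_apply x) (fun x => χ.i₁₃.e.apply_symm_apply x)
    (fun x => χ.i₂₃.e.apply_symm_apply x) (fun x => χ.e.apply_symm_apply x)

theorem TVS.Iso.f₁₂_symm (a b) : χ.symm.f₁₂ a b = -χ.f₁₂ a b := by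
  refine eq_neg_of_add_eq_zero_left ?_
  rw [← f₁₂_trans, symm_trans_self]; rfl
theorem TVS.Iso.f₁₃_symm (a b) : χ.symm.f₁₃ a b = -χ.f₁₃ a b := by
  refine eq_neg_of_add_eq_zero_left ?_
  rw [← f₁₃_trans, symm_trans_self]; rfl
theorem TVS.Iso.f₂₃_symm (a b) : χ.symm.f₂₃ a b = -χ.f₂₃ a b := by
  refine eq_neg_of_add_eq_zero_left ?_
  rw [← f₂₃_trans, symm_trans_self]; rfl
theorem TVS.Iso.g₁_symm (a b) : χ.symm.g₁ a b = -χ.g₁ a b := by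
  refine eq_neg_of_add_eq_zero_left ?_
  rw [← g₁_trans, symm_trans_self]; rfl
theorem TVS.Iso.g₂_symm (a b) : χ.symm.g₂ a b = -χ.g₂ a b := by
  refine eq_neg_of_add_eq_zero_left ?_
  rw [← g₂_trans, symm_trans_self]; rfl
theorem TVS.Iso.g₃_symm (a b) : χ.symm.g₃ a b = -χ.g₃ a b := by
  refine eq_neg_of_add_eq_zero_left ?_
  rw [← g₃_trans, symm_trans_self]; rfl

/-- Inversion changes the sign of the logarithm. -/
theorem TVS.Iso.logRho_symm (a b c) : χ.symm.logRho a b c = -χ.logRho a b c := by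
  have h : (χ.symm.trans χ).rho a b c = 0 := by rw [symm_trans_self]; rfl
  rw [rho_trans] at h
  simp only [logRho, f₁₂_symm, f₁₃_symm, f₂₃_symm, g₁_symm, g₂_symm, g₃_symm, g₁_neg, g₂_neg, g₃_neg,
    neg_neg] at h ⊢
  have h' : χ.symm.rho a b c = χ.g₁ a (χ.f₂₃ b c) + χ.g₂ b (χ.f₁₃ a c) + χ.g₃ c (χ.f₁₂ a b) -
      χ.rho a b c := by rw [← sub_eq_zero, ← h]; abel
  rw [h']
  module

end Components

end TripleVB

namespace TripleVB

/-! ### The action of duality and of the flips on statomorphisms -/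

section DualComponents

variable {V₁ V₂ V₃ V₁₂ V₁₃ V₂₃ V₁₂₃ V₀ V₀₂ V₀₃ V₀₂₃ : Type}
variable [AddCommGroup V₁] [Module ℝ V₁] [AddCommGroup V₂] [Module ℝ V₂]
  [AddCommGroup V₃] [Module ℝ V₃] [AddCommGroup V₁₂] [Module ℝ V₁₂] [AddCommGroup V₁₃] [Module ℝ V₁₃]
  [AddCommGroup V₂₃] [Module ℝ V₂₃] [AddCommGroup V₁₂₃] [Module ℝ V₁₂₃]
  [AddCommGroup V₀] [Module ℝ V₀] [AddCommGroup V₀₂] [Module ℝ V₀₂] [AddCommGroup V₀₃] [Module ℝ V₀₃]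
  [AddCommGroup V₀₂₃] [Module ℝ V₀₂₃]
  (b₀ : V₀ →ₗ[ℝ] V₁₂₃ →ₗ[ℝ] ℝ) (b₂ : V₀₂ →ₗ[ℝ] V₁₃ →ₗ[ℝ] ℝ) (b₃ : V₀₃ →ₗ[ℝ] V₁₂ →ₗ[ℝ] ℝ)
  (b₁ : V₀₂₃ →ₗ[ℝ] V₁ →ₗ[ℝ] ℝ)

/-- The components of `χ'` are those of `χ`, transposed as prescribed by the exchange of the indices
`0` and `1`, and with their signs changed except for the one in `E₂ × E₃ → E₂₃`. The last clause is
the reason for the use of the logarithm: the trilinear component itself acquires quadratic terms. -/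
structure DualRel (χ : (TVS.dec V₁ V₂ V₃ V₁₂ V₁₃ V₂₃ V₁₂₃).Iso (TVS.dec V₁ V₂ V₃ V₁₂ V₁₃ V₂₃ V₁₂₃))
    (χ' : (TVS.dec V₀ V₂ V₃ V₀₂ V₀₃ V₂₃ V₀₂₃).Iso (TVS.dec V₀ V₂ V₃ V₀₂ V₀₃ V₂₃ V₀₂₃)) : Prop where
  f₁₂ : ∀ a b t, b₂ (χ'.f₁₂ a b) t = -b₀ a (χ.g₂ b t)
  f₁₃ : ∀ a c t, b₃ (χ'.f₁₃ a c) t = -b₀ a (χ.g₃ c t)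
  f₂₃ : ∀ b c, χ'.f₂₃ b c = χ.f₂₃ b c
  g₁ : ∀ a z t, b₁ (χ'.g₁ a z) t = -b₀ a (χ.g₁ t z)
  g₂ : ∀ b y t, b₁ (χ'.g₂ b y) t = -b₃ y (χ.f₁₂ t b)
  g₃ : ∀ c x t, b₁ (χ'.g₃ c x) t = -b₂ x (χ.f₁₃ t c)
  logRho : ∀ a b c t, b₁ (χ'.logRho a b c) t = -b₀ a (χ.logRho t b c)

variable {b₀ b₂ b₃ b₁}

/-- The inverse `χ'` of the dual of a statomorphism `χ` of a decomposed triple vector bundle has the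
components which `DualRel` prescribes. -/
theorem dualRel_of_dual
    {χ : (TVS.dec V₁ V₂ V₃ V₁₂ V₁₃ V₂₃ V₁₂₃).Iso (TVS.dec V₁ V₂ V₃ V₁₂ V₁₃ V₂₃ V₁₂₃)}
    {χ' : (TVS.dec V₀ V₂ V₃ V₀₂ V₀₃ V₂₃ V₀₂₃).Iso (TVS.dec V₀ V₂ V₃ V₀₂ V₀₃ V₂₃ V₀₂₃)}
    (h : ∀ y, (tupT b₀ b₂ b₃ b₁ (χ'.e y) : TVS.dT (TVS.dec V₁ V₂ V₃ V₁₂ V₁₃ V₂₃ V₁₂₃)) =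
      χ.symm.cT (tupT b₀ b₂ b₃ b₁ y))
    (h₁₂ : ∀ y, (tup₁₂ b₀ b₂ (χ'.i₁₂.e y) : TVS.d₁₂ (TVS.dec V₁ V₂ V₃ V₁₂ V₁₃ V₂₃ V₁₂₃)) =
      χ.symm.c₁₂ (tup₁₂ b₀ b₂ y))
    (h₁₃ : ∀ y, (tup₁₃ b₀ b₃ (χ'.i₁₃.e y) : TVS.d₁₃ (TVS.dec V₁ V₂ V₃ V₁₂ V₁₃ V₂₃ V₁₂₃)) =
      χ.symm.c₁₃ (tup₁₃ b₀ b₃ y))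
    (h₂₃ : ∀ y, χ'.i₂₃.e y = χ.i₂₃.e y) : DualRel b₀ b₂ b₃ b₁ χ χ' := by
  have k₁₂ : ∀ a b t, b₂ (χ'.f₁₂ a b) t = -b₀ a (χ.g₂ b t) := fun a b t => by
    have := (tup₁₂_c₁₂ χ.symm (h₁₂ (a, b, 0))).2 t 0
    rw [TVS.Iso.i₁₂_apply, TVS.Iso.e_apply] at this
    simpa [TVS.Iso.g₂_symm, TVS.Iso.rho_zero₁, TVS.Iso.g₁_zero, TVS.Iso.g₃_zero] using this
  have k₁₃ : ∀ a b t, b₃ (χ'.f₁₃ a b) t = -b₀ a (χ.g₃ b t) := fun a b t => by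
    have := (tup₁₃_c₁₃ χ.symm (h₁₃ (a, b, 0))).2 t 0
    rw [TVS.Iso.i₁₃_apply, TVS.Iso.e_apply] at this
    simpa [TVS.Iso.g₃_symm, TVS.Iso.rho_zero₁, TVS.Iso.g₁_zero, TVS.Iso.g₂_zero] using this
  have k₂₃ : ∀ b c, χ'.f₂₃ b c = χ.f₂₃ b c := fun b c => congrArg (fun t => t.2.2) (h₂₃ (b, c, 0))
  have key : ∀ (x₀ : V₀) (x₂ : V₂) (x₃ : V₃) (x₀₂ : V₀₂) (x₀₃ : V₀₃) (x₂₃ : V₂₃) (t : V₁),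
      b₁ (χ'.g₁ x₀ x₂₃ + χ'.g₂ x₂ x₀₃ + χ'.g₃ x₃ x₀₂ + χ'.rho x₀ x₂ x₃) t =
        b₃ x₀₃ (χ.symm.f₁₂ t x₂) + b₂ x₀₂ (χ.symm.f₁₃ t x₃) +
          b₀ x₀ (χ.symm.g₁ t (x₂₃ + χ.f₂₃ x₂ x₃) + χ.symm.rho t x₂ x₃) := by
    intro x₀ x₂ x₃ x₀₂ x₀₃ x₂₃ t
    have := (tupT_cT χ.symm (h (x₀, x₂, x₃, x₀₂, x₀₃, x₂₃, 0))).2.2.2 t 0 0 0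
    rw [TVS.Iso.e_apply, TVS.Iso.e_apply] at this
    simpa [TVS.Iso.g₂_zero, TVS.Iso.g₃_zero, k₂₃] using this
  have k₁ : ∀ a z t, b₁ (χ'.g₁ a z) t = -b₀ a (χ.g₁ t z) := fun a z t => by
    have := key a 0 0 0 0 z t
    simpa [TVS.Iso.g₂_zero, TVS.Iso.g₃_zero, TVS.Iso.rho_zero₂, TVS.Iso.f₂₃_zero, TVS.Iso.g₁_symm]
      using this
  have k₂ : ∀ b y t, b₁ (χ'.g₂ b y) t = -b₃ y (χ.f₁₂ t b) := fun b y t => by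
    have := key 0 b 0 0 y 0 t
    simpa [TVS.Iso.g₁_zero, TVS.Iso.g₃_zero, TVS.Iso.rho_zero₃, TVS.Iso.f₁₂_symm] using this
  have k₃ : ∀ c x t, b₁ (χ'.g₃ c x) t = -b₂ x (χ.f₁₃ t c) := fun c x t => by
    have := key 0 0 c x 0 0 t
    simpa [TVS.Iso.g₁_zero, TVS.Iso.g₂_zero, TVS.Iso.rho_zero₂, TVS.Iso.f₁₃_symm] using this
  refine ⟨k₁₂, k₁₃, k₂₃, k₁, k₂, k₃, fun a b c t => ?_⟩
  have hr := key a b c 0 0 0 t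
  simp only [TVS.Iso.g₁_zero, TVS.Iso.g₂_zero, TVS.Iso.g₃_zero, zero_add, map_zero,
    LinearMap.zero_apply, map_add] at hr
  have hl : χ.symm.rho t b c = -χ.logRho t b c + (1 / 2 : ℝ) •
      (χ.g₁ t (χ.f₂₃ b c) + χ.g₂ b (χ.f₁₃ t c) + χ.g₃ c (χ.f₁₂ t b)) := by
    have := χ.logRho_symm t b c
    rw [TVS.Iso.logRho, TVS.Iso.f₁₂_symm, TVS.Iso.f₁₃_symm, TVS.Iso.f₂₃_symm, TVS.Iso.g₁_symm,
      TVS.Iso.g₂_symm, TVS.Iso.g₃_symm, TVS.Iso.g₁_neg, TVS.Iso.g₂_neg, TVS.Iso.g₃_neg, neg_neg,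
      neg_neg, neg_neg, sub_eq_iff_eq_add] at this
    exact this
  rw [TVS.Iso.logRho, map_sub, map_smul, map_add, map_add, LinearMap.sub_apply, LinearMap.smul_apply,
    LinearMap.add_apply, LinearMap.add_apply, k₁, k₂, k₃, hr, k₁₂, k₁₃, k₂₃, TVS.Iso.g₁_symm, hl]
  simp only [map_add, map_neg, map_smul, smul_eq_mul]
  ring

end DualComponents

section Acts

open CategoryTheory

variable {M : Base} {V₁ V₂ V₃ V₁₂ V₁₃ V₂₃ V₁₂₃ V₀ V₀₂ V₀₃ V₀₂₃ : VecBdl M}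

variable (V₁ V₂ V₃ V₁₂ V₁₃ V₂₃ V₁₂₃) in
/-- The decomposed triple vector bundle. -/
def TVB.decomposed : TVB V₁ V₂ V₃ V₁₂ V₁₃ V₂₃ V₁₂₃ where
  toPreTVB := PreTVB.dec V₁ V₂ V₃ V₁₂ V₁₃ V₂₃ V₁₂₃
  split := ⟨.refl _⟩

/-- The value at a point of an endomorphism of the decomposed triple vector bundle. -/
def isoAt (φ : TVB.decomposed V₁ V₂ V₃ V₁₂ V₁₃ V₂₃ V₁₂₃ ⟶ TVB.decomposed V₁ V₂ V₃ V₁₂ V₁₃ V₂₃ V₁₂₃)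
    (m : M.pt) : (TVS.dec (V₁.fib m) (V₂.fib m) (V₃.fib m) (V₁₂.fib m) (V₁₃.fib m) (V₂₃.fib m)
      (V₁₂₃.fib m)).Iso (TVS.dec (V₁.fib m) (V₂.fib m) (V₃.fib m) (V₁₂.fib m) (V₁₃.fib m)
      (V₂₃.fib m) (V₁₂₃.fib m)) := PreTVB.Iso.iso φ m

theorem isoAt_ext {φ ψ : TVB.decomposed V₁ V₂ V₃ V₁₂ V₁₃ V₂₃ V₁₂₃ ⟶
    TVB.decomposed V₁ V₂ V₃ V₁₂ V₁₃ V₂₃ V₁₂₃} (h : ∀ m, isoAt φ m = isoAt ψ m) : φ = ψ :=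
  PreTVB.Iso.ext' h

variable {W₁ W₂ W₃ W₁₂ W₁₃ W₂₃ W₁₂₃ U₁ U₂ U₃ U₁₂ U₁₃ U₂₃ U₁₂₃ : VecBdl M}

/-- `F` maps the decomposed triple vector bundle to the decomposed one, up to isomorphism, and the
resulting action on its statomorphisms satisfies the relation `R`. -/
def Acts (F : TVB V₁ V₂ V₃ V₁₂ V₁₃ V₂₃ V₁₂₃ ⥤ TVB W₁ W₂ W₃ W₁₂ W₁₃ W₂₃ W₁₂₃)
    (R : (TVB.decomposed V₁ V₂ V₃ V₁₂ V₁₃ V₂₃ V₁₂₃ ⟶ TVB.decomposed V₁ V₂ V₃ V₁₂ V₁₃ V₂₃ V₁₂₃) →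
      (TVB.decomposed W₁ W₂ W₃ W₁₂ W₁₃ W₂₃ W₁₂₃ ⟶ TVB.decomposed W₁ W₂ W₃ W₁₂ W₁₃ W₂₃ W₁₂₃) →
      Prop) : Prop :=
  ∃ α : F.obj (TVB.decomposed V₁ V₂ V₃ V₁₂ V₁₃ V₂₃ V₁₂₃) ≅ TVB.decomposed W₁ W₂ W₃ W₁₂ W₁₃ W₂₃ W₁₂₃,
    ∀ φ φ', F.map φ ≫ α.hom = α.hom ≫ φ' → R φ φ'

theorem Acts.comp {F : TVB V₁ V₂ V₃ V₁₂ V₁₃ V₂₃ V₁₂₃ ⥤ TVB W₁ W₂ W₃ W₁₂ W₁₃ W₂₃ W₁₂₃}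
    {G : TVB W₁ W₂ W₃ W₁₂ W₁₃ W₂₃ W₁₂₃ ⥤ TVB U₁ U₂ U₃ U₁₂ U₁₃ U₂₃ U₁₂₃} {R S}
    (hF : Acts F R) (hG : Acts G S) : Acts (F ⋙ G) (fun φ φ' => ∃ ψ, R φ ψ ∧ S ψ φ') := by
  obtain ⟨α, hα⟩ := hF
  obtain ⟨β, hβ⟩ := hG
  refine ⟨G.mapIso α ≪≫ β, fun φ φ' h => ⟨α.inv ≫ F.map φ ≫ α.hom, hα _ _ (by simp), hβ _ _ ?_⟩⟩
  have h' : G.map (F.map φ) ≫ G.map α.hom ≫ β.hom = G.map α.hom ≫ β.hom ≫ φ' := by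
    simpa using h
  rw [G.map_comp, G.map_comp, Category.assoc, Category.assoc, h', ← Category.assoc, ← G.map_comp]
  simp

theorem acts_flip₁₂ : Acts (flip₁₂Functor (V₁ := V₁) (V₂ := V₂) (V₃ := V₃) (V₁₂ := V₁₂) (V₁₃ := V₁₃)
    (V₂₃ := V₂₃) (V₁₂₃ := V₁₂₃)) fun φ φ' => ∀ m, isoAt φ' m =
      ((TVS.decFlip₁₂ _ _ _ _ _ _ _).symm.trans ((isoAt φ m).flip₁₂.trans
        (TVS.decFlip₁₂ _ _ _ _ _ _ _))) := by
  let α : flip₁₂Functor.obj (TVB.decomposed V₁ V₂ V₃ V₁₂ V₁₃ V₂₃ V₁₂₃) ⟶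
    TVB.decomposed V₂ V₁ V₃ V₁₂ V₂₃ V₁₃ V₁₂₃ := PreTVB.decFlip₁₂ V₁ V₂ V₃ V₁₂ V₁₃ V₂₃ V₁₂₃
  refine ⟨(Groupoid.isoEquivHom _ _).symm α, fun φ φ' h m => ?_⟩
  have h' : φ' = Groupoid.inv α ≫ flip₁₂Functor.map φ ≫ α := by
    rw [show flip₁₂Functor.map φ ≫ α = α ≫ φ' from h, ← Category.assoc, Groupoid.inv_comp,
      Category.id_comp]
  rw [h']; rfl

theorem acts_flip₁₃ : Acts (flip₁₃Functor (V₁ := V₁) (V₂ := V₂) (V₃ := V₃) (V₁₂ := V₁₂) (V₁₃ := V₁₃)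
    (V₂₃ := V₂₃) (V₁₂₃ := V₁₂₃)) fun φ φ' => ∀ m, isoAt φ' m =
      ((TVS.decFlip₁₃ _ _ _ _ _ _ _).symm.trans ((isoAt φ m).flip₁₃.trans
        (TVS.decFlip₁₃ _ _ _ _ _ _ _))) := by
  let α : flip₁₃Functor.obj (TVB.decomposed V₁ V₂ V₃ V₁₂ V₁₃ V₂₃ V₁₂₃) ⟶
    TVB.decomposed V₃ V₂ V₁ V₂₃ V₁₃ V₁₂ V₁₂₃ := PreTVB.decFlip₁₃ V₁ V₂ V₃ V₁₂ V₁₃ V₂₃ V₁₂₃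
  refine ⟨(Groupoid.isoEquivHom _ _).symm α, fun φ φ' h m => ?_⟩
  have h' : φ' = Groupoid.inv α ≫ flip₁₃Functor.map φ ≫ α := by
    rw [show flip₁₃Functor.map φ ≫ α = α ≫ φ' from h, ← Category.assoc, Groupoid.inv_comp,
      Category.id_comp]
  rw [h']; rfl

variable (P₀ : SmoothPairing V₀ V₁₂₃) (P₂ : SmoothPairing V₀₂ V₁₃) (P₃ : SmoothPairing V₀₃ V₁₂)
  (P₁ : SmoothPairing V₀₂₃ V₁)

theorem acts_dualX : Acts (V₁ := V₁) (W₁ := V₀) (W₂ := V₂) (W₃ := V₃) (W₁₂ := V₀₂) (W₁₃ := V₀₃)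
    (W₂₃ := V₂₃) (W₁₂₃ := V₀₂₃) (dualXFunctor P₀ P₂ P₃ P₁ ⋙ (Groupoid.invEquivalence _).inverse)
    fun φ φ' => ∀ m, DualRel (P₀.b m) (P₂.b m) (P₃.b m) (P₁.b m) (isoAt φ m) (isoAt φ' m) := by
  let E := TVB.decomposed V₁ V₂ V₃ V₁₂ V₁₃ V₂₃ V₁₂₃
  let E' := TVB.decomposed V₀ V₂ V₃ V₀₂ V₀₃ V₂₃ V₀₂₃
  let D : E.dualX P₀ P₂ P₃ P₁ ⟶ E' := ⟨fun m => (E.dualDec P₀ P₂ P₃ P₁ m).symm, .pullback _ _,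
    .pullback _ _, E.decomp.smooth₂₃, .pullback _ _⟩
  -- `D` is composed with the dual of the splitting of `E` which enters its definition
  let α : E.dualX P₀ P₂ P₃ P₁ ⟶ E' := PreTVB.Iso.trans (TVB.dualXMap P₀ P₂ P₃ P₁
    (E := E) (F := E) E.decomp) D
  refine ⟨(Groupoid.isoEquivHom _ _).symm α, fun φ φ' h m => ?_⟩
  have h' : φ' = Groupoid.inv α ≫ Groupoid.inv (TVB.dualXMap P₀ P₂ P₃ P₁ φ :
      E.dualX P₀ P₂ P₃ P₁ ⟶ E.dualX P₀ P₂ P₃ P₁) ≫ α := by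
    rw [show Groupoid.inv (TVB.dualXMap P₀ P₂ P₃ P₁ φ :
      E.dualX P₀ P₂ P₃ P₁ ⟶ E.dualX P₀ P₂ P₃ P₁) ≫ α = α ≫ φ' from h, ← Category.assoc,
      Groupoid.inv_comp, Category.id_comp]
  let D₀ := TVS.dec (V₁.fib m) (V₂.fib m) (V₃.fib m) (V₁₂.fib m) (V₁₃.fib m) (V₂₃.fib m)
    (V₁₂₃.fib m)
  let T : _ ≃ TVS.dT D₀ := tupTE (P₀.b m) (P₂.b m) (P₃.b m) (P₁.b m)
    (P₀.perfect m) (P₂.perfect m) (P₃.perfect m) (P₁.perfect m)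
  let T₁₂ : _ ≃ TVS.d₁₂ D₀ := tup₁₂E (P₀.b m) (P₂.b m) (P₀.perfect m) (P₂.perfect m)
  let T₁₃ : _ ≃ TVS.d₁₃ D₀ := tup₁₃E (P₀.b m) (P₃.b m) (P₀.perfect m) (P₃.perfect m)
  -- at `m`, the isomorphism `α` is the inverse of the identification `T` of the product with the dual
  have hα : ∀ Ψ, (PreTVB.Iso.iso α m).e Ψ = T.symm Ψ := fun Ψ =>
    congrArg T.symm ((E.decomp.iso m).cT.symm_apply_apply Ψ)
  have hα₁₂ : ∀ Ψ, (PreTVB.Iso.iso α m).i₁₂.e Ψ = T₁₂.symm Ψ := fun Ψ =>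
    congrArg T₁₂.symm ((E.decomp.iso m).c₁₂.symm_apply_apply Ψ)
  have hα₁₃ : ∀ Ψ, (PreTVB.Iso.iso α m).i₁₃.e Ψ = T₁₃.symm Ψ := fun Ψ =>
    congrArg T₁₃.symm ((E.decomp.iso m).c₁₃.symm_apply_apply Ψ)
  have hα₂₃ : ∀ Ψ, (PreTVB.Iso.iso α m).i₂₃.e Ψ = Ψ := fun Ψ =>
    (E.decomp.iso m).i₂₃.e.apply_symm_apply Ψ
  have hs {S S' : Type} {e f : S ≃ S'} (h : ∀ x, e x = f x) (y) : e.symm y = f.symm y := by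
    rw [Equiv.ext h]
  rw [h']
  refine dualRel_of_dual (fun y => ?_) (fun y => ?_) (fun y => ?_) fun y => ?_
  · refine (congrArg T (hα _)).trans ((T.apply_symm_apply _).trans ?_)
    exact congrArg (isoAt φ m).symm.cT ((hs (f := T.symm) hα y))
  · refine (congrArg T₁₂ (hα₁₂ _)).trans ((T₁₂.apply_symm_apply _).trans ?_)
    exact congrArg (isoAt φ m).symm.c₁₂ ((hs (f := T₁₂.symm) hα₁₂ y))
  · refine (congrArg T₁₃ (hα₁₃ _)).trans ((T₁₃.apply_symm_apply _).trans ?_)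
    exact congrArg (isoAt φ m).symm.c₁₃ ((hs (f := T₁₃.symm) hα₁₃ y))
  · refine (hα₂₃ _).trans ?_
    exact congrArg (isoAt φ m).i₂₃.e (hs (f := Equiv.refl _) hα₂₃ y)

end Acts

end TripleVB

namespace TripleVB

open CategoryTheory Equiv

section DualComponents

variable {V₁ V₂ V₃ V₁₂ V₁₃ V₂₃ V₁₂₃ V₀ V₀₁ V₀₂ V₀₃ V₀₁₂ V₀₁₃ : Type}
variable [AddCommGroup V₁] [Module ℝ V₁] [AddCommGroup V₂] [Module ℝ V₂]
  [AddCommGroup V₃] [Module ℝ V₃] [AddCommGroup V₁₂] [Module ℝ V₁₂] [AddCommGroup V₁₃] [Module ℝ V₁₃]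
  [AddCommGroup V₂₃] [Module ℝ V₂₃] [AddCommGroup V₁₂₃] [Module ℝ V₁₂₃]
  [AddCommGroup V₀] [Module ℝ V₀] [AddCommGroup V₀₁] [Module ℝ V₀₁] [AddCommGroup V₀₂] [Module ℝ V₀₂]
  [AddCommGroup V₀₃] [Module ℝ V₀₃] [AddCommGroup V₀₁₂] [Module ℝ V₀₁₂] [AddCommGroup V₀₁₃]
  [Module ℝ V₀₁₃]

theorem logRho_flip₁₂ (χ : (TVS.dec V₁ V₂ V₃ V₁₂ V₁₃ V₂₃ V₁₂₃).Iso
    (TVS.dec V₁ V₂ V₃ V₁₂ V₁₃ V₂₃ V₁₂₃)) (a b c) :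
    ((TVS.decFlip₁₂ V₁ V₂ V₃ V₁₂ V₁₃ V₂₃ V₁₂₃).symm.trans (χ.flip₁₂.trans
      (TVS.decFlip₁₂ V₁ V₂ V₃ V₁₂ V₁₃ V₂₃ V₁₂₃))).logRho a b c = χ.logRho b a c := by
  change χ.rho b a c - (1 / 2 : ℝ) • (χ.g₂ a (χ.f₁₃ b c) + χ.g₁ b (χ.f₂₃ a c) +
    χ.g₃ c (χ.f₁₂ b a)) = _
  rw [TVS.Iso.logRho, add_comm (χ.g₁ _ _)]

theorem logRho_flip₁₃ (χ : (TVS.dec V₁ V₂ V₃ V₁₂ V₁₃ V₂₃ V₁₂₃).Iso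
    (TVS.dec V₁ V₂ V₃ V₁₂ V₁₃ V₂₃ V₁₂₃)) (a b c) :
    ((TVS.decFlip₁₃ V₁ V₂ V₃ V₁₂ V₁₃ V₂₃ V₁₂₃).symm.trans (χ.flip₁₃.trans
      (TVS.decFlip₁₃ V₁ V₂ V₃ V₁₂ V₁₃ V₂₃ V₁₂₃))).logRho a b c = χ.logRho c b a := by
  change χ.rho c b a - (1 / 2 : ℝ) • (χ.g₃ a (χ.f₁₂ c b) + χ.g₂ b (χ.f₁₃ c a) +
    χ.g₁ c (χ.f₂₃ b a)) = _
  rw [TVS.Iso.logRho]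
  congr 2
  abel

/-- The analogue of `DualRel` for the duality along the axis 2. -/
structure DualRelY (b₀ : V₀ →ₗ[ℝ] V₁₂₃ →ₗ[ℝ] ℝ) (b₁ : V₀₁ →ₗ[ℝ] V₂₃ →ₗ[ℝ] ℝ)
    (b₃ : V₀₃ →ₗ[ℝ] V₁₂ →ₗ[ℝ] ℝ) (b₂ : V₀₁₃ →ₗ[ℝ] V₂ →ₗ[ℝ] ℝ)
    (χ : (TVS.dec V₁ V₂ V₃ V₁₂ V₁₃ V₂₃ V₁₂₃).Iso (TVS.dec V₁ V₂ V₃ V₁₂ V₁₃ V₂₃ V₁₂₃))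
    (χ' : (TVS.dec V₁ V₀ V₃ V₀₁ V₁₃ V₀₃ V₀₁₃).Iso (TVS.dec V₁ V₀ V₃ V₀₁ V₁₃ V₀₃ V₀₁₃)) : Prop where
  f₁₂ : ∀ b a t, b₁ (χ'.f₁₂ b a) t = -b₀ a (χ.g₁ b t)
  f₁₃ : ∀ b c, χ'.f₁₃ b c = χ.f₁₃ b c
  f₂₃ : ∀ a c t, b₃ (χ'.f₂₃ a c) t = -b₀ a (χ.g₃ c t)
  g₁ : ∀ b y t, b₂ (χ'.g₁ b y) t = -b₃ y (χ.f₁₂ b t)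
  g₂ : ∀ a z t, b₂ (χ'.g₂ a z) t = -b₀ a (χ.g₂ t z)
  g₃ : ∀ c x t, b₂ (χ'.g₃ c x) t = -b₁ x (χ.f₂₃ t c)
  logRho : ∀ b a c t, b₂ (χ'.logRho b a c) t = -b₀ a (χ.logRho b t c)

theorem DualRel.flip₁₂ {b₀ : V₀ →ₗ[ℝ] V₁₂₃ →ₗ[ℝ] ℝ} {b₁ : V₀₁ →ₗ[ℝ] V₂₃ →ₗ[ℝ] ℝ}
    {b₃ : V₀₃ →ₗ[ℝ] V₁₂ →ₗ[ℝ] ℝ} {b₂ : V₀₁₃ →ₗ[ℝ] V₂ →ₗ[ℝ] ℝ}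
    {χ : (TVS.dec V₁ V₂ V₃ V₁₂ V₁₃ V₂₃ V₁₂₃).Iso (TVS.dec V₁ V₂ V₃ V₁₂ V₁₃ V₂₃ V₁₂₃)}
    {ψ} {ψ' : (TVS.dec V₀ V₁ V₃ V₀₁ V₀₃ V₁₃ V₀₁₃).Iso (TVS.dec V₀ V₁ V₃ V₀₁ V₀₃ V₁₃ V₀₁₃)} {χ'}
    (hψ : ψ = ((TVS.decFlip₁₂ V₁ V₂ V₃ V₁₂ V₁₃ V₂₃ V₁₂₃).symm.trans (χ.flip₁₂.trans
      (TVS.decFlip₁₂ V₁ V₂ V₃ V₁₂ V₁₃ V₂₃ V₁₂₃)))) (H : DualRel b₀ b₁ b₃ b₂ ψ ψ')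
    (hχ' : χ' = ((TVS.decFlip₁₂ V₀ V₁ V₃ V₀₁ V₀₃ V₁₃ V₀₁₃).symm.trans (ψ'.flip₁₂.trans
      (TVS.decFlip₁₂ V₀ V₁ V₃ V₀₁ V₀₃ V₁₃ V₀₁₃)))) : DualRelY b₀ b₁ b₃ b₂ χ χ' := by
  subst hψ hχ'
  refine ⟨fun b a t => H.f₁₂ a b t, fun b c => H.f₂₃ b c, fun a c t => H.f₁₃ a c t,
    fun b y t => H.g₂ b y t, fun a z t => H.g₁ a z t, fun c x t => H.g₃ c x t, fun b a c t => ?_⟩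
  rw [logRho_flip₁₂, H.logRho, logRho_flip₁₂]

/-- The analogue of `DualRel` for the duality along the axis 3. -/
structure DualRelZ (b₀ : V₀ →ₗ[ℝ] V₁₂₃ →ₗ[ℝ] ℝ) (b₂ : V₀₂ →ₗ[ℝ] V₁₃ →ₗ[ℝ] ℝ)
    (b₁ : V₀₁ →ₗ[ℝ] V₂₃ →ₗ[ℝ] ℝ) (b₃ : V₀₁₂ →ₗ[ℝ] V₃ →ₗ[ℝ] ℝ)
    (χ : (TVS.dec V₁ V₂ V₃ V₁₂ V₁₃ V₂₃ V₁₂₃).Iso (TVS.dec V₁ V₂ V₃ V₁₂ V₁₃ V₂₃ V₁₂₃))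
    (χ' : (TVS.dec V₁ V₂ V₀ V₁₂ V₀₁ V₀₂ V₀₁₂).Iso (TVS.dec V₁ V₂ V₀ V₁₂ V₀₁ V₀₂ V₀₁₂)) : Prop where
  f₁₂ : ∀ b c, χ'.f₁₂ b c = χ.f₁₂ b c
  f₁₃ : ∀ c a t, b₁ (χ'.f₁₃ c a) t = -b₀ a (χ.g₁ c t)
  f₂₃ : ∀ b a t, b₂ (χ'.f₂₃ b a) t = -b₀ a (χ.g₂ b t)
  g₁ : ∀ c x t, b₃ (χ'.g₁ c x) t = -b₂ x (χ.f₁₃ c t)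
  g₂ : ∀ b y t, b₃ (χ'.g₂ b y) t = -b₁ y (χ.f₂₃ b t)
  g₃ : ∀ a z t, b₃ (χ'.g₃ a z) t = -b₀ a (χ.g₃ t z)
  logRho : ∀ c b a t, b₃ (χ'.logRho c b a) t = -b₀ a (χ.logRho c b t)

theorem DualRel.flip₁₃ {b₀ : V₀ →ₗ[ℝ] V₁₂₃ →ₗ[ℝ] ℝ} {b₂ : V₀₂ →ₗ[ℝ] V₁₃ →ₗ[ℝ] ℝ}
    {b₁ : V₀₁ →ₗ[ℝ] V₂₃ →ₗ[ℝ] ℝ} {b₃ : V₀₁₂ →ₗ[ℝ] V₃ →ₗ[ℝ] ℝ}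
    {χ : (TVS.dec V₁ V₂ V₃ V₁₂ V₁₃ V₂₃ V₁₂₃).Iso (TVS.dec V₁ V₂ V₃ V₁₂ V₁₃ V₂₃ V₁₂₃)}
    {ψ} {ψ' : (TVS.dec V₀ V₂ V₁ V₀₂ V₀₁ V₁₂ V₀₁₂).Iso (TVS.dec V₀ V₂ V₁ V₀₂ V₀₁ V₁₂ V₀₁₂)} {χ'}
    (hψ : ψ = ((TVS.decFlip₁₃ V₁ V₂ V₃ V₁₂ V₁₃ V₂₃ V₁₂₃).symm.trans (χ.flip₁₃.trans
      (TVS.decFlip₁₃ V₁ V₂ V₃ V₁₂ V₁₃ V₂₃ V₁₂₃)))) (H : DualRel b₀ b₂ b₁ b₃ ψ ψ')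
    (hχ' : χ' = ((TVS.decFlip₁₃ V₀ V₂ V₁ V₀₂ V₀₁ V₁₂ V₀₁₂).symm.trans (ψ'.flip₁₃.trans
      (TVS.decFlip₁₃ V₀ V₂ V₁ V₀₂ V₀₁ V₁₂ V₀₁₂)))) : DualRelZ b₀ b₂ b₁ b₃ χ χ' := by
  subst hψ hχ'
  refine ⟨fun b c => H.f₂₃ c b, fun c a t => H.f₁₃ a c t, fun b a t => H.f₁₂ a b t,
    fun c x t => H.g₃ c x t, fun b y t => H.g₂ b y t, fun a z t => H.g₁ a z t, fun c b a t => ?_⟩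
  rw [logRho_flip₁₃, H.logRho, logRho_flip₁₃]

end DualComponents

/-! ### Functors which permute the coordinates of statomorphisms up to signs -/

instance (l l' : Lab) : Decidable (l.Opp l') := inferInstanceAs (Decidable (∀ _, _))

/-- Relabelling of the building bundles along an arbitrary map which preserves complements. -/
def Building.relabel (B : Building) (r : Lab → Lab)
    (hr : ∀ l l', Lab.Opp l l' → Lab.Opp (r l) (r l')) : Building where
  base := B.base
  bundle l := B.bundle (r l)
  pair _ _ h := B.pair _ _ (hr _ _ h)
  pair_symm _ _ h h' := B.pair_symm _ _ (hr _ _ h) (hr _ _ h')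

/-- The decomposed triple vector bundle. -/
def Building.dec (B : Building) : B.TVB := TVB.decomposed _ _ _ _ _ _ _

/-- The decomposed triple vector bundle as an object of the category of all triple vector bundles.
-/
def Building.obj (B : Building) : TripleVectorBundle := ⟨B, B.dec⟩

/-- A statomorphism of the decomposed triple vector bundle in the category of all triple vector
bundles. -/
def Building.endo {B : Building} (φ : B.dec ⟶ B.dec) : B.obj ⟶ B.obj := (Sigma.incl B).map φ

theorem Building.endo_injective {B : Building} : Function.Injective (Building.endo (B := B)) :=
  (Sigma.incl B).map_injective

theorem Building.endo_surjective {B : Building} : Function.Surjective (Building.endo (B := B)) :=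
  (Sigma.incl B).map_surjective

/-- The coordinates of a statomorphism of a decomposed triple vector bundle at a point `m`,
evaluated on vectors of the building bundles. The component `E_I × E_J → E_K`, followed by the
pairing of `E_K` with `E_{Kᶜ}`, is a trilinear form which belongs to the partition of `{0, 1, 2, 3}`
into `I`, `J` and `Kᶜ`. Its label is the only block of this partition that has two elements: `Kᶜ`
for `f₁₂`, `f₁₃` and `f₂₃`, and `{2, 3}`, `{1, 3}`, `{1, 2}` for `g₁`, `g₂`, `g₃`. All labels which
do not have two elements give the trilinear component of the logarithm, as a form on `E₀ × E₁ × E₂ ×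
E₃`. -/
def coord {B : Building} (φ : B.dec ⟶ B.dec) (l : Lab) (m : B.base.pt)
    (w : ∀ l, (B.bundle l).fib m) : ℝ :=
  let χ := isoAt φ m
  let p (v : (B.bundle I₁₂₃).fib m) : ℝ :=
    (B.pair I₀ I₁₂₃ (by decide)).b m (w I₀) v
  match l.1 with
  | ⟨true, true, false, false⟩ =>
    (B.pair I₀₁ I₂₃ (by decide)).b m (w I₀₁) (χ.f₂₃ (w I₂) (w I₃))
  | ⟨true, false, true, false⟩ =>
    (B.pair I₀₂ I₁₃ (by decide)).b m (w I₀₂) (χ.f₁₃ (w I₁) (w I₃))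
  | ⟨true, false, false, true⟩ =>
    (B.pair I₀₃ I₁₂ (by decide)).b m (w I₀₃) (χ.f₁₂ (w I₁) (w I₂))
  | ⟨false, false, true, true⟩ => p (χ.g₁ (w I₁) (w I₂₃))
  | ⟨false, true, false, true⟩ => p (χ.g₂ (w I₂) (w I₁₃))
  | ⟨false, true, true, false⟩ => p (χ.g₃ (w I₃) (w I₁₂))
  | _ => p (χ.logRho (w I₁) (w I₂) (w I₃))

/-- `F` maps the decomposed triple vector bundle to the one with building bundles relabelled along
`r`, and permutes the coordinates of its statomorphisms along `r`, with the signs `s`. The last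
clause compares a statomorphism `φ` with `φ'`, which is `F.map φ` transported along the isomorphism
`α`. -/
def HasType (F : TripleVectorBundle ⥤ TripleVectorBundle) (r : Lab → Lab)
    (hr : ∀ l l', Lab.Opp l l' → Lab.Opp (r l) (r l')) (s : Lab → ℤˣ) : Prop :=
  ∀ B : Building, ∃ α : F.obj B.obj ≅ (B.relabel r hr).obj,
    ∀ (φ : B.dec ⟶ B.dec) (φ' : (B.relabel r hr).dec ⟶ (B.relabel r hr).dec),
      F.map (Building.endo φ) ≫ α.hom = α.hom ≫ Building.endo φ' →
      ∀ (l : Lab) (m : B.base.pt) (w : ∀ l, (B.bundle l).fib m),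
        coord φ' l m (fun k => w (r k)) = ((s l : ℤ) : ℝ) * coord φ (r l) m w

theorem HasType.id : HasType (𝟭 _) id (fun _ _ h => h) 1 := fun B =>
  ⟨Iso.refl _, fun φ φ' h l m w => by
    have h' : Building.endo φ = Building.endo φ' :=
      (Category.comp_id _).symm.trans (h.trans (Category.id_comp _))
    rw [← Building.endo_injective h']
    simp; rfl⟩

theorem HasType.comp {F G : TripleVectorBundle ⥤ TripleVectorBundle} {r r' hr hr' s t}
    (hF : HasType F r hr s) (hG : HasType G r' hr' t) :
    HasType (F ⋙ G) (r ∘ r') (fun _ _ h => hr _ _ (hr' _ _ h)) (fun l => t l * s (r' l)) :=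
    fun B => by
  obtain ⟨α, hα⟩ := hF B
  obtain ⟨β, hβ⟩ := hG (B.relabel r hr)
  refine ⟨G.mapIso α ≪≫ β, fun φ φ' h l m w => ?_⟩
  obtain ⟨ψ, hψ⟩ := Building.endo_surjective (α.inv ≫ F.map (Building.endo φ) ≫ α.hom)
  have h₁ := hα φ ψ (by rw [hψ]; simp) (r' l) m w
  let φ'' : ((B.relabel r hr).relabel r' hr').dec ⟶ ((B.relabel r hr).relabel r' hr').dec := φ'
  have h' : G.map (F.map (Building.endo φ)) ≫ G.map α.hom ≫ β.hom =
      G.map α.hom ≫ β.hom ≫ Building.endo φ'' :=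
    h.trans (Category.assoc _ _ _)
  have h₂ := hβ ψ φ'' (by
    rw [hψ, G.map_comp, G.map_comp, Category.assoc, Category.assoc, h', ← Category.assoc,
      ← G.map_comp]
    simp) l m (fun k => w (r k))
  refine h₂.trans ?_
  rw [h₁]
  push_cast
  simp only [Function.comp]
  ring

theorem HasType.of_iso {F G : TripleVectorBundle ⥤ TripleVectorBundle} {r hr s}
    (hF : HasType F r hr s) (i : G ≅ F) : HasType G r hr s := fun B => by
  obtain ⟨α, hα⟩ := hF B
  refine ⟨i.app _ ≪≫ α, fun φ φ' h => hα φ φ' ?_⟩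
  simp only [Iso.trans_hom, Iso.app_hom, Category.assoc, NatTrans.naturality_assoc] at h
  exact (cancel_epi (i.hom.app _)).1 h

theorem HasType.of_acts {F : TripleVectorBundle ⥤ TripleVectorBundle} {r hr s}
    {f : ∀ B : Building, B.TVB ⥤ (B.relabel r hr).TVB}
    (hF : F = Sigma.desc fun B => f B ⋙ Sigma.incl (B.relabel r hr))
    (hf : ∀ B, ∃ α : (f B).obj B.dec ≅ (B.relabel r hr).dec,
      ∀ (φ : B.dec ⟶ B.dec) (φ' : (B.relabel r hr).dec ⟶ (B.relabel r hr).dec),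
        (f B).map φ ≫ α.hom = α.hom ≫ φ' →
        ∀ (l : Lab) (m : B.base.pt) (w : ∀ l, (B.bundle l).fib m),
          coord φ' l m (fun k => w (r k)) = ((s l : ℤ) : ℝ) * coord φ (r l) m w) :
    HasType F r hr s := fun B => by
  obtain ⟨α, hα⟩ := hf B
  subst hF
  refine ⟨(Sigma.incl (B.relabel r hr)).mapIso α, fun φ φ' h => hα φ φ' ?_⟩
  refine (Sigma.incl (B.relabel r hr)).map_injective ?_
  exact ((Sigma.incl (B.relabel r hr)).map_comp ((f B).map φ) α.hom).trans
    (h.trans ((Sigma.incl (B.relabel r hr)).map_comp α.hom φ').symm)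

/-- The sign with which dualization along the axis `k` acts on the coordinate with label `l`: only
the coordinate with label `{0, k}` keeps its sign. -/
def dualSign (k : Fin 4) (l : Lab) : ℤˣ := if ∀ i, l.1.mem i = true ↔ i = 0 ∨ i = k then 1 else -1

theorem Lab.Opp.symm {l l' : Lab} (h : l.Opp l') : l'.Opp l := fun i => by rw [h i, Bool.not_not]

theorem Building.pair_swap (B : Building) {l l' : Lab} (h : l.Opp l') (m : B.base.pt)
    (v : (B.bundle l).fib m) (w : (B.bundle l').fib m) :
    (B.pair l l' h).b m v w = (B.pair l' l h.symm).b m w v := B.pair_symm l l' h h.symm m v w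

theorem eq_sign_mul_of_eq_neg {s : ℤˣ} (hs : s = -1) {x y : ℝ} (h : x = -y) :
    x = ((s : ℤ) : ℝ) * y := by
  rw [hs, h]; simp

theorem eq_sign_mul_of_eq {s : ℤˣ} (hs : s = 1) {x y : ℝ} (h : x = y) :
    x = ((s : ℤ) : ℝ) * y := by
  rw [hs, h]; simp

theorem hasType_X : HasType X (Lab.perm (swap 0 1)) (fun _ _ h => h.perm _) (dualSign 1) := by
  refine HasType.of_acts (f := dualXOn) rfl fun B => ?_
  obtain ⟨α, hα⟩ := acts_dualX (B.pair I₀ I₁₂₃ (by decide)) (B.pair I₀₂ I₁₃ (by decide))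
    (B.pair I₀₃ I₁₂ (by decide)) (B.pair I₀₂₃ I₁ (by decide))
  refine ⟨α, fun φ φ' h l m w => ?_⟩
  have H := hα φ φ' h m
  obtain ⟨⟨c₀, c₁, c₂, c₃⟩, hl⟩ := l
  have k := (B.pair_swap (l := I₁) (l' := I₀₂₃) (by decide) m (w I₁) _).trans
    (H.logRho (w I₀) (w I₂) (w I₃) (w I₁))
  cases c₀ <;> cases c₁ <;> cases c₂ <;> cases c₃
  · exact absurd hl (by decide)
  · exact eq_sign_mul_of_eq_neg rfl k
  · exact eq_sign_mul_of_eq_neg rfl k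
  · exact eq_sign_mul_of_eq_neg rfl ((B.pair_swap (l := I₁) (l' := I₀₂₃) _ m _ _).trans (H.g₁ _ _ _))
  · exact eq_sign_mul_of_eq_neg rfl k
  · exact eq_sign_mul_of_eq_neg rfl ((B.pair_swap (l := I₁) (l' := I₀₂₃) _ m _ _).trans (H.g₂ _ _ _))
  · exact eq_sign_mul_of_eq_neg rfl ((B.pair_swap (l := I₁) (l' := I₀₂₃) _ m _ _).trans (H.g₃ _ _ _))
  · exact eq_sign_mul_of_eq_neg rfl k
  · exact eq_sign_mul_of_eq_neg rfl k
  · exact eq_sign_mul_of_eq_neg rfl ((B.pair_swap (l := I₁₃) (l' := I₀₂) _ m _ _).trans (H.f₁₂ _ _ _))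
  · exact eq_sign_mul_of_eq_neg rfl ((B.pair_swap (l := I₁₂) (l' := I₀₃) _ m _ _).trans (H.f₁₃ _ _ _))
  · exact eq_sign_mul_of_eq_neg rfl k
  · exact eq_sign_mul_of_eq rfl (congrArg ((B.pair I₀₁ I₂₃ (by decide)).b m (w I₀₁)) (H.f₂₃ _ _))
  · exact eq_sign_mul_of_eq_neg rfl k
  · exact eq_sign_mul_of_eq_neg rfl k
  · exact absurd hl (by decide)

theorem hasType_Y : HasType Y (Lab.perm (swap 0 2)) (fun _ _ h => h.perm _) (dualSign 2) := by
  refine HasType.of_acts (f := dualYOn) rfl fun B => ?_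
  obtain ⟨α, hα⟩ := (acts_flip₁₂.comp (acts_dualX
    (B.pair I₀ I₁₂₃ (by decide)) (B.pair I₀₁ I₂₃ (by decide))
    (B.pair I₀₃ I₁₂ (by decide)) (B.pair I₀₁₃ I₂ (by decide)))).comp acts_flip₁₂
  refine ⟨α, fun φ φ' h l m w => ?_⟩
  obtain ⟨ψ', ⟨ψ, h₁, h₂⟩, h₃⟩ := hα φ φ' h
  have H := (h₂ m).flip₁₂ (h₁ m) (h₃ m)
  obtain ⟨⟨c₀, c₁, c₂, c₃⟩, hl⟩ := l
  have k := (B.pair_swap (l := I₂) (l' := I₀₁₃) (by decide) m (w I₂) _).trans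
    (H.logRho (w I₁) (w I₀) (w I₃) (w I₂))
  cases c₀ <;> cases c₁ <;> cases c₂ <;> cases c₃
  · exact absurd hl (by decide)
  · exact eq_sign_mul_of_eq_neg rfl k
  · exact eq_sign_mul_of_eq_neg rfl k
  · exact eq_sign_mul_of_eq_neg rfl ((B.pair_swap (l := I₂) (l' := I₀₁₃) _ m _ _).trans (H.g₁ _ _ _))
  · exact eq_sign_mul_of_eq_neg rfl k
  · exact eq_sign_mul_of_eq_neg rfl ((B.pair_swap (l := I₂) (l' := I₀₁₃) _ m _ _).trans (H.g₂ _ _ _))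
  · exact eq_sign_mul_of_eq_neg rfl ((B.pair_swap (l := I₂) (l' := I₀₁₃) _ m _ _).trans (H.g₃ _ _ _))
  · exact eq_sign_mul_of_eq_neg rfl k
  · exact eq_sign_mul_of_eq_neg rfl k
  · exact eq_sign_mul_of_eq_neg rfl ((B.pair_swap (l := I₂₃) (l' := I₀₁) _ m _ _).trans (H.f₁₂ _ _ _))
  · exact eq_sign_mul_of_eq rfl (congrArg ((B.pair I₀₂ I₁₃ (by decide)).b m (w I₀₂)) (H.f₁₃ _ _))
  · exact eq_sign_mul_of_eq_neg rfl k
  · exact eq_sign_mul_of_eq_neg rfl ((B.pair_swap (l := I₁₂) (l' := I₀₃) _ m _ _).trans (H.f₂₃ _ _ _))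
  · exact eq_sign_mul_of_eq_neg rfl k
  · exact eq_sign_mul_of_eq_neg rfl k
  · exact absurd hl (by decide)

theorem hasType_Z : HasType Z (Lab.perm (swap 0 3)) (fun _ _ h => h.perm _) (dualSign 3) := by
  refine HasType.of_acts (f := dualZOn) rfl fun B => ?_
  obtain ⟨α, hα⟩ := (acts_flip₁₃.comp (acts_dualX
    (B.pair I₀ I₁₂₃ (by decide)) (B.pair I₀₂ I₁₃ (by decide))
    (B.pair I₀₁ I₂₃ (by decide)) (B.pair I₀₁₂ I₃ (by decide)))).comp acts_flip₁₃
  refine ⟨α, fun φ φ' h l m w => ?_⟩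
  obtain ⟨ψ', ⟨ψ, h₁, h₂⟩, h₃⟩ := hα φ φ' h
  have H := (h₂ m).flip₁₃ (h₁ m) (h₃ m)
  obtain ⟨⟨c₀, c₁, c₂, c₃⟩, hl⟩ := l
  have k := (B.pair_swap (l := I₃) (l' := I₀₁₂) (by decide) m (w I₃) _).trans
    (H.logRho (w I₁) (w I₂) (w I₀) (w I₃))
  cases c₀ <;> cases c₁ <;> cases c₂ <;> cases c₃
  · exact absurd hl (by decide)
  · exact eq_sign_mul_of_eq_neg rfl k
  · exact eq_sign_mul_of_eq_neg rfl k
  · exact eq_sign_mul_of_eq_neg rfl ((B.pair_swap (l := I₃) (l' := I₀₁₂) _ m _ _).trans (H.g₁ _ _ _))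
  · exact eq_sign_mul_of_eq_neg rfl k
  · exact eq_sign_mul_of_eq_neg rfl ((B.pair_swap (l := I₃) (l' := I₀₁₂) _ m _ _).trans (H.g₂ _ _ _))
  · exact eq_sign_mul_of_eq_neg rfl ((B.pair_swap (l := I₃) (l' := I₀₁₂) _ m _ _).trans (H.g₃ _ _ _))
  · exact eq_sign_mul_of_eq_neg rfl k
  · exact eq_sign_mul_of_eq_neg rfl k
  · exact eq_sign_mul_of_eq rfl (congrArg ((B.pair I₀₃ I₁₂ (by decide)).b m (w I₀₃)) (H.f₁₂ _ _))
  · exact eq_sign_mul_of_eq_neg rfl ((B.pair_swap (l := I₂₃) (l' := I₀₁) _ m _ _).trans (H.f₁₃ _ _ _))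
  · exact eq_sign_mul_of_eq_neg rfl k
  · exact eq_sign_mul_of_eq_neg rfl ((B.pair_swap (l := I₁₃) (l' := I₀₂) _ m _ _).trans (H.f₂₃ _ _ _))
  · exact eq_sign_mul_of_eq_neg rfl k
  · exact eq_sign_mul_of_eq_neg rfl k
  · exact absurd hl (by decide)

end TripleVB

namespace TripleVB

open CategoryTheory Equiv

/-! ### A functor is determined by its action on coordinates -/

theorem SmoothPairing.eq_of_forall {M : Base} {V W : VecBdl M} (P : SmoothPairing V W) (m : M.pt)
    {x y : W.fib m} (h : ∀ v, P.b m v x = P.b m v y) : x = y := by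
  rw [← sub_eq_zero, ← Module.forall_dual_apply_eq_zero_iff ℝ]
  intro f
  obtain ⟨v, rfl⟩ := (P.perfect m).2 f
  rw [map_sub, h, sub_self]

open Classical in
/-- A dependent family with four prescribed values. -/
theorem exists_family {ι : Type} {F : ι → Type} [∀ i, Zero (F i)] {i₀ i₁ i₂ i₃ : ι} (h₀₁ : i₀ ≠ i₁)
    (h₀₂ : i₀ ≠ i₂) (h₀₃ : i₀ ≠ i₃) (h₁₂ : i₁ ≠ i₂) (h₁₃ : i₁ ≠ i₃) (h₂₃ : i₂ ≠ i₃) (a₀ : F i₀)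
    (a₁ : F i₁) (a₂ : F i₂) (a₃ : F i₃) :
    ∃ w : ∀ i, F i, w i₀ = a₀ ∧ w i₁ = a₁ ∧ w i₂ = a₂ ∧ w i₃ = a₃ := by
  refine ⟨Function.update (Function.update (Function.update (Function.update 0 i₀ a₀) i₁ a₁) i₂ a₂)
    i₃ a₃, ?_, ?_, ?_, ?_⟩ <;>
  simp [Function.update_of_ne, *]

open Classical in
/-- A family indexed along an injective map extends by zero. -/
theorem exists_comp_eq {ι κ : Type} {F : κ → Type} [∀ k, Zero (F k)] {r : ι → κ}
    (hr : Function.Injective r) (w' : ∀ i, F (r i)) : ∃ w : ∀ k, F k, ∀ i, w (r i) = w' i := by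
  refine ⟨fun k => if h : ∃ i, r i = k then h.choose_spec ▸ w' h.choose else 0, fun i => ?_⟩
  have h : ∃ j, r j = r i := ⟨i, rfl⟩
  simp only [dif_pos h]
  have key : ∀ j (e : r j = r i), (e ▸ w' j : F (r i)) = w' i := fun j e => by
    obtain rfl := hr e; rfl
  exact key _ h.choose_spec

/-- The coordinates of a statomorphism determine it. -/
theorem coord_ext {B : Building} {φ ψ : B.dec ⟶ B.dec}
    (h : ∀ l m w, coord φ l m w = coord ψ l m w) : φ = ψ := by
  refine isoAt_ext fun m => TVS.Iso.ext_components (fun a b => ?_) (fun a b => ?_) (fun a b => ?_)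
    (fun a b => ?_) (fun a b => ?_) (fun a b => ?_) fun a b c => ?_
  · refine (B.pair I₀₃ I₁₂ (by decide)).eq_of_forall m fun v => ?_
    obtain ⟨w, rfl, rfl, rfl, -⟩ := exists_family (F := fun l => (B.bundle l).fib m) (i₀ := I₀₃)
      (i₁ := I₁) (i₂ := I₂) (i₃ := I₀) (by simp [Lab.mk]) (by simp [Lab.mk]) (by simp [Lab.mk])
      (by simp [Lab.mk]) (by simp [Lab.mk]) (by simp [Lab.mk]) v a b 0
    exact h I₀₃ m w
  · refine (B.pair I₀₂ I₁₃ (by decide)).eq_of_forall m fun v => ?_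
    obtain ⟨w, rfl, rfl, rfl, -⟩ := exists_family (F := fun l => (B.bundle l).fib m) (i₀ := I₀₂)
      (i₁ := I₁) (i₂ := I₃) (i₃ := I₀) (by simp [Lab.mk]) (by simp [Lab.mk]) (by simp [Lab.mk])
      (by simp [Lab.mk]) (by simp [Lab.mk]) (by simp [Lab.mk]) v a b 0
    exact h I₀₂ m w
  · refine (B.pair I₀₁ I₂₃ (by decide)).eq_of_forall m fun v => ?_
    obtain ⟨w, rfl, rfl, rfl, -⟩ := exists_family (F := fun l => (B.bundle l).fib m) (i₀ := I₀₁)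
      (i₁ := I₂) (i₂ := I₃) (i₃ := I₀) (by simp [Lab.mk]) (by simp [Lab.mk]) (by simp [Lab.mk])
      (by simp [Lab.mk]) (by simp [Lab.mk]) (by simp [Lab.mk]) v a b 0
    exact h I₀₁ m w
  · refine (B.pair I₀ I₁₂₃ (by decide)).eq_of_forall m fun v => ?_
    obtain ⟨w, rfl, rfl, rfl, -⟩ := exists_family (F := fun l => (B.bundle l).fib m) (i₀ := I₀)
      (i₁ := I₁) (i₂ := I₂₃) (i₃ := I₀₁) (by simp [Lab.mk]) (by simp [Lab.mk]) (by simp [Lab.mk])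
      (by simp [Lab.mk]) (by simp [Lab.mk]) (by simp [Lab.mk]) v a b 0
    exact h I₂₃ m w
  · refine (B.pair I₀ I₁₂₃ (by decide)).eq_of_forall m fun v => ?_
    obtain ⟨w, rfl, rfl, rfl, -⟩ := exists_family (F := fun l => (B.bundle l).fib m) (i₀ := I₀)
      (i₁ := I₂) (i₂ := I₁₃) (i₃ := I₀₁) (by simp [Lab.mk]) (by simp [Lab.mk]) (by simp [Lab.mk])
      (by simp [Lab.mk]) (by simp [Lab.mk]) (by simp [Lab.mk]) v a b 0
    exact h I₁₃ m w
  · refine (B.pair I₀ I₁₂₃ (by decide)).eq_of_forall m fun v => ?_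
    obtain ⟨w, rfl, rfl, rfl, -⟩ := exists_family (F := fun l => (B.bundle l).fib m) (i₀ := I₀)
      (i₁ := I₃) (i₂ := I₁₂) (i₃ := I₀₁) (by simp [Lab.mk]) (by simp [Lab.mk]) (by simp [Lab.mk])
      (by simp [Lab.mk]) (by simp [Lab.mk]) (by simp [Lab.mk]) v a b 0
    exact h I₁₂ m w
  · refine (B.pair I₀ I₁₂₃ (by decide)).eq_of_forall m fun v => ?_
    obtain ⟨w, rfl, rfl, rfl, rfl⟩ := exists_family (F := fun l => (B.bundle l).fib m) (i₀ := I₀)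
      (i₁ := I₁) (i₂ := I₂) (i₃ := I₃) (by simp [Lab.mk]) (by simp [Lab.mk]) (by simp [Lab.mk])
      (by simp [Lab.mk]) (by simp [Lab.mk]) (by simp [Lab.mk]) v a b c
    exact h I₀ m w

/-- A splitting, as an isomorphism with the decomposed triple vector bundle. -/
def splitting (E : TripleVectorBundle) : E ≅ E.1.obj :=
  (Sigma.incl E.1).mapIso ((Groupoid.isoEquivHom E.2 E.1.dec).symm (TVB.decomp E.2 :))

/-- Conjugation with splittings turns every statomorphism into one of the decomposed bundle. -/
theorem exists_endo {B : Building} {E E' : B.TVB} (f : E ⟶ E') : ∃ φ : B.dec ⟶ B.dec,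
    (Sigma.incl B).map f = (splitting ⟨B, E⟩).hom ≫ Building.endo φ ≫ (splitting ⟨B, E'⟩).inv := by
  obtain ⟨φ, hφ⟩ := Building.endo_surjective
    ((splitting ⟨B, E⟩).inv ≫ (Sigma.incl B).map f ≫ (splitting ⟨B, E'⟩).hom)
  exact ⟨φ, by rw [hφ]; simp⟩

/-- Functors of the same type are isomorphic: they have the same action on the statomorphisms of the
decomposed bundles, and every object is isomorphic to a decomposed one by a splitting. -/
theorem HasType.nonempty_iso {F G : TripleVectorBundle ⥤ TripleVectorBundle} {r hr s}
    (hF : HasType F r hr s) (hG : HasType G r hr s) (hr' : Function.Injective r) :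
    Nonempty (F ≅ G) := by
  choose α hα using hF
  choose β hβ using hG
  have key : ∀ (B : Building) (φ : B.dec ⟶ B.dec), F.map (Building.endo φ) ≫ (α B ≪≫ (β B).symm).hom =
      (α B ≪≫ (β B).symm).hom ≫ G.map (Building.endo φ) := fun B φ => by
    obtain ⟨φ', hφ'⟩ := Building.endo_surjective ((α B).inv ≫ F.map (Building.endo φ) ≫ (α B).hom)
    obtain ⟨ψ', hψ'⟩ := Building.endo_surjective ((β B).inv ≫ G.map (Building.endo φ) ≫ (β B).hom)
    have h : φ' = ψ' := coord_ext fun l (m : B.base.pt) w' => by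
      obtain ⟨w, hw⟩ := exists_comp_eq (F := fun l => (B.bundle l).fib m) hr' w'
      obtain rfl : (fun k => w (r k)) = w' := funext hw
      rw [hα B φ φ' (by rw [hφ']; simp) l m w, hβ B φ ψ' (by rw [hψ']; simp) l m w]
    rw [← h, hφ'] at hψ'
    have h' := congrArg (fun f => (α B).hom ≫ f ≫ (β B).inv) hψ'
    simpa using h'
  refine ⟨NatIso.ofComponents (fun E => F.mapIso (splitting E) ≪≫ (α E.1 ≪≫ (β E.1).symm) ≪≫
    G.mapIso (splitting E).symm) fun {E E'} f => ?_⟩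
  obtain ⟨B, E⟩ := E
  obtain ⟨B', E'⟩ := E'
  obtain ⟨f⟩ := f
  obtain ⟨φ, hφ⟩ := exists_endo f
  have k := key B φ
  generalize α B ≪≫ (β B).symm = γ at k ⊢
  change F.map ((Sigma.incl B).map f) ≫ _ = _ ≫ G.map ((Sigma.incl B).map f)
  rw [hφ]
  simp [reassoc_of% k]

/-- Objects joined by a morphism have the same building bundles. -/
theorem fst_eq_of_hom {E E' : TripleVectorBundle} (f : E ⟶ E') : E.1 = E'.1 := by
  obtain ⟨B, E⟩ := E
  obtain ⟨B', E'⟩ := E'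
  change Sigma.SigmaHom _ _ at f
  cases f
  rfl

theorem HasType.fst_eq {F : TripleVectorBundle ⥤ TripleVectorBundle} {r hr s}
    (hF : HasType F r hr s) (E : TripleVectorBundle) : (F.obj E).1 = E.1.relabel r hr := by
  obtain ⟨α, -⟩ := hF E.1
  exact fst_eq_of_hom (F.map (splitting E).hom ≫ α.hom)

end TripleVB

namespace TripleVB

/-! ### A decomposed triple vector bundle with many statomorphisms -/

section Line

open scoped Manifold ContDiff
open Bundle CategoryTheory Equiv

/-- A one-point manifold. -/
def pointBase : Base where
  dim := 0
  pt := EuclideanSpace ℝ (Fin 0)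

/-- The trivial line bundle over a point. -/
def lineBdl : VecBdl pointBase where
  F := ℝ
  fib := Bundle.Trivial pointBase.pt ℝ

section
variable {E H N : Type} [NormedAddCommGroup E] [NormedSpace ℝ E] [TopologicalSpace H]
  {J : ModelWithCorners ℝ E H} [TopologicalSpace N] [ChartedSpace H N]

theorem contMDiffAt_line {b : N → pointBase.pt} {v : N → ℝ} {n₀ : N} :
    ContMDiffAt J lineBdl.I ∞ (fun n => (⟨b n, v n⟩ : lineBdl.Tot)) n₀ ↔
      ContMDiffAt J (𝓡 pointBase.dim) ∞ b n₀ ∧ ContMDiffAt J 𝓘(ℝ) ∞ v n₀ := by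
  rw [contMDiffAt_totalSpace]
  rfl

theorem contMDiffAt_mul {f g : N → ℝ} {n₀ : N} (hf : ContMDiffAt J 𝓘(ℝ) ∞ f n₀)
    (hg : ContMDiffAt J 𝓘(ℝ) ∞ g n₀) : ContMDiffAt J 𝓘(ℝ) ∞ (fun n => f n * g n) n₀ :=
  hf.smul hg

end

theorem mul_perfect : Function.Bijective (LinearMap.mul ℝ ℝ) := by
  refine ⟨fun x y h => ?_, fun f => ⟨f 1, LinearMap.ext_ring (by simp)⟩⟩
  simpa using LinearMap.congr_fun h 1

/-- The building bundles are trivial lines over a point, paired by multiplication. -/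
def lineBuilding : Building where
  base := pointBase
  bundle _ := lineBdl
  pair _ _ _ :=
    { b := fun _ => LinearMap.mul ℝ ℝ
      perfect := fun _ => mul_perfect
      smooth := fun p => by
        have h := contMDiffAt_prod_iff.1 (contMDiffAt_id (I := (lineBdl.prod lineBdl).I) (n := ∞)
          (x := p))
        exact contMDiffAt_mul (contMDiffAt_line.1 h.1).2 (contMDiffAt_line.1 h.2).2 }
  pair_symm _ _ _ _ _ _ _ := mul_comm (G := ℝ) _ _

/-- The statomorphism `(a, b, x) ↦ (a, b, x + p a b)` of the double vector space `ℝ³`. -/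
def shear (p : ℝ) : (DVS.dec ℝ ℝ ℝ).Iso (DVS.dec ℝ ℝ ℝ) where
  e := ⟨fun x => (x.1, x.2.1, x.2.2 + p * (x.1 * x.2.1)),
    fun x => (x.1, x.2.1, x.2.2 + -p * (x.1 * x.2.1)), fun x => by simp, fun x => by simp⟩
  homA := ⟨fun _ => rfl, fun x y (h : x.1 = y.1) => by simp [h]; ring, fun t x => by simp; ring⟩
  homB := ⟨fun _ => rfl, fun x y (h : x.2.1 = y.2.1) => by simp [h]; ring, fun t x => by simp; ring⟩
  core c := by simp

theorem diffeo_shear (p : ℝ) : IsDiffeo (lineBdl.prod (lineBdl.prod lineBdl)).str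
    (lineBdl.prod (lineBdl.prod lineBdl)).str (tot fun _ => (shear p).e) := by
  have key : ∀ p : ℝ, (lineBdl.prod (lineBdl.prod lineBdl)).str.Smooth
      (lineBdl.prod (lineBdl.prod lineBdl)).str (tot fun _ => (shear p).e) := by
    intro p
    let L := lineBdl.prod (lineBdl.prod lineBdl)
    let f : L.Tot → ℝ × ℝ × ℝ := fun n => n.2
    suffices h : ∀ n₀ : L.Tot, ContMDiffAt L.I L.I ∞
        (fun n : L.Tot => (⟨n.1, (shear p).e (f n)⟩ : L.Tot)) n₀ from h
    intro n₀
    obtain ⟨h₁, h₂, h₃⟩ := (contMDiffAt_triple (J := L.I) (A := lineBdl) (B := lineBdl) (C := lineBdl)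
      (b := fun n : L.Tot => n.1) (f := f) (n₀ := n₀)).1 contMDiffAt_id
    obtain ⟨hb, k₁⟩ := contMDiffAt_line.1 h₁
    have k₂ := (contMDiffAt_line.1 h₂).2
    have k₃ := (contMDiffAt_line.1 h₃).2
    exact contMDiffAt_triple.2 ⟨h₁, h₂, contMDiffAt_line.2 ⟨hb,
      k₃.add (contMDiffAt_mul contMDiffAt_const (contMDiffAt_mul k₁ k₂))⟩⟩
  exact ⟨key p, key (-p)⟩

/-- The map of `ℝ⁷` which sends `(a, b, c, x, y, z, u)` to
`(a, b, c, x + p a b, y + q a c, z + r b c, u + l a z + m b y + n c x + k a b c)`. -/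
def shearFun (p q r l m n k : ℝ) (t : ℝ × ℝ × ℝ × ℝ × ℝ × ℝ × ℝ) : ℝ × ℝ × ℝ × ℝ × ℝ × ℝ × ℝ :=
  (t.1, t.2.1, t.2.2.1, t.2.2.2.1 + p * (t.1 * t.2.1), t.2.2.2.2.1 + q * (t.1 * t.2.2.1),
    t.2.2.2.2.2.1 + r * (t.2.1 * t.2.2.1),
    t.2.2.2.2.2.2 + l * (t.1 * t.2.2.2.2.2.1) + m * (t.2.1 * t.2.2.2.2.1) +
      n * (t.2.2.1 * t.2.2.2.1) + k * (t.1 * (t.2.1 * t.2.2.1)))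

theorem shearFun_neg (p q r l m n k : ℝ) (t) :
    shearFun (-p) (-q) (-r) (-l) (-m) (-n) (l * r + m * q + n * p - k) (shearFun p q r l m n k t) =
      t := by
  simp only [shearFun, Prod.ext_iff]
  refine ⟨trivial, trivial, trivial, ?_, ?_, ?_, ?_⟩ <;> ring

theorem smooth_shearFun (p q r l m n k : ℝ) :
    (BT lineBdl lineBdl lineBdl lineBdl lineBdl lineBdl lineBdl).str.Smooth
      (BT lineBdl lineBdl lineBdl lineBdl lineBdl lineBdl lineBdl).str
      (fun x => ⟨x.1, shearFun p q r l m n k x.2⟩) := by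
  let L := BT lineBdl lineBdl lineBdl lineBdl lineBdl lineBdl lineBdl
  let f : L.Tot → ℝ × ℝ × ℝ × ℝ × ℝ × ℝ × ℝ := fun n => n.2
  suffices h : ∀ n₀ : L.Tot, ContMDiffAt L.I L.I ∞
      (fun t : L.Tot => (⟨t.1, shearFun p q r l m n k (f t)⟩ : L.Tot)) n₀ from h
  intro n₀
  obtain ⟨h₁, h₂, h₃, h₄, h₅, h₆, h₇⟩ := (contMDiffAt_tuple (J := L.I) (V₁ := lineBdl)
    (V₂ := lineBdl) (V₃ := lineBdl) (V₁₂ := lineBdl) (V₁₃ := lineBdl) (V₂₃ := lineBdl)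
    (V₁₂₃ := lineBdl) (b := fun n : L.Tot => n.1) (f := f) (n₀ := n₀)).1 contMDiffAt_id
  obtain ⟨hb, k₁⟩ := contMDiffAt_line.1 h₁
  have k₂ := (contMDiffAt_line.1 h₂).2
  have k₃ := (contMDiffAt_line.1 h₃).2
  have k₄ := (contMDiffAt_line.1 h₄).2
  have k₅ := (contMDiffAt_line.1 h₅).2
  have k₆ := (contMDiffAt_line.1 h₆).2
  have k₇ := (contMDiffAt_line.1 h₇).2
  exact contMDiffAt_tuple.2 ⟨h₁, h₂, h₃,
    contMDiffAt_line.2 ⟨hb, k₄.add (contMDiffAt_mul contMDiffAt_const (contMDiffAt_mul k₁ k₂))⟩,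
    contMDiffAt_line.2 ⟨hb, k₅.add (contMDiffAt_mul contMDiffAt_const (contMDiffAt_mul k₁ k₃))⟩,
    contMDiffAt_line.2 ⟨hb, k₆.add (contMDiffAt_mul contMDiffAt_const (contMDiffAt_mul k₂ k₃))⟩,
    contMDiffAt_line.2 ⟨hb, (((k₇.add (contMDiffAt_mul contMDiffAt_const (contMDiffAt_mul k₁ k₆))).add
      (contMDiffAt_mul contMDiffAt_const (contMDiffAt_mul k₂ k₅))).add
      (contMDiffAt_mul contMDiffAt_const (contMDiffAt_mul k₃ k₄))).add
      (contMDiffAt_mul contMDiffAt_const (contMDiffAt_mul k₁ (contMDiffAt_mul k₂ k₃)))⟩⟩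

/-- The statomorphism `shearFun` of `ℝ⁷`. Its inverse is a map of the same form: the last
coefficient of the inverse is corrected by the products of the bilinear ones. -/
def shearIso (p q r l m n k : ℝ) : (TVS.dec ℝ ℝ ℝ ℝ ℝ ℝ ℝ).Iso (TVS.dec ℝ ℝ ℝ ℝ ℝ ℝ ℝ) where
  i₁₂ := shear p
  i₁₃ := shear q
  i₂₃ := shear r
  e := ⟨shearFun p q r l m n k,
    shearFun (-p) (-q) (-r) (-l) (-m) (-n) (l * r + m * q + n * p - k), shearFun_neg _ _ _ _ _ _ _,
    fun t => by
      have h := shearFun_neg (-p) (-q) (-r) (-l) (-m) (-n) (l * r + m * q + n * p - k) t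
      have e : -l * -r + -m * -q + -n * -p - (l * r + m * q + n * p - k) = k := by ring
      rwa [e, neg_neg, neg_neg, neg_neg, neg_neg, neg_neg, neg_neg] at h⟩
  hom₁₂ :=
    { proj := fun _ => rfl
      add := by
        rintro ⟨a, b, c, x, y, z, u⟩ ⟨a', b', c', x', y', z', u'⟩ h
        obtain ⟨rfl, rfl, rfl⟩ : a = a' ∧ b = b' ∧ x = x' := by simpa using h
        simp only [shearFun, Equiv.coe_fn_mk, Prod.mk.injEq]
        refine ⟨trivial, trivial, trivial, trivial, ?_, ?_, ?_⟩ <;> ring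
      smul := by
        rintro s ⟨a, b, c, x, y, z, u⟩
        simp only [shearFun, Equiv.coe_fn_mk, Prod.mk.injEq, smul_eq_mul]
        refine ⟨trivial, trivial, trivial, trivial, ?_, ?_, ?_⟩ <;> ring }
  hom₁₃ :=
    { proj := fun _ => rfl
      add := by
        rintro ⟨a, b, c, x, y, z, u⟩ ⟨a', b', c', x', y', z', u'⟩ h
        obtain ⟨rfl, rfl, rfl⟩ : a = a' ∧ c = c' ∧ y = y' := by simpa using h
        simp only [shearFun, Equiv.coe_fn_mk, Prod.mk.injEq]
        refine ⟨trivial, trivial, trivial, ?_, trivial, ?_, ?_⟩ <;> ring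
      smul := by
        rintro s ⟨a, b, c, x, y, z, u⟩
        simp only [shearFun, Equiv.coe_fn_mk, Prod.mk.injEq, smul_eq_mul]
        refine ⟨trivial, trivial, trivial, ?_, trivial, ?_, ?_⟩ <;> ring }
  hom₂₃ :=
    { proj := fun _ => rfl
      add := by
        rintro ⟨a, b, c, x, y, z, u⟩ ⟨a', b', c', x', y', z', u'⟩ h
        obtain ⟨rfl, rfl, rfl⟩ : b = b' ∧ c = c' ∧ z = z' := by simpa using h
        simp only [shearFun, Equiv.coe_fn_mk, Prod.mk.injEq]
        refine ⟨trivial, trivial, trivial, ?_, ?_, trivial, ?_⟩ <;> ring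
      smul := by
        rintro s ⟨a, b, c, x, y, z, u⟩
        simp only [shearFun, Equiv.coe_fn_mk, Prod.mk.injEq, smul_eq_mul]
        refine ⟨trivial, trivial, trivial, ?_, ?_, trivial, ?_⟩ <;> ring }
  core u := by simp [shearFun]

/-- A statomorphism of the decomposed triple vector bundle whose bilinear components are pairwise
different positive numbers. -/
def testEndo : lineBuilding.dec ⟶ lineBuilding.dec :=
  (⟨fun _ => shearIso 1 2 3 4 5 6 0, diffeo_shear 1, diffeo_shear 2, diffeo_shear 3,
    smooth_shearFun _ _ _ _ _ _ _, smooth_shearFun _ _ _ _ _ _ _⟩ : PreTVB.Iso _ _)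

end Line

end TripleVB

namespace TripleVB

open CategoryTheory Equiv

/-! ### The type of a functor is well-defined -/

/-- A subset as a quadruple of truth values. -/
def fourEquiv : Four ≃ Bool × Bool × Bool × Bool where
  toFun l := (l.c₀, l.c₁, l.c₂, l.c₃)
  invFun t := ⟨t.1, t.2.1, t.2.2.1, t.2.2.2⟩

instance : DecidableEq Four := fourEquiv.decidableEq
instance : Fintype Four := Fintype.ofEquiv _ fourEquiv.symm

/-- `l` has two elements. -/
def Lab.IsPair (l : Lab) : Prop :=
  l.1.c₀.toNat + l.1.c₁.toNat + l.1.c₂.toNat + l.1.c₃.toNat = 2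

instance : DecidablePred Lab.IsPair := fun _ => inferInstanceAs (Decidable (_ = 2))

theorem Lab.perm_mul (σ τ : Perm (Fin 4)) (l : Lab) : l.perm (σ * τ) = (l.perm τ).perm σ := by
  apply Subtype.ext
  change l.1.perm (σ * τ) = (l.1.perm τ).perm σ
  simp only [Four.perm]
  simp only [Four.mem, Four.mk.injEq]
  refine ⟨?_, ?_, ?_, ?_⟩ <;> exact (Four.mem_perm τ l.1 _).symm

theorem Lab.perm_injective (σ : Perm (Fin 4)) : Function.Injective (Lab.perm σ) := fun l l' h => by
  have := congrArg (Lab.perm σ⁻¹) h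
  rwa [← Lab.perm_mul, ← Lab.perm_mul, inv_mul_cancel] at this

theorem Lab.IsPair.perm {l : Lab} (h : l.IsPair) (σ : Perm (Fin 4)) : (l.perm σ).IsPair := by
  revert σ l
  decide +kernel

/-- The action on the two-element subsets is faithful. -/
theorem eq_one_of_perm_pair {σ : Perm (Fin 4)} (h : ∀ l : Lab, l.IsPair → l.perm σ = l) : σ = 1 := by
  revert σ
  decide +kernel

theorem map_eq_add {V : Type} [AddCommGroup V] [Module ℝ V] (f : V →ₗ[ℝ] ℝ) {x y z : V}
    (h : x = y + z) : f x = f y + f z := by rw [h, map_add]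

/-- The bilinear coordinates are additive. The trilinear coordinate is not, since the group of
statomorphisms is not commutative. -/
theorem coord_comp {B : Building} (φ ψ : B.dec ⟶ B.dec) {l : Lab} (hl : l.IsPair) (m w) :
    coord (φ ≫ ψ) l m w = coord φ l m w + coord ψ l m w := by
  obtain ⟨⟨c₀, c₁, c₂, c₃⟩, h⟩ := l
  cases c₀ <;> cases c₁ <;> cases c₂ <;> cases c₃
  · exact absurd hl (by simp [Lab.IsPair])
  · exact absurd hl (by simp [Lab.IsPair])
  · exact absurd hl (by simp [Lab.IsPair])
  · exact map_eq_add ((B.pair I₀ I₁₂₃ (by decide)).b m (w I₀))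
      (TVS.Iso.g₁_trans (isoAt φ m) (isoAt ψ m) _ _)
  · exact absurd hl (by simp [Lab.IsPair])
  · exact map_eq_add ((B.pair I₀ I₁₂₃ (by decide)).b m (w I₀))
      (TVS.Iso.g₂_trans (isoAt φ m) (isoAt ψ m) _ _)
  · exact map_eq_add ((B.pair I₀ I₁₂₃ (by decide)).b m (w I₀))
      (TVS.Iso.g₃_trans (isoAt φ m) (isoAt ψ m) _ _)
  · exact absurd hl (by simp [Lab.IsPair])
  · exact absurd hl (by simp [Lab.IsPair])
  · exact map_eq_add ((B.pair I₀₃ I₁₂ (by decide)).b m (w I₀₃))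
      (TVS.Iso.f₁₂_trans (isoAt φ m) (isoAt ψ m) _ _)
  · exact map_eq_add ((B.pair I₀₂ I₁₃ (by decide)).b m (w I₀₂))
      (TVS.Iso.f₁₃_trans (isoAt φ m) (isoAt ψ m) _ _)
  · exact absurd hl (by simp [Lab.IsPair])
  · exact map_eq_add ((B.pair I₀₁ I₂₃ (by decide)).b m (w I₀₁))
      (TVS.Iso.f₂₃_trans (isoAt φ m) (isoAt ψ m) _ _)
  · exact absurd hl (by simp [Lab.IsPair])
  · exact absurd hl (by simp [Lab.IsPair])
  · exact absurd hl (by simp [Lab.IsPair])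

/-- The coordinates of `testEndo` on the two-element subsets; the value on other subsets is not
used. -/
def testVal : Four → ℤ
  | ⟨true, true, false, false⟩ => 3
  | ⟨true, false, true, false⟩ => 2
  | ⟨true, false, false, true⟩ => 1
  | ⟨false, false, true, true⟩ => 4
  | ⟨false, true, false, true⟩ => 5
  | _ => 6

theorem coord_testEndo {l : Lab} (hl : l.IsPair) (m) :
    coord testEndo l m (fun _ => (1 : ℝ)) = testVal l.1 := by
  obtain ⟨⟨c₀, c₁, c₂, c₃⟩, h⟩ := l
  cases c₀ <;> cases c₁ <;> cases c₂ <;> cases c₃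
  · exact absurd hl (by simp [Lab.IsPair])
  · exact absurd hl (by simp [Lab.IsPair])
  · exact absurd hl (by simp [Lab.IsPair])
  · change (1 : ℝ) * (0 + 4 * (1 * 1) + 5 * (0 * 0) + 6 * (0 * 0) + 0 * (1 * (0 * 0))) = (4 : ℤ)
    norm_num
  · exact absurd hl (by simp [Lab.IsPair])
  · change (1 : ℝ) * (0 + 4 * (0 * 0) + 5 * (1 * 1) + 6 * (0 * 0) + 0 * (0 * (1 * 0))) = (5 : ℤ)
    norm_num
  · change (1 : ℝ) * (0 + 4 * (0 * 0) + 5 * (0 * 0) + 6 * (1 * 1) + 0 * (0 * (0 * 1))) = (6 : ℤ)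
    norm_num
  · exact absurd hl (by simp [Lab.IsPair])
  · exact absurd hl (by simp [Lab.IsPair])
  · change (1 : ℝ) * (0 + 1 * (1 * 1)) = (1 : ℤ)
    norm_num
  · change (1 : ℝ) * (0 + 2 * (1 * 1)) = (2 : ℤ)
    norm_num
  · exact absurd hl (by simp [Lab.IsPair])
  · change (1 : ℝ) * (0 + 3 * (1 * 1)) = (3 : ℤ)
    norm_num
  · exact absurd hl (by simp [Lab.IsPair])
  · exact absurd hl (by simp [Lab.IsPair])
  · exact absurd hl (by simp [Lab.IsPair])

/-- The values are non-zero and pairwise different in absolute value, so that they detect both the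
label and the sign. -/
theorem testVal_separates : ∀ l l' : Lab, l.IsPair → l'.IsPair → ∀ s t : ℤˣ,
    (s : ℤ) * testVal l.1 = t * testVal l'.1 → l = l' ∧ s = t := by
  decide +kernel

/-- The permutation and the signs on the bilinear components are determined by the functor. Two
choices of the isomorphism `α` in `HasType` differ by conjugation, which does not change the
bilinear coordinates because they are additive, so the two actions on `testEndo` agree. -/
theorem HasType.unique {F : TripleVectorBundle ⥤ TripleVectorBundle} {σ τ : Perm (Fin 4)} {hr hr' s t}
    (h : HasType F (Lab.perm σ) hr s) (h' : HasType F (Lab.perm τ) hr' t) :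
    σ = τ ∧ ∀ l : Lab, l.IsPair → s l = t l := by
  obtain ⟨α₀, hα₀⟩ := h lineBuilding
  obtain ⟨β₀, hβ₀⟩ := h' lineBuilding
  -- relabelling does not change `lineBuilding`
  let α : F.obj lineBuilding.obj ≅ lineBuilding.obj := α₀
  let β : F.obj lineBuilding.obj ≅ lineBuilding.obj := β₀
  obtain ⟨φ, hφ⟩ := Building.endo_surjective (α.inv ≫ F.map (Building.endo testEndo) ≫ α.hom)
  obtain ⟨ψ, hψ⟩ := Building.endo_surjective (β.inv ≫ F.map (Building.endo testEndo) ≫ β.hom)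
  obtain ⟨χ, hχ⟩ := Building.endo_surjective (α.inv ≫ β.hom)
  have hc : χ ≫ ψ = φ ≫ χ := Building.endo_injective (by
    change Building.endo χ ≫ Building.endo ψ = Building.endo φ ≫ Building.endo χ
    rw [hφ, hψ, hχ]; simp)
  let m : lineBuilding.base.pt := (0 : EuclideanSpace ℝ (Fin 0))
  let w : ∀ l, (lineBuilding.bundle l).fib m := fun _ => (1 : ℝ)
  have key : ∀ l : Lab, l.IsPair → l.perm σ = l.perm τ ∧ s l = t l := fun l hl => by
    have e : coord φ l m w = coord ψ l m w := by
      have : coord (χ ≫ ψ) l m w = coord (φ ≫ χ) l m w := by rw [hc]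
      rw [coord_comp _ _ hl, coord_comp _ _ hl, add_comm] at this
      exact (add_right_cancel this).symm
    have e₁ := hα₀ testEndo φ
      (show F.map (Building.endo testEndo) ≫ α.hom = α.hom ≫ Building.endo φ by rw [hφ]; simp) l m
      w
    have e₂ := hβ₀ testEndo ψ
      (show F.map (Building.endo testEndo) ≫ β.hom = β.hom ≫ Building.endo ψ by rw [hψ]; simp) l m
      w
    have e₃ := e₁.symm.trans (Eq.trans e e₂)
    rw [show coord testEndo _ m w = _ from coord_testEndo (hl.perm σ) m,
      show coord testEndo _ m w = _ from coord_testEndo (hl.perm τ) m] at e₃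
    exact testVal_separates _ _ (hl.perm σ) (hl.perm τ) _ _ (by exact_mod_cast e₃)
  refine ⟨?_, fun l hl => (key l hl).2⟩
  have : τ⁻¹ * σ = 1 := eq_one_of_perm_pair fun l hl => by
    rw [Lab.perm_mul, (key l hl).1, ← Lab.perm_mul, inv_mul_cancel]
    rfl
  exact (inv_mul_eq_one.1 this).symm

end TripleVB

namespace TripleVB

open CategoryTheory Equiv

/-! ### Signed permutations -/

/-- A permutation of `{0, 1, 2, 3}` with signs on the proper non-empty subsets: the type of a
functor which relabels the building bundles along `perm` and acts on coordinates with the signs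
`sign`. -/
structure SignedPerm where
  perm : Perm (Fin 4)
  sign : Lab → ℤˣ

/-- The type of `F ⋙ G` is the product of the types of `F` and `G`. -/
instance : Mul SignedPerm :=
  ⟨fun a b => ⟨a.perm * b.perm, fun l => b.sign l * a.sign (l.perm b.perm)⟩⟩

instance : One SignedPerm := ⟨⟨1, 1⟩⟩

/-- Some, equivalently every, functor in the class `x` has type `t`. -/
def FunctorClass.HasType (x : FunctorClass) (t : SignedPerm) : Prop :=
  ∃ F, FunctorClass.of F = x ∧
    TripleVB.HasType F (Lab.perm t.perm) (fun _ _ h => h.perm t.perm) t.sign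

theorem FunctorClass.HasType.of {F : TripleVectorBundle ⥤ TripleVectorBundle} {t : SignedPerm}
    (h : (FunctorClass.of F).HasType t) :
    TripleVB.HasType F (Lab.perm t.perm) (fun _ _ h => h.perm t.perm) t.sign := by
  obtain ⟨G, hG, h⟩ := h
  obtain ⟨i⟩ := FunctorClass.of_eq.1 hG
  exact h.of_iso i.symm

theorem HasType.congr {F : TripleVectorBundle ⥤ TripleVectorBundle} {r r' hr hr' s}
    (h : HasType F r hr s) (e : r = r') : HasType F r' hr' s := by
  subst e; exact h

theorem FunctorClass.HasType.mul {x y : FunctorClass} {t u : SignedPerm} (hx : x.HasType t)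
    (hy : y.HasType u) : (x * y).HasType (t * u) := by
  obtain ⟨F, rfl, hF⟩ := hx
  obtain ⟨G, rfl, hG⟩ := hy
  exact ⟨F ⋙ G, rfl, (hF.comp hG).congr (funext fun l => (Lab.perm_mul _ _ l).symm)⟩

theorem FunctorClass.HasType.one : (1 : FunctorClass).HasType 1 := ⟨𝟭 _, rfl, HasType.id⟩

theorem FunctorClass.HasType.eq {x y : FunctorClass} {t : SignedPerm} (hx : x.HasType t)
    (hy : y.HasType t) : x = y := by
  obtain ⟨F, rfl, hF⟩ := hx
  obtain ⟨G, rfl, hG⟩ := hy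
  exact FunctorClass.of_eq.2 (hF.nonempty_iso hG (Lab.perm_injective _))

theorem FunctorClass.HasType.unique {x : FunctorClass} {t u : SignedPerm} (ht : x.HasType t)
    (hu : x.HasType u) : t.perm = u.perm ∧ ∀ l : Lab, l.IsPair → t.sign l = u.sign l := by
  obtain ⟨F, rfl, hF⟩ := ht
  exact TripleVB.HasType.unique hF hu.of

/-- The sign `-1` for subsets which do not contain `0`, and `1` for the others. -/
def zeroSign (l : Lab) : ℤˣ := if l.1.mem 0 then 1 else -1

/-- The constraints on the signs of a composition of the three dualization functors. Each right-hand
side has the form `sign σ * (c x * c (σ x))`, so that the factors in the middle cancel in a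
composition and the constraints are stable under it. Over the identity permutation they say that
complementary pairs have the same sign and that the product of the signs of the three pairs through
a point is `1`. -/
structure SignedPerm.Admissible (t : SignedPerm) : Prop where
  not_pair : ∀ l : Lab, ¬l.IsPair → t.sign l = Perm.sign t.perm
  opp : ∀ l l' : Lab, l.IsPair → l.Opp l' →
    t.sign l * t.sign l' = Perm.sign t.perm * (zeroSign l * zeroSign (l.perm t.perm))
  star : ∀ i : Fin 4, ∏ l : Lab with l.IsPair ∧ l.1.mem i = true, t.sign l =
    Perm.sign t.perm * ((if i = 0 then -1 else 1) * if t.perm i = 0 then -1 else 1)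

theorem Lab.not_isPair_perm {l : Lab} (h : ¬l.IsPair) (σ : Perm (Fin 4)) : ¬(l.perm σ).IsPair :=
  fun h' => h (by
    have := h'.perm σ⁻¹
    rwa [← Lab.perm_mul, inv_mul_cancel] at this)

theorem SignedPerm.Admissible.one : (1 : SignedPerm).Admissible where
  not_pair _ _ := rfl
  opp l l' _ _ := by
    change 1 = 1 * (zeroSign l * zeroSign l)
    rw [Int.units_mul_self, mul_one]
  star i := by
    change ∏ l : Lab with _, (1 : ℤˣ) = 1 * ((if i = 0 then -1 else 1) * if i = 0 then -1 else 1)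
    rw [Int.units_mul_self, Finset.prod_const_one, mul_one]

/-- A permutation maps the pairs through `i` to the pairs through `σ i`. -/
theorem prod_star_perm (f : Lab → ℤˣ) (σ : Perm (Fin 4)) (i : Fin 4) :
    ∏ l : Lab with l.IsPair ∧ l.1.mem i = true, f (l.perm σ) =
      ∏ l : Lab with l.IsPair ∧ l.1.mem (σ i) = true, f l := by
  refine Finset.prod_nbij' (Lab.perm σ) (Lab.perm σ⁻¹) ?_ ?_ ?_ ?_ ?_
  · intro l hl
    simp only [Finset.mem_filter, Finset.mem_univ, true_and] at hl ⊢
    refine ⟨hl.1.perm σ, ?_⟩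
    change (l.1.perm σ).mem (σ i) = true
    rw [Four.mem_perm, Equiv.symm_apply_apply, hl.2]
  · intro l hl
    simp only [Finset.mem_filter, Finset.mem_univ, true_and] at hl ⊢
    refine ⟨hl.1.perm _, ?_⟩
    change (l.1.perm σ⁻¹).mem i = true
    rw [Four.mem_perm]
    exact hl.2
  · intro l _
    rw [← Lab.perm_mul, inv_mul_cancel]; rfl
  · intro l _
    rw [← Lab.perm_mul, mul_inv_cancel]; rfl
  · intro l _; rfl

theorem SignedPerm.Admissible.mul {t u : SignedPerm} (ht : t.Admissible) (hu : u.Admissible) :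
    (t * u).Admissible where
  not_pair l hl := by
    change u.sign l * t.sign (l.perm u.perm) = Perm.sign (t.perm * u.perm)
    rw [hu.not_pair l hl, ht.not_pair _ (Lab.not_isPair_perm hl _), Perm.sign_mul, mul_comm]
  opp l l' hl h := by
    change u.sign l * t.sign (l.perm u.perm) * (u.sign l' * t.sign (l'.perm u.perm)) =
      Perm.sign (t.perm * u.perm) * (zeroSign l * zeroSign (l.perm (t.perm * u.perm)))
    rw [mul_mul_mul_comm, hu.opp l l' hl h, ht.opp _ _ (hl.perm _) (h.perm _), Perm.sign_mul,
      Lab.perm_mul]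
    have e := Int.units_mul_self (zeroSign (l.perm u.perm))
    generalize zeroSign (l.perm u.perm) = a at *
    calc _ = Perm.sign t.perm * Perm.sign u.perm * (zeroSign l *
          zeroSign ((l.perm u.perm).perm t.perm)) * (a * a) := by
          ac_rfl
      _ = _ := by rw [e, mul_one]
  star i := by
    change ∏ l : Lab with l.IsPair ∧ l.1.mem i = true, u.sign l * t.sign (l.perm u.perm) =
      Perm.sign (t.perm * u.perm) *
        ((if i = 0 then -1 else 1) * if t.perm (u.perm i) = 0 then -1 else 1)
    rw [Finset.prod_mul_distrib, prod_star_perm t.sign, hu.star, ht.star, Perm.sign_mul]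
    have e := Int.units_mul_self (if u.perm i = 0 then -1 else 1)
    generalize (if u.perm i = 0 then (-1 : ℤˣ) else 1) = a at *
    generalize (if i = 0 then (-1 : ℤˣ) else 1) = b at *
    generalize (if t.perm (u.perm i) = 0 then (-1 : ℤˣ) else 1) = c at *
    calc _ = Perm.sign t.perm * Perm.sign u.perm * (b * c) * (a * a) := by ac_rfl
      _ = _ := by rw [e, mul_one]

/-- The type of the dualization along the axis `k`. -/
def dualType (k : Fin 4) : SignedPerm := ⟨swap 0 k, dualSign k⟩

theorem dualType_admissible {k : Fin 4} (hk : k ≠ 0) : (dualType k).Admissible := by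
  have h₁ : ∀ k : Fin 4, k ≠ 0 → ∀ l : Lab, ¬l.IsPair → dualSign k l = Perm.sign (swap 0 k) := by
    decide +kernel
  have h₂ : ∀ k : Fin 4, k ≠ 0 → ∀ l l' : Lab, l.IsPair → l.Opp l' → dualSign k l * dualSign k l' =
      Perm.sign (swap 0 k) * (zeroSign l * zeroSign (l.perm (swap 0 k))) := by
    decide +kernel
  have h₃ : ∀ k : Fin 4, k ≠ 0 → ∀ i : Fin 4, ∏ l : Lab with l.IsPair ∧ l.1.mem i = true,
      dualSign k l = Perm.sign (swap 0 k) *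
        ((if i = 0 then -1 else 1) * if swap 0 k i = 0 then -1 else 1) := by
    decide +kernel
  exact ⟨h₁ k hk, h₂ k hk, h₃ k hk⟩

theorem dualType_mul_self {k : Fin 4} (hk : k ≠ 0) : dualType k * dualType k = 1 := by
  have h : ∀ k : Fin 4, k ≠ 0 → ∀ l : Lab, dualSign k l * dualSign k (l.perm (swap 0 k)) = 1 := by
    decide +kernel
  have e : dualType k * dualType k = ⟨swap 0 k * swap 0 k, fun l => dualSign k l *
    dualSign k (l.perm (swap 0 k))⟩ := rfl
  rw [e, swap_mul_self, funext (h k hk)]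
  rfl

/-- Admissible signs over the identity are determined by those of `{0, 1}` and `{0, 2}`. -/
theorem SignedPerm.Admissible.eq_of_perm_eq_one {t u : SignedPerm} (ht : t.Admissible)
    (hu : u.Admissible) (ht' : t.perm = 1) (hu' : u.perm = 1) (h₁ : t.sign I₀₁ = u.sign I₀₁)
    (h₂ : t.sign I₀₂ = u.sign I₀₂) : t = u := by
  have key : ∀ s : Lab → ℤˣ, SignedPerm.Admissible ⟨1, s⟩ →
      s I₀₃ = s I₀₁ * s I₀₂ ∧ s I₂₃ = s I₀₁ ∧ s I₁₃ = s I₀₂ ∧ s I₁₂ = s I₀₃ := by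
    intro s hs
    have a₁ : s I₀₁ * s I₂₃ = _ := hs.opp I₀₁ I₂₃ (by decide) (by decide)
    have a₂ : s I₀₂ * s I₁₃ = _ := hs.opp I₀₂ I₁₃ (by decide) (by decide)
    have a₃ : s I₀₃ * s I₁₂ = _ := hs.opp I₀₃ I₁₂ (by decide) (by decide)
    have a₄ : ∏ l : Lab with l.IsPair ∧ l.1.mem 0 = true, s l = _ := hs.star 0
    have e : ({l : Lab | l.IsPair ∧ l.1.mem 0 = true} : Finset Lab) = {I₀₁, I₀₂, I₀₃} := by
      decide +kernel
    rw [e, Finset.prod_insert (by decide), Finset.prod_insert (by decide),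
      Finset.prod_singleton] at a₄
    have c₁ : Perm.sign (1 : Perm (Fin 4)) * (zeroSign I₀₁ * zeroSign (Lab.perm 1 I₀₁)) = 1 := by
      decide +kernel
    have c₂ : Perm.sign (1 : Perm (Fin 4)) * (zeroSign I₀₂ * zeroSign (Lab.perm 1 I₀₂)) = 1 := by
      decide +kernel
    have c₃ : Perm.sign (1 : Perm (Fin 4)) * (zeroSign I₀₃ * zeroSign (Lab.perm 1 I₀₃)) = 1 := by
      decide +kernel
    have c₄ : Perm.sign (1 : Perm (Fin 4)) * ((if (0 : Fin 4) = 0 then -1 else 1) *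
        if (1 : Perm (Fin 4)) 0 = 0 then -1 else 1) = 1 := by
      decide +kernel
    replace a₁ := a₁.trans c₁
    replace a₂ := a₂.trans c₂
    replace a₃ := a₃.trans c₃
    replace a₄ := a₄.trans c₄
    generalize s I₀₁ = x₁ at *
    generalize s I₀₂ = x₂ at *
    generalize s I₀₃ = x₃ at *
    generalize s I₂₃ = y₁ at *
    generalize s I₁₃ = y₂ at *
    generalize s I₁₂ = y₃ at *
    clear hs
    revert x₁ x₂ x₃ y₁ y₂ y₃
    decide
  obtain ⟨σ, s⟩ := t
  obtain ⟨τ, s'⟩ := u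
  obtain rfl : σ = 1 := ht'
  obtain rfl : τ = 1 := hu'
  change s I₀₁ = s' I₀₁ at h₁
  change s I₀₂ = s' I₀₂ at h₂
  obtain ⟨k₁, k₂, k₃, k₄⟩ := key s ht
  obtain ⟨k₁', k₂', k₃', k₄'⟩ := key s' hu
  congr 1
  funext l
  by_cases hl : l.IsPair
  · have hc : ∀ l : Lab, l.IsPair → l = I₀₁ ∨ l = I₀₂ ∨ l = I₀₃ ∨ l = I₁₂ ∨ l = I₁₃ ∨ l = I₂₃ := by
      decide +kernel
    rcases hc l hl with rfl | rfl | rfl | rfl | rfl | rfl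
    · exact h₁
    · exact h₂
    · rw [k₁, k₁', h₁, h₂]
    · rw [k₄, k₄', k₁, k₁', h₁, h₂]
    · rw [k₃, k₃', h₂]
    · rw [k₂, k₂', h₁]
  · exact (ht.not_pair l hl).trans (hu.not_pair l hl).symm

end TripleVB

namespace TripleVB

open CategoryTheory Equiv

/-! ### The group generated by the dualization functors -/

theorem hasType_of_X : (FunctorClass.of X).HasType (dualType 1) := ⟨X, rfl, hasType_X⟩
theorem hasType_of_Y : (FunctorClass.of Y).HasType (dualType 2) := ⟨Y, rfl, hasType_Y⟩
theorem hasType_of_Z : (FunctorClass.of Z).HasType (dualType 3) := ⟨Z, rfl, hasType_Z⟩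

/-- The dualization functors are involutions, up to isomorphism. -/
theorem FunctorClass.HasType.mul_self {x : FunctorClass} {k : Fin 4} (h : x.HasType (dualType k))
    (hk : k ≠ 0) : x * x = 1 :=
  (h.mul h).eq (dualType_mul_self hk ▸ .one)

/-- A dualization functor as an invertible class. -/
def dualUnit {x : FunctorClass} {k : Fin 4} (h : x.HasType (dualType k)) (hk : k ≠ 0) :
    FunctorClassˣ := ⟨x, x, h.mul_self hk, h.mul_self hk⟩

/-- Every member of `DG₃` has an admissible type, since the generators do. -/
theorem exists_hasType {w : FunctorClassˣ} (hw : w ∈ DG₃) :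
    ∃ t : SignedPerm, (w : FunctorClass).HasType t ∧ t.Admissible := by
  have gen : ∀ x : FunctorClassˣ, ((x : FunctorClass) = .of X ∨ (x : FunctorClass) = .of Y ∨
      (x : FunctorClass) = .of Z) → ∃ k : Fin 4, k ≠ 0 ∧ (x : FunctorClass).HasType (dualType k) := by
    rintro x (h | h | h)
    · exact ⟨1, by decide, h ▸ hasType_of_X⟩
    · exact ⟨2, by decide, h ▸ hasType_of_Y⟩
    · exact ⟨3, by decide, h ▸ hasType_of_Z⟩
  refine Subgroup.closure_induction'' (p := fun (w : FunctorClassˣ) _ =>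
    ∃ t : SignedPerm, (w : FunctorClass).HasType t ∧ t.Admissible)
    ?_ ?_ ?_ ?_ hw
  · intro x hx
    obtain ⟨k, hk, h⟩ := gen x hx
    exact ⟨_, h, dualType_admissible hk⟩
  · intro x hx
    obtain ⟨k, hk, h⟩ := gen x hx
    have : x⁻¹ = x := inv_eq_of_mul_eq_one_left (Units.ext (h.mul_self hk))
    rw [this]
    exact ⟨_, h, dualType_admissible hk⟩
  · exact ⟨1, .one, .one⟩
  · rintro x y _ _ ⟨t, ht, ht'⟩ ⟨u, hu, hu'⟩
    exact ⟨t * u, ht.mul hu, ht'.mul hu'⟩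

/-- A type of a member of `DG₃`. Its permutation and its signs on pairs do not depend on the choice.
-/
def typeOf (w : DG₃) : SignedPerm := (exists_hasType w.2).choose

theorem hasType_typeOf (w : DG₃) : ((w : FunctorClassˣ) : FunctorClass).HasType (typeOf w) :=
  (exists_hasType w.2).choose_spec.1

theorem typeOf_admissible (w : DG₃) : (typeOf w).Admissible := (exists_hasType w.2).choose_spec.2

theorem eq_of_typeOf_eq {w w' : DG₃} (h : typeOf w = typeOf w') : w = w' :=
  Subtype.ext (Units.ext ((hasType_typeOf w).eq (h ▸ hasType_typeOf w')))

/-- The homomorphism which maps a class of functors to its permutation of the building bundles. -/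
def permHom : DG₃ →* Perm (Fin 4) where
  toFun w := (typeOf w).perm
  map_one' := ((hasType_typeOf 1).unique .one).1
  map_mul' w w' := ((hasType_typeOf (w * w')).unique ((hasType_typeOf w).mul (hasType_typeOf w'))).1

theorem permHom_eq {w : DG₃} {t : SignedPerm} (h : ((w : FunctorClassˣ) : FunctorClass).HasType t) :
    permHom w = t.perm := ((hasType_typeOf w).unique h).1

theorem exists_dual {x : FunctorClass} {k : Fin 4} (h : x.HasType (dualType k)) (hk : k ≠ 0)
    (hx : x = .of X ∨ x = .of Y ∨ x = .of Z) :
    ∃ w : DG₃, ((w : FunctorClassˣ) : FunctorClass).HasType (dualType k) :=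
  ⟨⟨dualUnit h hk, Subgroup.subset_closure hx⟩, h⟩

theorem exists_dual_of_ne {k : Fin 4} (hk : k ≠ 0) :
    ∃ w : DG₃, ((w : FunctorClassˣ) : FunctorClass).HasType (dualType k) := by
  obtain rfl | rfl | rfl : k = 1 ∨ k = 2 ∨ k = 3 := by revert k; decide
  · exact exists_dual hasType_of_X hk (.inl rfl)
  · exact exists_dual hasType_of_Y hk (.inr (.inl rfl))
  · exact exists_dual hasType_of_Z hk (.inr (.inr rfl))

/-- The transpositions `(0 k)` generate the symmetric group. -/
theorem permHom_surjective : Function.Surjective permHom := by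
  rw [← MonoidHom.range_eq_top, eq_top_iff, ← Perm.closure_isSwap, Subgroup.closure_le]
  have h : ∀ k : Fin 4, swap 0 k ∈ permHom.range := fun k => by
    by_cases hk : k = 0
    · rw [hk, swap_self]; exact one_mem _
    · obtain ⟨w, hw⟩ := exists_dual_of_ne hk
      exact ⟨w, permHom_eq hw⟩
  rintro _ ⟨i, j, hij, rfl⟩
  by_cases hi : i = 0
  · rw [hi]; exact h j
  by_cases hj : j = 0
  · rw [hj, swap_comm]; exact h i
  have e : ∀ i j : Fin 4, i ≠ j → i ≠ 0 → j ≠ 0 → swap i j = swap 0 i * swap 0 j * swap 0 i := by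
    decide +kernel
  rw [e i j hij hi hj]
  exact mul_mem (mul_mem (h i) (h j)) (h i)

theorem mul_self_of_mem_ker (w : permHom.ker) : w * w = 1 := by
  obtain ⟨w, hw⟩ := w
  have hp : (typeOf w).perm = 1 := hw
  have e : typeOf w * typeOf w = 1 := by
    change (⟨(typeOf w).perm * (typeOf w).perm, fun l =>
      (typeOf w).sign l * (typeOf w).sign (l.perm (typeOf w).perm)⟩ : SignedPerm) = ⟨1, 1⟩
    rw [hp]
    congr 1
    funext l
    exact Int.units_mul_self _
  have h := (hasType_typeOf w).mul (hasType_typeOf w)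
  rw [e] at h
  exact Subtype.ext (Subtype.ext (Units.ext (h.eq .one)))

/-- The signs of a member of the kernel of `permHom` on `{0, 1}` and `{0, 2}`, which determine it.
-/
def kerSigns (w : permHom.ker) : ℤˣ × ℤˣ := ((typeOf w.1).sign I₀₁, (typeOf w.1).sign I₀₂)

theorem kerSigns_injective : Function.Injective kerSigns := fun w w' h =>
  Subtype.ext (eq_of_typeOf_eq ((typeOf_admissible w.1).eq_of_perm_eq_one (typeOf_admissible w'.1)
    w.2 w'.2 (congrArg Prod.fst h) (congrArg Prod.snd h)))

theorem exists_kerSigns_eq {w : DG₃} {t : SignedPerm}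
    (h : ((w : FunctorClassˣ) : FunctorClass).HasType t) (ht : t.perm = 1) {a b : ℤˣ}
    (ha : t.sign I₀₁ = a) (hb : t.sign I₀₂ = b) : ∃ w, kerSigns w = (a, b) := by
  have h' := (hasType_typeOf w).unique h
  refine ⟨⟨w, h'.1.trans ht⟩, ?_⟩
  rw [← ha, ← hb, ← h'.2 I₀₁ (by decide), ← h'.2 I₀₂ (by decide)]
  rfl

/-- The four pairs of signs are those of `1`, `(XYZ)⁴`, `(XZY)⁴` and `(XYZ)⁴(XZY)⁴`. -/
theorem kerSigns_surjective : Function.Surjective kerSigns := by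
  obtain ⟨x, hx⟩ := exists_dual_of_ne (k := 1) (by decide)
  obtain ⟨y, hy⟩ := exists_dual_of_ne (k := 2) (by decide)
  obtain ⟨z, hz⟩ := exists_dual_of_ne (k := 3) (by decide)
  have mul : ∀ {u v : DG₃} {t s : SignedPerm}, ((u : FunctorClassˣ) : FunctorClass).HasType t →
      ((v : FunctorClassˣ) : FunctorClass).HasType s →
      (((u * v : DG₃) : FunctorClassˣ) : FunctorClass).HasType (t * s) := fun h k => h.mul k
  have c := mul (mul hx hy) hz
  have d := mul (mul hx hz) hy
  -- `XYZ` and `XZY` are mapped to four-cycles, so that their fourth powers are in the kernel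
  have c₄ := mul (mul c c) (mul c c)
  have d₄ := mul (mul d d) (mul d d)
  rintro ⟨a, b⟩
  obtain rfl | rfl := Int.units_eq_one_or a <;> obtain rfl | rfl := Int.units_eq_one_or b
  · exact exists_kerSigns_eq (w := 1) .one rfl rfl rfl
  · exact exists_kerSigns_eq (mul c₄ d₄) (by decide +kernel) (by decide +kernel) (by decide +kernel)
  · exact exists_kerSigns_eq c₄ (by decide +kernel) (by decide +kernel) (by decide +kernel)
  · exact exists_kerSigns_eq d₄ (by decide +kernel) (by decide +kernel) (by decide +kernel)

theorem card_ker : Nat.card permHom.ker = 4 := by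
  rw [Nat.card_congr (Equiv.ofBijective kerSigns ⟨kerSigns_injective, kerSigns_surjective⟩),
    Nat.card_prod, Nat.card_eq_fintype_card, Fintype.card_units_int]

theorem isKleinFour_ker : IsKleinFour permHom.ker where
  card_four := card_ker
  exponent_two := by
    refine (Nat.prime_two.eq_one_or_self_of_dvd _ (Monoid.exponent_dvd_of_forall_pow_eq_one
      fun w => by rw [pow_two, mul_self_of_mem_ker])).resolve_left fun h => ?_
    have := Monoid.exp_eq_one_iff.1 h
    have h' := card_ker
    rw [Nat.card_unique] at h'
    exact absurd h' (by decide)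

theorem card_DG₃ : Nat.card DG₃ = 96 := by
  rw [← permHom.ker.card_mul_index, Subgroup.index_ker, card_ker,
    MonoidHom.range_eq_top.2 permHom_surjective, Subgroup.card_top, Nat.card_perm,
    Nat.card_eq_fintype_card, Fintype.card_fin]
  rfl

end TripleVB

theorem mainTheorem1 :
    IsUnit (TripleVB.FunctorClass.of TripleVB.X) ∧
    IsUnit (TripleVB.FunctorClass.of TripleVB.Y) ∧
    IsUnit (TripleVB.FunctorClass.of TripleVB.Z) ∧
    Nat.card TripleVB.DG₃ = 96 ∧
    ∃ π : TripleVB.DG₃ →* Equiv.Perm (Fin 4),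
      (∀ (w : TripleVB.DG₃)
        (F : CategoryTheory.Functor TripleVB.TripleVectorBundle TripleVB.TripleVectorBundle),
        TripleVB.FunctorClass.of F = ((w : TripleVB.FunctorClassˣ) : TripleVB.FunctorClass) →
          ∀ E : TripleVB.TripleVectorBundle, (F.obj E).1 = E.1.perm (π w)) ∧
      (∀ w : TripleVB.DG₃, TripleVB.FunctorClass.of TripleVB.X = ((w : TripleVB.FunctorClassˣ) : TripleVB.FunctorClass) → π w = Equiv.swap 0 1) ∧
      (∀ w : TripleVB.DG₃, TripleVB.FunctorClass.of TripleVB.Y = ((w : TripleVB.FunctorClassˣ) : TripleVB.FunctorClass) → π w = Equiv.swap 0 2) ∧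
      (∀ w : TripleVB.DG₃, TripleVB.FunctorClass.of TripleVB.Z = ((w : TripleVB.FunctorClassˣ) : TripleVB.FunctorClass) → π w = Equiv.swap 0 3) ∧
      Function.Surjective π ∧
      IsKleinFour π.ker := by
  refine ⟨(TripleVB.dualUnit TripleVB.hasType_of_X (by decide)).isUnit,
    (TripleVB.dualUnit TripleVB.hasType_of_Y (by decide)).isUnit,
    (TripleVB.dualUnit TripleVB.hasType_of_Z (by decide)).isUnit, TripleVB.card_DG₃,
    TripleVB.permHom, fun w F hF E => ?_, fun w hw => ?_, fun w hw => ?_, fun w hw => ?_,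
    TripleVB.permHom_surjective, TripleVB.isKleinFour_ker⟩
  · have h := TripleVB.hasType_typeOf w
    rw [← hF] at h
    exact h.of.fst_eq E
  · exact TripleVB.permHom_eq (hw ▸ TripleVB.hasType_of_X)
  · exact TripleVB.permHom_eq (hw ▸ TripleVB.hasType_of_Y)
  · exact TripleVB.permHom_eq (hw ▸ TripleVB.hasType_of_Z)

end
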